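/- **Setting.** Let $d\in\mathbb N$, let $X\subset\mathbb R^d$ be non-empty, closed and convex, $\Pi$ the orthogonal projection onto $X$ and $b:\mathbb R^d\to\mathbb R^d$ continuous with $b(0)=0$ and $\|b(x)-b(y)\|\le L\|x-y\|$ for $x,y\in X$, where $L\ge 0$. Assume that there are $R_1,m_1^+>0$ with $\langle b(x)-b(y),x-y\rangle\le -m_1^+\|x-y\|^2$ for all $x,y\in X$ with $\|x-y\|\ge R_1$. For $\gamma>0$ put $T_\gamma(x)=x+\gamma b(x)$; let $R_\gamma$ be the Markov kernel on $X$ of the projected Euler–Maruyama scheme $X_{k+1}=\Pi(T_\gamma(X_k)+\sqrt\gamma Z_{k+1})$, with $Z_k$ i.i.d. standard Gaussian. Let $K_\gamma$ be the kernel on $X^2$ of its projected reflection coupling: with $E=T_\gamma(y)-T_\gamma(x)$, $e=E/\|E\|$, $Z$ standard Gaussian, $\tilde X=T_\gamma(x)+\sqrt\gamma Z$, one sets $\tilde Y=\tilde X$ if $E=0$; otherwise, conditionally on $Z$, $\tilde Y=\tilde X$ with probability $1\wedge\frac{\varphi_\gamma(\|E\|-\langle e,\sqrt\gamma Z\rangle)}{\varphi_\gamma(\langle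 e,\sqrt\gamma Z\rangle)}$ ($\varphi_\gamma$ the density of $N(0,\gamma)$), and $\tilde Y=T_\gamma(y)+(\mathrm{Id}-2ee^\top)\sqrt\gamma Z$ with the remaining probability; $K_\gamma((x,y),\cdot)$ is the law of $(\Pi\tilde X,\Pi\tilde Y)$. Let $\Delta=\{(x,x):x\in X\}$, $\Delta_M=\{(x,y)\in X^2:\|x-y\|\le M\}$, $V_1(x,y)=1+\|x-y\|/R_1$, $c_1=\mathbb 1_{\Delta^c}V_1$, $W_{c_1}$ the associated Wasserstein cost (infimum over transference plans), $\Phi$ the standard Gaussian distribution function, $\Xi_n(\kappa)=\gamma\sum_{k=1}^n(1+\gamma\kappa(\gamma))^{-k}$, and let one of the following hold. (I) There is $m\le 0$ with $\langle b(x)-b(y),x-y\rangle\le -m\|x-y\|^2$ on $X^2$. Put $\kappa(\gamma)=-2m+L^2\gamma$, $A=m_1^+-m$, $\Psi(\gamma,\ell,t)=2\Phi\{-t/(2\Xi^{1/2}_{\ell\lceil1/\gamma\rceil}(\kappa))\}$, and let $\bar\gamma>0$ satisfy $\bar\gamma L^2<2m_1^+$. (II) There is $m_b>0$ with $\langle b(x)-b(y),x-y\rangle\le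 -m_b\|b(x)-b(y)\|^2$ on $X^2$. Put $\kappa(\gamma)=L^2\gamma$, $A=m_1^+$; fix an integer $N\ge R_1^2$ (for instance $N=\lceil R_1\rceil^2$ or $N=\lceil R_1^2\rceil$), let $\Psi(\gamma,\ell,t)=2\Phi(-1/2)$ if $\ell\ge N$ and $t\le R_1$, and $\Psi(\gamma,\ell,t)=2\Phi\{-t/(2\Xi^{1/2}_{\ell\lceil1/\gamma\rceil}(\kappa))\}$ otherwise, and let $\bar\gamma>0$ satisfy $\bar\gamma L^2<2m_1^+$ and $\bar\gamma\le 2m_b$. Put $\lambda=\lambda_{\bar\gamma}=\exp[-(m_1^+-\bar\gamma L^2/2)/2]$. **Hypotheses of the general convergence theorem.** $\lambda\in(0,1)$, $A\ge0$, and for all $\gamma\in(0,\bar\gamma]$: $K_\gamma$ is a Markov coupling kernel for $R_\gamma$; $K_\gamma V_1\le\lambda^\gamma V_1+A\gamma\mathbb 1_{\Delta_{R_1}}$; $K_\gamma((x,x),\Delta)=1$ for $x\in X$; $\Psi(\gamma,\ell,\cdot)$ takes values in $[0,1]$ on $[0,\infty)$ and, for all integers $\ell\ge1$, all $x,y\in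 X$ and all $M\ge 0$, $K_\gamma^{\ell\lceil1/\gamma\rceil}((x,y),\Delta^c)\le1-\Psi(\gamma,\ell,\|x-y\|)$ and $\inf_{(x,y)\in\Delta_M}\Psi(\gamma,\ell,\|x-y\|)>0$. **Conclusions.** For all $\ell\ge 1$, $\gamma\in(0,\bar\gamma]$, $x,y\in X$, $k\in\mathbb N$, $$W_{c_1}(\delta_xR_\gamma^k,\delta_yR_\gamma^k)\le K_\gamma^kc_1(x,y)\le\lambda^{k\gamma/4}[D_1c_1(x,y)+D_2\mathbb 1_{\Delta^c}(x,y)]+C_1\rho^{k\gamma/4}\mathbb 1_{\Delta^c}(x,y),$$ and $W_{c_1}(\delta_xR_\gamma^k,\delta_yR_\gamma^k)\le\rho^{k\gamma/4}(D_1+D_2+C_1)c_1(x,y)$, where $$D_1=1+\tfrac{4A}{\log(1/\lambda)\lambda^{\bar\gamma}},\quad D_2=D_1A\lambda^{-(1+\bar\gamma)\ell}(1+\bar\gamma)\ell,\quad C_1=\tfrac{8A}{\log(1/\rho)\rho^{\bar\gamma}},\quad \log\rho=\frac{\log\lambda\,\log(1-\varepsilon)}{-\log c+\log(1-\varepsilon)},$$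 $c=B+A\lambda^{-(1+\bar\gamma)\ell}(1+\bar\gamma)\ell$, $B=\sup_{\Delta_{R_1}}V_1$, $\varepsilon=\inf_{\gamma\in(0,\bar\gamma],(x,y)\in\Delta_{R_1}}\Psi(\gamma,\ell,\|x-y\|)>0$. If $X$ has at least two points, $\lambda\le\rho<1$. (If $X$ is a single point, all costs vanish; in case (I) one then has $\varepsilon=1$ and reads $\rho=1$, $\log^{-1}(1/\rho)=0$.) If $\bar\gamma\le1$ and $\varepsilon\le1-e^{-1}$, then $\log^{-1}(\rho^{-1})\le[1+\log B+\log(1+2A\ell)+2\ell\log(\lambda^{-1})]/[\log(\lambda^{-1})\varepsilon]$. **Limits and explicit rates.** As $\bar\gamma\to0$, for each $\ell\ge 1$, $\lambda,D_1,D_2,\rho,C_1$ converge to limits that do not depend on $L$: they are given by the same formulas with $\bar\gamma=0$, $\lambda=e^{-m_1^+/2}$ and $\varepsilon=\inf_{(x,y)\in\Delta_{R_1}}\psi(\ell,\|x-y\|)$, where $\psi=\lim_{\gamma\to0}\Psi$ is obtained from $\Psi$ on replacing $\Xi_{\ell\lceil1/\gamma\rceil}(\kappa)$ by $(1-e^{2m\ell})/(-2m)$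 (by $\ell$ if $m=0$, and in case (II)); if $X$ has at least two points, the limit $\rho_0$ of $\rho$ satisfies $e^{-m_1^+/2}\le\rho_0<1$. Take now $\ell=\lceil R_1^2\rceil$. (I) If $R_1>1$ and $\bar\gamma\le1$, $$\log^{-1}(\rho^{-1})\le\frac{1+\log2+\log(1+2(1+R_1^2)(m_1^+-m))+2(1+R_1^2)(m_1^+-\bar\gamma L^2/2)}{(m_1^+-\bar\gamma L^2/2)\,\Phi\{-R_1/(2\Xi^{1/2}_{\lceil1/\bar\gamma\rceil}(\kappa))\}}\quad(\Xi\text{ taken at }\gamma=\bar\gamma),$$ and if $m<0$, $$\log^{-1}(\rho_0^{-1})\le\frac{1+\log2+\log(1+2(1+R_1^2)(m_1^+-m))+2(1+R_1^2)m_1^+}{m_1^+\,\Phi\{-(-m)^{1/2}R_1/(2-2e^{2mR_1^2})^{1/2}\}},$$ which also holds for $m=0$ if the argument of $\Phi$ is replaced by its limit $-1/2$. (II) If $N=\lceil R_1^2\rceil$ and $\bar\gamma\le1$, $$\log^{-1}(\rho^{-1})\le\frac{1+\log2+\log(1+2(1+R_1^2)m_1^+)+2(1+R_1^2)(m_1^+-\bar\gamma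 L^2/2)}{(m_1^+-\bar\gamma L^2/2)\Phi(-1/2)},$$ and $\log^{-1}(\rho_0^{-1})\le\frac{1+\log2}{m_1^+\Phi(-1/2)}+\frac{4(1+R_1^2)}{\Phi(-1/2)}$; in particular, if $R_1\ge1$, $\log^{-1}(\rho_0^{-1})\le\frac{9+\log2}{\Phi(-1/2)}\max(R_1^2,1/m_1^+)$. -/

import Mathlib

open MeasureTheory ProbabilityTheory Set Filter Topology
open scoped ENNReal RealInnerProductSpace

noncomputable section

namespace ProjEM

/-- `ℝ^d` with its Euclidean scalar product. -/
abbrev E (d : ℕ) := EuclideanSpace ℝ (Fin d)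

/-- The data of the projected Euler-Maruyama scheme: a non-empty closed convex set `X ⊆ ℝ^d` and a
continuous drift `b : ℝ^d → ℝ^d`. -/
structure Scheme (d : ℕ) where
  X : Set (E d)
  isClosed : IsClosed X
  convex : Convex ℝ X
  nonempty : X.Nonempty
  b : E d → E d
  continuous_b : Continuous b

namespace Scheme

variable {d : ℕ} (S : Scheme d)

/-! ### Assumptions on the drift -/

/-- `b` is `L`-Lipschitz on `X`, with `L ≥ 0`, and `b 0 = 0`. -/
def LipschitzDrift (L : ℝ) : Prop :=
  0 ≤ L ∧ (∀ x ∈ S.X, ∀ y ∈ S.X, ‖S.b x - S.b y‖ ≤ L * ‖x - y‖) ∧ S.b 0 = 0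

/-- One-sided Lipschitz condition with constant `m` (of any sign). -/
def OneSided (m : ℝ) : Prop :=
  ∀ x ∈ S.X, ∀ y ∈ S.X, ⟪S.b x - S.b y, x - y⟫ ≤ -m * ‖x - y‖ ^ 2

/-- Co-coercivity of `-b` with constant `mb > 0`. -/
def CoCoercive (mb : ℝ) : Prop :=
  0 < mb ∧ ∀ x ∈ S.X, ∀ y ∈ S.X, ⟪S.b x - S.b y, x - y⟫ ≤ -mb * ‖S.b x - S.b y‖ ^ 2

/-- Strong dissipativity at distance at least `R₁ > 0`, with constant `m₁ > 0`. -/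
def DissipativeAtInfinity (R₁ m₁ : ℝ) : Prop :=
  0 < R₁ ∧ 0 < m₁ ∧ ∀ x ∈ S.X, ∀ y ∈ S.X, R₁ ≤ ‖x - y‖ →
    ⟪S.b x - S.b y, x - y⟫ ≤ -m₁ * ‖x - y‖ ^ 2

/-! ### The orthogonal projection on `X` -/

theorem exists_nearest (z : E d) : ∃ y : S.X, ∀ w ∈ S.X, ‖(y : E d) - z‖ ≤ ‖w - z‖ := by
  obtain ⟨y, hy, h⟩ := S.isClosed.exists_infDist_eq_dist S.nonempty z
  refine ⟨⟨y, hy⟩, fun w hw => ?_⟩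
  have h1 := Metric.infDist_le_dist_of_mem (x := z) hw
  rw [h, dist_comm z y, dist_comm z w, dist_eq_norm, dist_eq_norm] at h1
  exact h1

/-- The orthogonal projection: `proj z` is the point of `X` nearest to `z`. -/
def proj (z : E d) : S.X := (S.exists_nearest z).choose

theorem proj_le (z : E d) {w : E d} (hw : w ∈ S.X) : ‖(S.proj z : E d) - z‖ ≤ ‖w - z‖ :=
  (S.exists_nearest z).choose_spec w hw

theorem inner_proj_le (z : E d) {w : E d} (hw : w ∈ S.X) :
    ⟪z - (S.proj z : E d), w - (S.proj z : E d)⟫ ≤ 0 := by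
  refine (norm_eq_iInf_iff_real_inner_le_zero S.convex (S.proj z).2).1 ?_ w hw
  have : Nonempty S.X := S.nonempty.to_subtype
  refine le_antisymm (le_ciInf fun w => ?_) (ciInf_le (f := fun w : S.X => ‖z - (w : E d)‖) ?_ _)
  · rw [norm_sub_rev, norm_sub_rev z]; exact S.proj_le z w.2
  · exact ⟨0, by rintro _ ⟨w, rfl⟩; exact norm_nonneg _⟩

theorem norm_proj_sub_le (z z' : E d) :
    ‖(S.proj z : E d) - (S.proj z' : E d)‖ ≤ ‖z - z'‖ := by
  have h1 := S.inner_proj_le z (S.proj z').2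
  have h2 := S.inner_proj_le z' (S.proj z).2
  set u : E d := (S.proj z : E d)
  set v : E d := (S.proj z' : E d)
  have h3 : ⟪u - v, u - v⟫ ≤ ⟪z - z', u - v⟫ := by
    simp only [inner_sub_left, inner_sub_right] at h1 h2 ⊢
    linarith
  rw [real_inner_self_eq_norm_sq] at h3
  have h4 := real_inner_le_norm (z - z') (u - v)
  by_contra! h
  nlinarith [norm_nonneg (z - z'), norm_nonneg (u - v)]

theorem continuous_proj : Continuous S.proj := by
  refine (LipschitzWith.of_dist_le_mul (K := 1) fun z z' => ?_).continuous
  rw [NNReal.coe_one, one_mul, Subtype.dist_eq, dist_eq_norm, dist_eq_norm]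
  exact S.norm_proj_sub_le z z'

/-! ### The Markov kernel of the scheme and its reflection coupling -/

/-- `T_γ(x) = x + γ b(x)`. -/
def T (γ : ℝ) (x : E d) : E d := x + γ • S.b x

theorem continuous_T (γ : ℝ) : Continuous (S.T γ) :=
  continuous_id.add (S.continuous_b.const_smul γ)

/-- Density at `z` of the Gaussian law on `ℝ^d` with mean `c` and covariance `γ Id`. -/
def gaussDensity (d : ℕ) (γ : ℝ) (c z : E d) : ℝ :=
  (2 * Real.pi * γ) ^ (-(d : ℝ) / 2) * Real.exp (-‖z - c‖ ^ 2 / (2 * γ))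

theorem measurable_gaussDensity {α : Type*} [MeasurableSpace α] (γ : ℝ) {f g : α → E d}
    (hf : Measurable f) (hg : Measurable g) :
    Measurable fun a => gaussDensity d γ (f a) (g a) := by
  unfold gaussDensity
  exact ((((hg.sub hf).norm.pow_const 2).neg.div_const _).exp).const_mul _

theorem measurable_map_withDensity {α β : Type*} [MeasurableSpace α] [MeasurableSpace β]
    {f : α × E d → ℝ≥0∞} {h : α × E d → β} (hf : Measurable f) (hh : Measurable h) :
    Measurable fun a => ((volume : Measure (E d)).withDensity fun z => f (a, z)).map
      fun z => h (a, z) := by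
  refine Measure.measurable_of_measurable_coe _ fun s hs => ?_
  have hh' : ∀ a, Measurable fun z => h (a, z) := fun a => hh.comp measurable_prodMk_left
  have key : ∀ a, (((volume : Measure (E d)).withDensity fun z => f (a, z)).map
      fun z => h (a, z)) s = ∫⁻ z, (h ⁻¹' s).indicator f (a, z) := by
    intro a
    rw [Measure.map_apply (hh' a) hs, withDensity_apply _ (hh' a hs),
      ← lintegral_indicator (hh' a hs)]
    rfl
  simp only [key]
  exact (hf.indicator (hh hs)).lintegral_prod_right'

/-- The Markov kernel `R_γ` of the chain `X_{k+1} = Π(T_γ(X_k) + √γ Z_{k+1})`: the image under the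
projection of the Gaussian law with mean `T_γ(x)` and covariance `γ Id`. -/
def R (γ : ℝ) : Kernel S.X S.X where
  toFun x := ((volume : Measure (E d)).withDensity fun z =>
    ENNReal.ofReal (gaussDensity d γ (S.T γ x) z)).map S.proj
  measurable' := by
    refine measurable_map_withDensity (f := fun q : S.X × E d =>
      ENNReal.ofReal (gaussDensity d γ (S.T γ q.1) q.2)) (h := fun q : S.X × E d => S.proj q.2)
      ?_ (S.continuous_proj.measurable.comp measurable_snd)
    exact (measurable_gaussDensity γ
      (((S.continuous_T γ).measurable.comp measurable_subtype_coe).comp measurable_fst)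
      measurable_snd).ennreal_ofReal

/-- `T_γ(y) - T_γ(x)`. -/
def gap (γ : ℝ) (x y : E d) : E d := S.T γ y - S.T γ x

/-- The direction `e(x, y)` of `T_γ(y) - T_γ(x)`; it is `0` if `T_γ(x) = T_γ(y)`. -/
def dir (γ : ℝ) (x y : E d) : E d := ‖S.gap γ x y‖⁻¹ • S.gap γ x y

/-- `T_γ(y) + (Id - 2 e(x, y) e(x, y)ᵀ) z`. -/
def reflected (γ : ℝ) (x y z : E d) : E d :=
  S.T γ y + (z - (2 * ⟪S.dir γ x y, z⟫) • S.dir γ x y)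

/-- The acceptance probability `p_γ(x, y, z)`, where the one-dimensional density is that of the
centred Gaussian law with variance `γ`. -/
def acceptProb (γ : ℝ) (x y z : E d) : ℝ :=
  min 1 (gaussianPDFReal 0 γ.toNNReal (‖S.gap γ x y‖ - ⟪S.dir γ x y, z⟫) /
    gaussianPDFReal 0 γ.toNNReal ⟪S.dir γ x y, z⟫)

section Measurability

variable {α : Type*} [MeasurableSpace α] (γ : ℝ) {f g h : α → E d}

theorem measurable_gap (hf : Measurable f) (hg : Measurable g) :
    Measurable fun a => S.gap γ (f a) (g a) :=
  ((S.continuous_T γ).measurable.comp hg).sub ((S.continuous_T γ).measurable.comp hf)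

theorem measurable_dir (hf : Measurable f) (hg : Measurable g) :
    Measurable fun a => S.dir γ (f a) (g a) :=
  (S.measurable_gap γ hf hg).norm.inv.smul (S.measurable_gap γ hf hg)

theorem measurable_acceptProb (hf : Measurable f) (hg : Measurable g) (hh : Measurable h) :
    Measurable fun a => S.acceptProb γ (f a) (g a) (h a) := by
  have hp := measurable_gaussianPDFReal 0 γ.toNNReal
  have hi := (S.measurable_dir γ hf hg).inner (𝕜 := ℝ) hh
  exact measurable_const.min
    ((hp.comp ((S.measurable_gap γ hf hg).norm.sub hi)).div (hp.comp hi))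

theorem measurable_reflected (hf : Measurable f) (hg : Measurable g) (hh : Measurable h) :
    Measurable fun a => S.reflected γ (f a) (g a) (h a) :=
  ((S.continuous_T γ).measurable.comp hg).add (hh.sub
    ((((S.measurable_dir γ hf hg).inner (𝕜 := ℝ) hh).const_mul 2).smul (S.measurable_dir γ hf hg)))

end Measurability

open Classical in
/-- The law of one step of the projected reflection coupling started at `(x, y)`. -/
def couplingStep (γ : ℝ) (x y : E d) : Measure (S.X × S.X) :=
  if S.T γ x = S.T γ y then
    ((volume : Measure (E d)).withDensity fun z =>
      ENNReal.ofReal (gaussDensity d γ (S.T γ x) z)).map fun z => (S.proj z, S.proj z)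
  else
    ((volume : Measure (E d)).withDensity fun z =>
      ENNReal.ofReal (S.acceptProb γ x y (z - S.T γ x) * gaussDensity d γ (S.T γ x) z)).map
        (fun z => (S.proj z, S.proj z)) +
    ((volume : Measure (E d)).withDensity fun z =>
      ENNReal.ofReal ((1 - S.acceptProb γ x y (z - S.T γ x)) * gaussDensity d γ (S.T γ x) z)).map
        (fun z => (S.proj z, S.proj (S.reflected γ x y (z - S.T γ x))))

theorem measurable_couplingStep (γ : ℝ) :
    Measurable fun q : E d × E d => S.couplingStep γ q.1 q.2 := by
  have hT := (S.continuous_T γ).measurable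
  have hP := S.continuous_proj.measurable
  have h0 : Measurable fun q : (E d × E d) × E d => q.1.1 := measurable_fst.comp measurable_fst
  have h0' : Measurable fun q : (E d × E d) × E d => q.1.2 := measurable_snd.comp measurable_fst
  have hx : Measurable fun q : (E d × E d) × E d => S.T γ q.1.1 := hT.comp h0
  have hz : Measurable fun q : (E d × E d) × E d => q.2 - S.T γ q.1.1 := measurable_snd.sub hx
  have hg := measurable_gaussDensity γ hx measurable_snd
  have ha := S.measurable_acceptProb γ h0 h0' hz
  have hr := S.measurable_reflected γ h0 h0' hz
  have hp : Measurable fun q : (E d × E d) × E d => S.proj q.2 := hP.comp measurable_snd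
  have hpr : Measurable fun q : (E d × E d) × E d =>
      S.proj (S.reflected γ q.1.1 q.1.2 (q.2 - S.T γ q.1.1)) := hP.comp hr
  have h1 := measurable_map_withDensity hg.ennreal_ofReal (hp.prodMk hp)
  have h2 := measurable_map_withDensity (ha.mul hg).ennreal_ofReal (hp.prodMk hp)
  have h3 := measurable_map_withDensity ((measurable_const (a := (1 : ℝ)).sub ha).mul
    hg).ennreal_ofReal (hp.prodMk hpr)
  have hset : MeasurableSet {q : E d × E d | S.T γ q.1 = S.T γ q.2} :=
    measurableSet_eq_fun (hT.comp measurable_fst) (hT.comp measurable_snd)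
  exact Measurable.ite hset h1 (h2.add h3)

/-- The reflection coupling kernel `K_γ` on `X × X`. -/
def K (γ : ℝ) : Kernel (S.X × S.X) (S.X × S.X) where
  toFun q := S.couplingStep γ q.1 q.2
  measurable' := (S.measurable_couplingStep γ).comp
    ((measurable_subtype_coe.comp measurable_fst).prodMk
      (measurable_subtype_coe.comp measurable_snd))

/-- The Lyapunov function `1 + ‖x - y‖ / R₁`. -/
def lyapunov (R₁ : ℝ) (q : S.X × S.X) : ℝ := 1 + ‖(q.1 : E d) - (q.2 : E d)‖ / R₁

end Scheme

/-! ### Wasserstein costs, drift and coupling conditions -/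

section General

variable {d : ℕ} {X : Set (E d)}

/-- `{(x, y) ∈ X × X : ‖x - y‖ ≤ M}`. -/
def closePairs (X : Set (E d)) (M : ℝ) : Set (X × X) := {q | ‖(q.1 : E d) - (q.2 : E d)‖ ≤ M}

/-- The complement of the diagonal of `X × X`. -/
def offDiag (X : Set (E d)) : Set (X × X) := {q | q.1 ≠ q.2}

/-- The cost equal to `V` off the diagonal and to `0` on it. -/
def cost (V : X × X → ℝ) : X × X → ℝ := (offDiag X).indicator V

/-- The Wasserstein cost: the infimum over all transference plans. -/
def wasserstein (c : X × X → ℝ) (μ ν : Measure X) : ℝ≥0∞ :=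
  ⨅ (ζ : Measure (X × X)) (_ : ζ.map Prod.fst = μ ∧ ζ.map Prod.snd = ν),
    ∫⁻ q, ENNReal.ofReal (c q) ∂ζ

/-- `K` is a Markov coupling kernel for the Markov kernel `R`. -/
def IsMarkovCoupling (K : Kernel (X × X) (X × X)) (R : Kernel X X) : Prop :=
  IsMarkovKernel R ∧ IsMarkovKernel K ∧
    ∀ x y, (K (x, y)).map Prod.fst = R x ∧ (K (x, y)).map Prod.snd = R y

/-- The discrete Foster-Lyapunov drift condition `K V ≤ lam V + A 1_C`. -/
def Drift (K : Kernel (X × X) (X × X)) (V : X × X → ℝ) (lam A : ℝ) (C : Set (X × X)) : Prop :=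
  ∀ q, ∫⁻ q', ENNReal.ofReal (V q') ∂(K q) ≤
    ENNReal.ofReal (lam * V q + C.indicator (fun _ => A) q)

/-- The hypotheses of the general convergence theorem for a family `K` of coupling kernels of the
family `R`, indexed by the step sizes in `(0, gbar]`. -/
structure ConvergenceHypotheses (R : ℝ → Kernel X X) (K : ℝ → Kernel (X × X) (X × X))
    (gbar lam A M : ℝ) (V : X × X → ℝ) (C : Set (X × X)) (Ψ : ℝ → ℕ → ℝ → ℝ) : Prop where
  lam_mem : lam ∈ Ioo (0 : ℝ) 1
  A_nonneg : 0 ≤ A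
  M_pos : 0 < M
  measurable_V : Measurable V
  one_le_V : ∀ q, 1 ≤ V q
  measurableSet_C : MeasurableSet C
  C_subset : C ⊆ closePairs X M
  coupling : ∀ γ ∈ Ioc 0 gbar, IsMarkovCoupling (K γ) (R γ)
  drift : ∀ γ ∈ Ioc 0 gbar, Drift (K γ) V (lam ^ γ) (A * γ) C
  absorbing : ∀ γ ∈ Ioc 0 gbar, ∀ x : X, K γ (x, x) (offDiag X)ᶜ = 1
  Ψ_mem : ∀ γ ∈ Ioc 0 gbar, ∀ ℓ : ℕ, 1 ≤ ℓ → ∀ t : ℝ, 0 ≤ t → Ψ γ ℓ t ∈ Icc (0 : ℝ) 1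
  minorization : ∀ γ ∈ Ioc 0 gbar, ∀ ℓ : ℕ, 1 ≤ ℓ → ∀ x y : X,
    (K γ ^ (ℓ * ⌈1 / γ⌉₊)) (x, y) (offDiag X) ≤
      ENNReal.ofReal (1 - Ψ γ ℓ ‖(x : E d) - (y : E d)‖)
  Ψ_pos : ∀ γ ∈ Ioc 0 gbar, ∀ ℓ : ℕ, 1 ≤ ℓ → ∀ M' : ℝ, 0 ≤ M' →
    ∃ δ > 0, ∀ q ∈ closePairs X M', δ ≤ Ψ γ ℓ ‖(q.1 : E d) - (q.2 : E d)‖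

/-! ### The explicit constants -/

/-- `inf {Ψ γ ℓ ‖x - y‖ : γ ∈ (0, gbar], ‖x - y‖ ≤ M}`. -/
def epsBar (X : Set (E d)) (Ψ : ℝ → ℕ → ℝ → ℝ) (gbar M : ℝ) (ℓ : ℕ) : ℝ :=
  sInf {r | ∃ γ ∈ Ioc 0 gbar, ∃ q ∈ closePairs X M, r = Ψ γ ℓ ‖(q.1 : E d) - (q.2 : E d)‖}

/-- `inf {ψ ‖x - y‖ : ‖x - y‖ ≤ M}`. -/
def epsInf (X : Set (E d)) (ψ : ℝ → ℝ) (M : ℝ) : ℝ :=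
  sInf {r | ∃ q ∈ closePairs X M, r = ψ ‖(q.1 : E d) - (q.2 : E d)‖}

/-- `sup_C V`. -/
def supOn (V : X × X → ℝ) (C : Set (X × X)) : ℝ := sSup (V '' C)

end General

/-- `D₁ = 1 + 4 A log⁻¹(1/λ) / λ^gbar`. -/
def D₁ (lam A gbar : ℝ) : ℝ := 1 + 4 * A * (Real.log (1 / lam))⁻¹ / lam ^ gbar

/-- `A λ^{-(1 + gbar) ℓ} (1 + gbar) ℓ`. -/
def burnIn (lam A gbar : ℝ) (ℓ : ℕ) : ℝ := A * lam ^ (-(1 + gbar) * ℓ) * (1 + gbar) * ℓ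

/-- `D₂ = D₁ A λ^{-(1 + gbar) ℓ} (1 + gbar) ℓ`. -/
def D₂ (lam A gbar : ℝ) (ℓ : ℕ) : ℝ := D₁ lam A gbar * burnIn lam A gbar ℓ

/-- The rate `ρ`, with `log ρ = log λ log (1 - ε) / (-log c + log (1 - ε))` and
`c = B + A λ^{-(1 + gbar) ℓ} (1 + gbar) ℓ`. -/
def rho (lam A gbar : ℝ) (ℓ : ℕ) (B ε : ℝ) : ℝ :=
  Real.exp (Real.log lam * Real.log (1 - ε) /
    (-Real.log (B + burnIn lam A gbar ℓ) + Real.log (1 - ε)))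

/-- `C₁ = 8 A log⁻¹(1/ρ) / ρ^gbar`. -/
def C₁ (A gbar ρ : ℝ) : ℝ := 8 * A * (Real.log (1 / ρ))⁻¹ / ρ ^ gbar

section General

variable {d : ℕ} {X : Set (E d)}

/-- The conclusion of the general convergence theorem for a given `ℓ`. -/
def ConvergenceConclusion (R : ℝ → Kernel X X) (K : ℝ → Kernel (X × X) (X × X))
    (gbar lam A : ℝ) (V : X × X → ℝ) (ℓ : ℕ) (B ε : ℝ) : Prop :=
  (∀ γ ∈ Ioc 0 gbar, ∀ (x y : X) (k : ℕ),
    wasserstein (cost V) ((R γ ^ k) x) ((R γ ^ k) y) ≤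
        ∫⁻ q, ENNReal.ofReal (cost V q) ∂((K γ ^ k) (x, y)) ∧
    ∫⁻ q, ENNReal.ofReal (cost V q) ∂((K γ ^ k) (x, y)) ≤ ENNReal.ofReal
      (lam ^ (k * γ / 4) * (D₁ lam A gbar * cost V (x, y) +
          D₂ lam A gbar ℓ * (offDiag X).indicator 1 (x, y)) +
        C₁ A gbar (rho lam A gbar ℓ B ε) * rho lam A gbar ℓ B ε ^ (k * γ / 4) *
          (offDiag X).indicator 1 (x, y)) ∧
    wasserstein (cost V) ((R γ ^ k) x) ((R γ ^ k) y) ≤ ENNReal.ofReal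
      (rho lam A gbar ℓ B ε ^ (k * γ / 4) *
        (D₁ lam A gbar + D₂ lam A gbar ℓ + C₁ A gbar (rho lam A gbar ℓ B ε)) *
          cost V (x, y))) ∧
  (gbar ≤ 1 → ε ≤ 1 - Real.exp (-1) →
    (Real.log (rho lam A gbar ℓ B ε)⁻¹)⁻¹ ≤
      (1 + Real.log B + Real.log (1 + 2 * A * ℓ) + 2 * ℓ * Real.log lam⁻¹) /
        (Real.log lam⁻¹ * ε))

end General

/-- The cumulative distribution function of the standard Gaussian law on `ℝ`. -/
def Φ (t : ℝ) : ℝ := cdf (gaussianReal 0 1) t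

/-- `Ξ_n(κ) = γ ∑_{k=1}^n (1 + γ κ(γ))^{-k}`. -/
def Xi (κ : ℝ → ℝ) (γ : ℝ) (n : ℕ) : ℝ :=
  γ * ∑ k ∈ Finset.Icc 1 n, ((1 + γ * κ γ) ^ k)⁻¹

/-- `κ(γ) = -2 m + L² γ`. -/
def kappa (m L : ℝ) (γ : ℝ) : ℝ := -2 * m + L ^ 2 * γ

/-- The limit of `Ξ_{ℓ ⌈1/γ⌉}` as `γ → 0`: `(1 - e^{2 m ℓ}) / (-2 m)`, that is `ℓ` if `m = 0`. -/
def XiZero (m : ℝ) (ℓ : ℕ) : ℝ :=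
  if m = 0 then ℓ else (1 - Real.exp (2 * m * ℓ)) / (-2 * m)

/-- `2 Φ(-t / (2 Ξ_{ℓ ⌈1/γ⌉}^{1/2}(κ)))` with `κ(γ) = -2 m + L² γ`. -/
def PsiOneSided (m L : ℝ) (γ : ℝ) (ℓ : ℕ) (t : ℝ) : ℝ :=
  2 * Φ (-t / (2 * √(Xi (kappa m L) γ (ℓ * ⌈1 / γ⌉₊))))

/-- The limit of `PsiOneSided` as `γ → 0`. -/
def PsiOneSidedZero (m : ℝ) (ℓ : ℕ) (t : ℝ) : ℝ := 2 * Φ (-t / (2 * √(XiZero m ℓ)))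

open Classical in
/-- The minorization function under co-coercivity, `N` being the threshold on `ℓ`. -/
def PsiCoCoercive (N : ℕ) (R₁ L : ℝ) (γ : ℝ) (ℓ : ℕ) (t : ℝ) : ℝ :=
  if N ≤ ℓ ∧ t ≤ R₁ then 2 * Φ (-1 / 2) else PsiOneSided 0 L γ ℓ t

open Classical in
/-- The limit of `PsiCoCoercive` as `γ → 0`. -/
def PsiCoCoerciveZero (N : ℕ) (R₁ : ℝ) (ℓ : ℕ) (t : ℝ) : ℝ :=
  if N ≤ ℓ ∧ t ≤ R₁ then 2 * Φ (-1 / 2) else PsiOneSidedZero 0 ℓ t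

/-- `λ = exp(-(m₁ - gbar L² / 2) / 2)`. -/
def lamBar (m₁ L gbar : ℝ) : ℝ := Real.exp (-(m₁ - gbar * L ^ 2 / 2) / 2)

namespace Scheme

variable {d : ℕ} (S : Scheme d)

/-- `B = sup {1 + ‖x - y‖ / R₁ : ‖x - y‖ ≤ R₁}`. -/
def B (R₁ : ℝ) : ℝ := supOn (S.lyapunov R₁) (closePairs S.X R₁)

/-- The rate `ρ` of the scheme for step sizes at most `gbar`. -/
def rhoBar (L R₁ m₁ A : ℝ) (Ψ : ℝ → ℕ → ℝ → ℝ) (ℓ : ℕ) (gbar : ℝ) : ℝ :=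
  rho (lamBar m₁ L gbar) A gbar ℓ (S.B R₁) (epsBar S.X Ψ gbar R₁ ℓ)

/-- The limit rate, where `λ = exp(-m₁ / 2)`, `gbar = 0` and `ψ` is the limit of `Ψ`. It does not
involve `L`. -/
def rhoZero (R₁ m₁ A : ℝ) (ψ : ℕ → ℝ → ℝ) (ℓ : ℕ) : ℝ :=
  rho (Real.exp (-m₁ / 2)) A 0 ℓ (S.B R₁) (epsInf S.X (ψ ℓ) R₁)

/-- The reflection coupling satisfies the hypotheses of the general theorem, with Lyapunov function
`1 + ‖x - y‖ / R₁` and `C = {‖x - y‖ ≤ R₁}`, and its conclusion holds for all `ℓ ≥ 1`, the rates being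
non-degenerate. -/
def Converges (L R₁ m₁ A : ℝ) (Ψ : ℝ → ℕ → ℝ → ℝ) (gbar : ℝ) : Prop :=
  ConvergenceHypotheses S.R S.K gbar (lamBar m₁ L gbar) A R₁ (S.lyapunov R₁)
      (closePairs S.X R₁) Ψ ∧
  ∀ ℓ : ℕ, 1 ≤ ℓ →
    ConvergenceConclusion S.R S.K gbar (lamBar m₁ L gbar) A (S.lyapunov R₁) ℓ (S.B R₁)
      (epsBar S.X Ψ gbar R₁ ℓ) ∧
    0 < epsBar S.X Ψ gbar R₁ ℓ ∧
    (S.X.Nontrivial → lamBar m₁ L gbar ≤ S.rhoBar L R₁ m₁ A Ψ ℓ gbar ∧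
      S.rhoBar L R₁ m₁ A Ψ ℓ gbar < 1)

/-- As `gbar → 0`, all the constants converge to explicit limits that do not involve `L`. -/
def HasLimits (L R₁ m₁ A : ℝ) (Ψ : ℝ → ℕ → ℝ → ℝ) (ψ : ℕ → ℝ → ℝ) (ℓ : ℕ) : Prop :=
  Tendsto (fun g => lamBar m₁ L g) (𝓝[>] 0) (𝓝 (Real.exp (-m₁ / 2))) ∧
  Tendsto (fun g => D₁ (lamBar m₁ L g) A g) (𝓝[>] 0) (𝓝 (D₁ (Real.exp (-m₁ / 2)) A 0)) ∧
  Tendsto (fun g => D₂ (lamBar m₁ L g) A g ℓ) (𝓝[>] 0) (𝓝 (D₂ (Real.exp (-m₁ / 2)) A 0 ℓ)) ∧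
  Tendsto (fun g => S.rhoBar L R₁ m₁ A Ψ ℓ g) (𝓝[>] 0) (𝓝 (S.rhoZero R₁ m₁ A ψ ℓ)) ∧
  Tendsto (fun g => C₁ A g (S.rhoBar L R₁ m₁ A Ψ ℓ g)) (𝓝[>] 0)
    (𝓝 (C₁ A 0 (S.rhoZero R₁ m₁ A ψ ℓ))) ∧
  (S.X.Nontrivial → Real.exp (-m₁ / 2) ≤ S.rhoZero R₁ m₁ A ψ ℓ ∧ S.rhoZero R₁ m₁ A ψ ℓ < 1)

end Scheme

end ProjEM

end

open ProjEM

/-!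
Two facts about the projected reflection coupling `K_γ` carry the theorem.

*Contraction at large distance.* The expected distance after one step is at most
`‖T_γ(y) - T_γ(x)‖` (`Scheme.lintegral_lyapunov_le`), so dissipativity at infinity gives the drift
condition for `1 + ‖x - y‖ / R₁` (`Scheme.drift_lyapunov`).

*Coupling at bounded distance.* Let `F` be odd and increasing. Only the rejected part of the
Gaussian mass contributes to `K_γ F(‖x - y‖)`, and symmetrizing under the reflection that exchanges
the two Gaussian densities turns the rejected mass into a signed Gaussian mean:
`K_γ F(‖x - y‖) ≤ E F(‖T_γ(y) - T_γ(x)‖ - 2 √γ Z)`, with equality before projection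
(`lintegral_reject_mul`, `Scheme.lintegral_K_le`). Both facts come from this inequality, the first
one with a linear `F`. For the second one, `F` is the mean sign `signMean s` of `t / 2` perturbed by
a centred Gaussian variable of variance `s`. A step adds `γ` to the variance, and the bound
`‖T_γ(y) - T_γ(x)‖² ≤ (1 + γ κ) ‖x - y‖²` divides it by `1 + γ κ`; this is the recursion satisfied
by `Ξ_n(κ)`. Starting from variance `0`, where `signMean` is the indicator of positive distances,
the probability of not having met after `n` steps is at most
`1 - 2 Φ(-‖x - y‖ / (2 Ξ_n^{1/2}))` (`Scheme.K_pow_offDiag_le`, `signMean_eq`). Under co-coercivity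
`T_γ` is nonexpansive, so `κ = 0` is admissible as well; the variance is then the elapsed time, at
least `R₁²` after `ℓ ≥ N` units, which gives the constant `2 Φ(-1/2)`.

Drift and minorization are combined without regenerative arguments
(`pow_apply_le_of_drift_of_minorization`). With `ρ = λ^θ`, the function `V^θ` contracts at rate `ρ`
outside the set `C` by Jensen's inequality. On `C`, Hölder's inequality interpolates over a block of
`ℓ ⌈1/γ⌉` steps between the growth of `V`, at most by the factor `c`, and the probability `1 - ε` of
not meeting; the exponent `θ` solves `c^θ (1 - ε)^{1 - θ} = 1`, which is the formula for `ρ`. Hence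
the probability of not having met after `k` steps is at most `ρ^{(k - n) γ} V^θ` with
`n = ℓ ⌈1/γ⌉`. Iterating the drift inequality for the cost `V` off the diagonal then gives a
convolution of this bound with `λ^{γ j}` (`lintegral_indicator_pow_le`). The explicit constants
absorb it because `A ≥ 2 log(1/λ)` (`constants_bound`, `lintegral_pow_cost_le`).

As `γ → 0`, the geometric sum `Ξ_{ℓ ⌈1/γ⌉}` converges (`tendsto_Xi`). Since `Φ` is Lipschitz, the
minorization functions converge uniformly on bounded sets, hence so do their infima and the
constants (`Scheme.hasLimits_of_tendsto`). The explicit rates follow from `-log(1 - ε) ≥ ε`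
(`inv_log_rho_inv_le`) and, uniformly in the step size, from a comparison of the `Ξ` at two step
sizes by Bernoulli's inequality (`Xi_ceil_le`).
-/

namespace ProjEM

/-! ### Absorbed Markov chains under drift and minorization -/

section Abstract

variable {α : Type*} [MeasurableSpace α]

theorem lintegral_kernel_pow_succ (K : Kernel α α) (k : ℕ) (q : α) {f : α → ℝ≥0∞}
    (hf : Measurable f) : ∫⁻ z, f z ∂((K ^ (k + 1)) q) = ∫⁻ y, ∫⁻ z, f z ∂(K y) ∂((K ^ k) q) := by
  rw [pow_succ']
  exact Kernel.lintegral_comp _ _ _ hf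

theorem kernel_pow_zero_apply (K : Kernel α α) (q : α) : (K ^ 0) q = Measure.dirac q :=
  Kernel.id_apply q

theorem kernel_pow_succ_apply_eq_lintegral (K : Kernel α α) (k : ℕ) (q : α) {s : Set α}
    (hs : MeasurableSet s) : (K ^ (k + 1)) q s = ∫⁻ z, (K ^ k) z s ∂(K q) := by
  rw [add_comm, Kernel.pow_add_apply_eq_lintegral _ _ _ _ hs, pow_one]

instance isMarkovKernel_pow (K : Kernel α α) [IsMarkovKernel K] (k : ℕ) :
    IsMarkovKernel (K ^ k) := by
  induction k with
  | zero => exact inferInstanceAs (IsMarkovKernel Kernel.id)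
  | succ k ih => rw [pow_succ]; exact inferInstanceAs (IsMarkovKernel ((K ^ k) ∘ₖ K))

variable {K : Kernel α α} {D C : Set α} {V : α → ℝ≥0∞} {l a B δ : ℝ≥0∞}

/-- The bound `k a` for the accumulated drift constants is cruder than a geometric sum; it is the
source of the factor `(1 + gbar) ℓ` in `burnIn`. -/
theorem lintegral_pow_le_of_drift (hl : l ≤ 1) (hV : Measurable V) [IsMarkovKernel K]
    (hdrift : ∀ q, ∫⁻ z, V z ∂(K q) ≤ l * V q + a) (k : ℕ) (q : α) :
    ∫⁻ z, V z ∂((K ^ k) q) ≤ l ^ k * V q + k * a := by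
  induction k with
  | zero => simp only [kernel_pow_zero_apply]; simp [lintegral_dirac' _ hV]
  | succ k ih =>
    rw [lintegral_kernel_pow_succ K k q hV]
    calc _ ≤ ∫⁻ y, (l * V y + a) ∂((K ^ k) q) := lintegral_mono fun y => hdrift y
      _ = l * ∫⁻ y, V y ∂((K ^ k) q) + a := by
        rw [lintegral_add_right _ measurable_const, lintegral_const_mul _ hV]; simp
      _ ≤ l * (l ^ k * V q + k * a) + a := by gcongr
      _ = l ^ (k + 1) * V q + l * (k * a) + a := by ring
      _ ≤ l ^ (k + 1) * V q + 1 * (k * a) + a := by gcongr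
      _ = _ := by push_cast; ring

theorem pow_apply_eq_zero_of_absorbing (hD : MeasurableSet D) (habs : ∀ q ∉ D, K q D = 0) (k : ℕ)
    {q : α} (hq : q ∉ D) : (K ^ k) q D = 0 := by
  induction k generalizing q with
  | zero => simp only [kernel_pow_zero_apply]; simp [Measure.dirac_apply' _ hD, hq]
  | succ k ih =>
    rw [kernel_pow_succ_apply_eq_lintegral _ _ _ hD]
    have h0 : ∀ᵐ z ∂(K q), z ∉ D := by
      rw [ae_iff]; simpa using habs q hq
    rw [lintegral_congr_ae (h0.mono fun z hz => ih hz), lintegral_zero]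

/-- The drift and the minorization combine into a geometric bound for the probability of not having
been absorbed: outside `C` the power `V ^ θ` of the Lyapunov function contracts by Jensen's
inequality, and on `C` the `n`-step bound follows from Hölder's inequality, which interpolates
between the growth of `V` and the probability `δ` of not being absorbed. -/
theorem pow_apply_le_of_drift_of_minorization [IsMarkovKernel K] (hD : MeasurableSet D)
    (habs : ∀ q ∉ D, K q D = 0) (hV : Measurable V) (hV1 : ∀ q, 1 ≤ V q)
    (hl : l ≤ 1) (hdrift : ∀ q, ∫⁻ z, V z ∂(K q) ≤ l * V q + C.indicator (fun _ => a) q)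
    (hB : ∀ q ∈ C, V q ≤ B) {n : ℕ} (hn : 1 ≤ n) (hmin : ∀ q ∈ C, (K ^ n) q D ≤ δ)
    {θ : ℝ} (h0 : 0 < θ) (h1 : θ < 1)
    (hθ : (l ^ n * B + n * a) ^ θ * δ ^ (1 - θ) ≤ (l ^ θ) ^ n) (k : ℕ) (q : α) :
    (K ^ k) q D * (l ^ θ) ^ n ≤ (l ^ θ) ^ k * V q ^ θ := by
  have hl' : l ^ θ ≤ 1 := ENNReal.rpow_le_one hl h0.le
  have hVθ : ∀ q, 1 ≤ V q ^ θ := fun q => ENNReal.one_le_rpow (hV1 q) h0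
  have hDk : ∀ k, Measurable fun z => (K ^ k) z D := fun k => Kernel.measurable_coe _ hD
  induction k using Nat.strong_induction_on generalizing q with
  | _ k ih =>
  by_cases hqC : q ∈ C
  · rcases lt_or_ge k n with hk | hk
    · calc (K ^ k) q D * (l ^ θ) ^ n ≤ 1 * (l ^ θ) ^ k :=
            mul_le_mul' prob_le_one (pow_le_pow_right_of_le_one' hl' hk.le)
        _ = (l ^ θ) ^ k * 1 := mul_comm _ _
        _ ≤ _ := by gcongr; exact hVθ q
    · obtain ⟨j, rfl⟩ := Nat.exists_eq_add_of_le hk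
      have hj : j < n + j := by omega
      have hle : ∀ z, (K ^ j) z D * (l ^ θ) ^ n ≤
          (l ^ θ) ^ j * (V z ^ θ * (D.indicator 1 z : ℝ≥0∞) ^ (1 - θ)) := by
        intro z
        by_cases hz : z ∈ D
        · simpa [hz] using ih j hj z
        · simp [pow_apply_eq_zero_of_absorbing hD habs j hz]
      calc (K ^ (n + j)) q D * (l ^ θ) ^ n
          = ∫⁻ z, (K ^ j) z D * (l ^ θ) ^ n ∂((K ^ n) q) := by
            rw [Kernel.pow_add_apply_eq_lintegral _ _ _ _ hD,
              lintegral_mul_const _ (hDk j)]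
        _ ≤ ∫⁻ z, (l ^ θ) ^ j * (V z ^ θ * (D.indicator 1 z : ℝ≥0∞) ^ (1 - θ)) ∂((K ^ n) q) :=
            lintegral_mono hle
        _ = (l ^ θ) ^ j * ∫⁻ z, V z ^ θ * (D.indicator 1 z : ℝ≥0∞) ^ (1 - θ) ∂((K ^ n) q) := by
            rw [lintegral_const_mul]
            exact (hV.pow_const _).mul ((measurable_one.indicator hD).pow_const _)
        _ ≤ (l ^ θ) ^ j * ((∫⁻ z, V z ∂((K ^ n) q)) ^ θ *
              (∫⁻ z, D.indicator 1 z ∂((K ^ n) q)) ^ (1 - θ)) := by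
            gcongr
            exact ENNReal.lintegral_mul_norm_pow_le hV.aemeasurable
              (measurable_one.indicator hD).aemeasurable h0.le (by linarith) (by ring)
        _ ≤ (l ^ θ) ^ j * ((l ^ n * B + n * a) ^ θ * δ ^ (1 - θ)) := by
            have hdrift' : ∀ q, ∫⁻ z, V z ∂(K q) ≤ l * V q + a := fun q =>
              (hdrift q).trans (by gcongr; exact indicator_le_self' (fun _ _ => zero_le) q)
            rw [lintegral_indicator_one hD]
            gcongr
            · exact (lintegral_pow_le_of_drift hl hV hdrift' n q).trans (by gcongr; exact hB q hqC)
            · exact hmin q hqC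
        _ ≤ (l ^ θ) ^ j * (l ^ θ) ^ n := by gcongr
        _ = (l ^ θ) ^ (n + j) * 1 := by rw [mul_one, add_comm, pow_add]
        _ ≤ _ := by gcongr; exact hVθ q
  · rcases k with _ | k
    · calc (K ^ 0) q D * (l ^ θ) ^ n ≤ 1 * 1 :=
            mul_le_mul' prob_le_one (pow_le_one' hl' n)
        _ ≤ _ := by simpa using hVθ q
    · have hdq : ∫⁻ z, V z ∂(K q) ≤ l * V q := by simpa [hqC] using hdrift q
      calc (K ^ (k + 1)) q D * (l ^ θ) ^ n
          = ∫⁻ z, (K ^ k) z D * (l ^ θ) ^ n ∂(K q) := by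
            rw [kernel_pow_succ_apply_eq_lintegral _ _ _ hD, lintegral_mul_const _ (hDk k)]
        _ ≤ ∫⁻ z, (l ^ θ) ^ k * (V z ^ θ * (1 : ℝ≥0∞) ^ (1 - θ)) ∂(K q) :=
            lintegral_mono fun z => by simpa using ih k (by omega) z
        _ = (l ^ θ) ^ k * ∫⁻ z, V z ^ θ * (1 : ℝ≥0∞) ^ (1 - θ) ∂(K q) := by
            rw [lintegral_const_mul]
            exact (hV.pow_const _).mul measurable_const
        _ ≤ (l ^ θ) ^ k * ((∫⁻ z, V z ∂(K q)) ^ θ * (∫⁻ z, 1 ∂(K q)) ^ (1 - θ)) := by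
            gcongr
            exact ENNReal.lintegral_mul_norm_pow_le hV.aemeasurable
              aemeasurable_const h0.le (by linarith) (by ring)
        _ ≤ (l ^ θ) ^ k * ((l * V q) ^ θ * 1) := by
            simp only [lintegral_one, measure_univ, ENNReal.one_rpow]
            gcongr
        _ = _ := by rw [mul_one, ENNReal.mul_rpow_of_nonneg _ _ h0.le]; ring

/-- Iterated drift inequality for the cost `V` restricted to the transient set `D`. -/
theorem lintegral_indicator_pow_le [IsMarkovKernel K] (hD : MeasurableSet D)
    (habs : ∀ q ∉ D, K q D = 0) (hV : Measurable V)
    (hdrift : ∀ q, ∫⁻ z, V z ∂(K q) ≤ l * V q + a) (k : ℕ) {q : α} (hq : q ∈ D) :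
    ∫⁻ z, D.indicator V z ∂((K ^ k) q) ≤
      l ^ k * V q + a * ∑ j ∈ Finset.range k, l ^ (k - 1 - j) * (K ^ j) q D := by
  induction k with
  | zero =>
    rw [kernel_pow_zero_apply]
    simp [lintegral_dirac' _ (hV.indicator hD), hq]
  | succ k ih =>
    have hle : ∀ y, ∫⁻ z, D.indicator V z ∂(K y) ≤
        l * D.indicator V y + a * D.indicator 1 y := by
      intro y
      by_cases hy : y ∈ D
      · simp only [hy, indicator_of_mem, Pi.one_apply, mul_one]
        exact (lintegral_mono (indicator_le_self' fun _ _ => zero_le)).trans (hdrift y)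
      · rw [lintegral_indicator hD, setLIntegral_measure_zero _ _ (habs y hy)]
        exact zero_le
    rw [lintegral_kernel_pow_succ K k q (hV.indicator hD)]
    calc _ ≤ ∫⁻ y, (l * D.indicator V y + a * D.indicator 1 y) ∂((K ^ k) q) := lintegral_mono hle
      _ = l * ∫⁻ y, D.indicator V y ∂((K ^ k) q) + a * (K ^ k) q D := by
        rw [lintegral_add_left ((hV.indicator hD).const_mul _),
          lintegral_const_mul _ (hV.indicator hD),
          lintegral_const_mul _ (measurable_one.indicator hD), lintegral_indicator_one hD]
      _ ≤ l * (l ^ k * V q + a * ∑ j ∈ Finset.range k, l ^ (k - 1 - j) * (K ^ j) q D) +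
          a * (K ^ k) q D := by gcongr
      _ = _ := by
        have hs : l * ∑ j ∈ Finset.range k, l ^ (k - 1 - j) * (K ^ j) q D =
            ∑ j ∈ Finset.range k, l ^ (k - j) * (K ^ j) q D := by
          rw [Finset.mul_sum]
          refine Finset.sum_congr rfl fun j hj => ?_
          have := Finset.mem_range.1 hj
          rw [← mul_assoc, ← pow_succ', show k - 1 - j + 1 = k - j by omega]
        rw [Finset.sum_range_succ, Nat.add_sub_cancel, Nat.sub_self, pow_zero, one_mul, ← hs]
        ring

end Abstract

/-! ### The explicit constants -/

/-- Two geometric sequences, one decaying four times faster, have a convolution decaying like the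
slower one. -/
theorem sum_exp_convolution_le {w γ : ℝ} (hw : 0 < w) (hγ : 0 < γ) (k : ℕ) :
    γ * ∑ j ∈ Finset.range k, (Real.exp (-w * γ / 4) ^ 4) ^ (k - 1 - j) *
        Real.exp (-w * γ / 4) ^ j ≤
      4 / 3 * w⁻¹ * Real.exp (w * γ) * Real.exp (-w * γ / 4) ^ k := by
  set s := Real.exp (-w * γ / 4) with hs
  have hs0 : 0 < s := Real.exp_pos _
  have hs1 : s < 1 := Real.exp_lt_one_iff.2 (by nlinarith [mul_pos hw hγ])
  have hs3 : s ^ 3 < 1 := pow_lt_one₀ hs0.le hs1 (by norm_num)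
  have hsum : ∑ j ∈ Finset.range k, (s ^ 4) ^ (k - 1 - j) * s ^ j * s ≤ s ^ k * (1 - s ^ 3)⁻¹ := by
    calc ∑ j ∈ Finset.range k, (s ^ 4) ^ (k - 1 - j) * s ^ j * s
        = ∑ j ∈ Finset.range k, s ^ k * (s ^ 3) ^ (k - 1 - j) := by
          refine Finset.sum_congr rfl fun j hj => ?_
          obtain ⟨i, rfl⟩ := Nat.exists_eq_add_of_lt (Finset.mem_range.1 hj)
          rw [show j + i + 1 - 1 - j = i by omega]
          ring
      _ = s ^ k * ∑ j ∈ Finset.range k, (s ^ 3) ^ j := by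
          rw [← Finset.mul_sum, Finset.sum_range_reflect (fun i => (s ^ 3) ^ i)]
      _ ≤ s ^ k * (1 - s ^ 3)⁻¹ := by
          gcongr
          rw [← tsum_geometric_of_lt_one (by positivity) hs3]
          exact (summable_geometric_of_lt_one (by positivity) hs3).sum_le_tsum _
            fun _ _ => by positivity
  rw [← Finset.sum_mul] at hsum
  have hs4 : Real.exp (w * γ) * s ^ 4 = 1 := by
    rw [hs, ← Real.exp_nat_mul, ← Real.exp_add]
    simp only [Real.exp_eq_one_iff]; push_cast; ring
  have h3 : s ^ 3 * (3 / 4 * w * γ) ≤ 1 - s ^ 3 := by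
    have h := Real.add_one_le_exp (3 / 4 * w * γ)
    have h' : s ^ 3 * Real.exp (3 / 4 * w * γ) = 1 := by
      rw [hs, ← Real.exp_nat_mul, ← Real.exp_add]
      simp only [Real.exp_eq_one_iff]; push_cast; ring
    nlinarith [pow_pos hs0 3]
  have h4 : γ * (1 - s ^ 3)⁻¹ ≤ 4 / 3 * w⁻¹ * (s ^ 3)⁻¹ := by
    have h : (1 - s ^ 3)⁻¹ ≤ (s ^ 3 * (3 / 4 * w * γ))⁻¹ := inv_anti₀ (by positivity) h3
    calc γ * (1 - s ^ 3)⁻¹ ≤ γ * (s ^ 3 * (3 / 4 * w * γ))⁻¹ := by gcongr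
      _ = _ := by field_simp
  set S₀ := ∑ j ∈ Finset.range k, (s ^ 4) ^ (k - 1 - j) * s ^ j
  have hexp : Real.exp (w * γ) = (s ^ 4)⁻¹ := eq_inv_of_mul_eq_one_left hs4
  calc γ * S₀ = γ * (S₀ * s) * s⁻¹ := by field_simp
    _ ≤ γ * (s ^ k * (1 - s ^ 3)⁻¹) * s⁻¹ := by gcongr
    _ = s ^ k * s⁻¹ * (γ * (1 - s ^ 3)⁻¹) := by ring
    _ ≤ s ^ k * s⁻¹ * (4 / 3 * w⁻¹ * (s ^ 3)⁻¹) := by gcongr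
    _ = _ := by rw [hexp]; field_simp

/-- Splits a geometric bound with the prefactor `(V Λ) ^ θ` into a term of rate `p` that is linear
in `V` and `Λ` and a term of rate `p ^ θ` with prefactor `1`. The price is the fourth root of the
rate. -/
theorem le_of_le_rpow_of_le_one {U V Λ p θ : ℝ} (hU : U ≤ 1) (hV : 0 ≤ V) (hΛ : 0 ≤ Λ)
    (hp : 0 < p) (hp1 : p ≤ 1) (hθ : 0 < θ) (h : U ≤ (p ^ 4 * V * Λ) ^ θ) :
    U ≤ p * (V + Λ) + p ^ θ := by
  have hpθ : 0 < p ^ θ := Real.rpow_pos_of_pos hp θ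
  rcases le_or_gt 1 (p * V) with h1 | h1
  · nlinarith [mul_nonneg hp.le hΛ]
  rcases le_or_gt 1 (p * Λ) with h2 | h2
  · nlinarith [mul_nonneg hp.le hV]
  have h3 : p ^ 4 * V * Λ ≤ p := by
    calc p ^ 4 * V * Λ = p ^ 2 * ((p * V) * (p * Λ)) := by ring
      _ ≤ p ^ 2 * (1 * 1) := by gcongr
      _ ≤ p := by nlinarith
  have h4 : (p ^ 4 * V * Λ) ^ θ ≤ p ^ θ := Real.rpow_le_rpow (by positivity) h3 hθ.le
  nlinarith [mul_nonneg hp.le hΛ, mul_nonneg hp.le hV]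

/-- The exponent `θ` for which `ρ = λ ^ θ`. -/
noncomputable def interpExp (c ε : ℝ) : ℝ := Real.log (1 - ε) / (Real.log (1 - ε) - Real.log c)

theorem interpExp_mem {c ε : ℝ} (hc : 1 < c) (hε : ε ∈ Ioo (0 : ℝ) 1) :
    interpExp c ε ∈ Ioo (0 : ℝ) 1 := by
  have h1 : Real.log (1 - ε) < 0 := Real.log_neg (by linarith [hε.2]) (by linarith [hε.1])
  have h2 := Real.log_pos hc
  unfold interpExp
  constructor
  · exact div_pos_of_neg_of_neg h1 (by linarith)
  · rw [div_lt_one_of_neg (by linarith)]; linarith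

/-- The equation determining `θ`: the growth `c` of the Lyapunov function and the probability
`1 - ε` of not meeting balance. -/
theorem rpow_interpExp_mul {c ε : ℝ} (hc : 1 < c) (hε : ε ∈ Ioo (0 : ℝ) 1) :
    c ^ interpExp c ε * (1 - ε) ^ (1 - interpExp c ε) = 1 := by
  have h1 : Real.log (1 - ε) < 0 := Real.log_neg (by linarith [hε.2]) (by linarith [hε.1])
  have h2 := Real.log_pos hc
  have h3 : Real.log (1 - ε) - Real.log c ≠ 0 := by linarith
  rw [Real.rpow_def_of_pos (by linarith), Real.rpow_def_of_pos (by linarith [hε.2]),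
    ← Real.exp_add, Real.exp_eq_one_iff]
  unfold interpExp
  field_simp
  ring

theorem rho_eq_rpow {lam A gbar B ε : ℝ} {ℓ : ℕ} (hlam : 0 < lam) :
    rho lam A gbar ℓ B ε = lam ^ interpExp (B + burnIn lam A gbar ℓ) ε := by
  rw [Real.rpow_def_of_pos hlam, rho, interpExp, mul_div_assoc, neg_add_eq_sub]

theorem burnIn_pos {lam A gbar : ℝ} {ℓ : ℕ} (hlam : 0 < lam) (hA : 0 < A) (hg : 0 ≤ gbar)
    (hℓ : 1 ≤ ℓ) : 0 < burnIn lam A gbar ℓ := by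
  have : (0 : ℝ) < ℓ := by exact_mod_cast hℓ
  have := Real.rpow_pos_of_pos hlam (-(1 + gbar) * ℓ)
  unfold burnIn; positivity

theorem rho_mem {lam A gbar B ε : ℝ} {ℓ : ℕ} (hlam : lam ∈ Ioo (0 : ℝ) 1) (hA : 0 < A)
    (hg : 0 ≤ gbar) (hℓ : 1 ≤ ℓ) (hB : 1 ≤ B) (hε : ε ∈ Ioo (0 : ℝ) 1) :
    lam ≤ rho lam A gbar ℓ B ε ∧ rho lam A gbar ℓ B ε < 1 := by
  have hc := burnIn_pos (ℓ := ℓ) hlam.1 hA hg hℓ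
  have hθ := interpExp_mem (c := B + burnIn lam A gbar ℓ) (by linarith) hε
  rw [rho_eq_rpow hlam.1]
  refine ⟨?_, Real.rpow_lt_one hlam.1.le hlam.2 hθ.1⟩
  conv_lhs => rw [← Real.rpow_one lam]
  exact Real.rpow_le_rpow_of_exponent_ge hlam.1 hlam.2.le hθ.2.le

theorem mul_ceil_one_div_le {γ : ℝ} (hγ : 0 < γ) : γ * ⌈1 / γ⌉₊ ≤ 1 + γ := by
  have h := (Nat.ceil_lt_add_one (one_div_pos.2 hγ).le).le
  calc γ * ⌈1 / γ⌉₊ ≤ γ * (1 / γ + 1) := by gcongr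
    _ = 1 + γ := by field_simp

theorem one_le_mul_ceil_one_div {γ : ℝ} (hγ : 0 < γ) : 1 ≤ γ * ⌈1 / γ⌉₊ := by
  calc (1 : ℝ) = γ * (1 / γ) := by field_simp
    _ ≤ γ * ⌈1 / γ⌉₊ := by gcongr; exact Nat.le_ceil _

theorem one_le_ceil_one_div {γ : ℝ} (hγ : 0 < γ) : 1 ≤ ⌈1 / γ⌉₊ :=
  Nat.one_le_ceil_iff.2 (one_div_pos.2 hγ)

/-- Absorption of the drift constant `A` and of the burn-in factor into the explicit constants. The
assumption `2 log (1 / λ) ≤ A` says that the drift constant is not small compared to the rate. -/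
theorem constants_bound {lam A gbar V w ρ sk ρk : ℝ} {ℓ : ℕ} (hlam : lam ∈ Ioo (0 : ℝ) 1)
    (hw : w = Real.log (1 / lam)) (hA : 2 * w ≤ A) (hg : 0 ≤ gbar)
    (hV : 1 ≤ V) (hρ : ρ ∈ Ioo (0 : ℝ) 1) (hsk : 0 ≤ sk) (hρk : 0 ≤ ρk) :
    sk * V + A * (4 / 3 * w⁻¹ / lam ^ gbar) * sk * (V + lam ^ (-(1 + gbar) * ℓ)) +
        A * (4 / 3 * (Real.log (1 / ρ))⁻¹ / ρ ^ gbar) * ρk ≤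
      sk * (D₁ lam A gbar * V + D₂ lam A gbar ℓ) + C₁ A gbar ρ * ρk := by
  have hw0 : 0 < w := by rw [hw]; exact Real.log_pos (one_lt_one_div hlam.1 hlam.2)
  have hA0 : 0 < A := by linarith
  have hp := Real.rpow_pos_of_pos hlam.1 gbar
  have hw' : 0 < Real.log (1 / ρ) := Real.log_pos (one_lt_one_div hρ.1 hρ.2)
  have hp' := Real.rpow_pos_of_pos hρ.1 gbar
  set Λ := lam ^ (-(1 + gbar) * ℓ) with hΛ
  set s := (1 + gbar) * ℓ with hs
  have hs0 : 0 ≤ s := by positivity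
  have hΛ0 : 0 < Λ := Real.rpow_pos_of_pos hlam.1 _
  have hΛ1 : Λ ≤ 1 + w * s * Λ := by
    have h := Real.add_one_le_exp (-(w * s))
    have hΛe : Λ = Real.exp (w * s) := by
      rw [hΛ, Real.rpow_def_of_pos hlam.1, hw, one_div, Real.log_inv, hs]; congr 1; ring
    have : Real.exp (-(w * s)) * Λ = 1 := by
      rw [hΛe, ← Real.exp_add]; simp
    nlinarith
  set G := w⁻¹ / lam ^ gbar with hG
  have hG0 : 0 < G := by positivity
  have hD : D₁ lam A gbar = 1 + 4 * A * G := by rw [D₁, ← hw, hG]; ring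
  have hD2 : D₂ lam A gbar ℓ = (1 + 4 * A * G) * (A * Λ * s) := by
    rw [D₂, hD, burnIn, hs]; ring
  have h1 : V + A * (4 / 3 * G) * (V + Λ) ≤
      (1 + 4 * A * G) * V + (1 + 4 * A * G) * (A * Λ * s) := by
    have e1 : A * (4 / 3 * G) * Λ ≤ A * (4 / 3 * G) * (V + w * s * Λ) := by gcongr; linarith
    have e2 : A * (4 / 3 * G) * (w * s * Λ) ≤ A * (4 / 3 * G) * (A * s * Λ) := by
      gcongr; linarith
    have e3 : 0 ≤ A * G * (A * s * Λ) := by positivity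
    have e4 : 0 ≤ A * s * Λ := by positivity
    have e5 : 0 ≤ A * G * V := by positivity
    nlinarith
  have h2 : A * (4 / 3 * (Real.log (1 / ρ))⁻¹ / ρ ^ gbar) * ρk ≤ C₁ A gbar ρ * ρk := by
    unfold C₁
    gcongr
    have : 0 ≤ A * (Real.log (1 / ρ))⁻¹ / ρ ^ gbar := by positivity
    calc A * (4 / 3 * (Real.log (1 / ρ))⁻¹ / ρ ^ gbar)
        = 4 / 3 * (A * (Real.log (1 / ρ))⁻¹ / ρ ^ gbar) := by ring
      _ ≤ 8 * (A * (Real.log (1 / ρ))⁻¹ / ρ ^ gbar) := by gcongr; norm_num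
      _ = _ := by ring
  have h3 := mul_le_mul_of_nonneg_left h1 hsk
  rw [hD, hD2]
  calc _ = sk * (V + A * (4 / 3 * G) * (V + Λ)) +
        A * (4 / 3 * (Real.log (1 / ρ))⁻¹ / ρ ^ gbar) * ρk := by rw [hG]; ring
    _ ≤ _ := by linarith

theorem inv_rpow_eq_exp {r g : ℝ} (hr : 0 < r) : (r ^ g)⁻¹ = Real.exp (Real.log (1 / r) * g) := by
  rw [Real.rpow_def_of_pos hr, ← Real.exp_neg, one_div, Real.log_inv, neg_mul]

section Abstract

variable {α : Type*} [MeasurableSpace α] {K : Kernel α α} {D C : Set α} {V : α → ℝ}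

/-- Quantitative convergence of an absorbed Markov chain under a drift and a minorization condition,
stated for one time step `γ`. -/
theorem lintegral_pow_cost_le [IsMarkovKernel K] (hD : MeasurableSet D)
    (habs : ∀ q ∉ D, K q D = 0) (hV : Measurable V) (hV1 : ∀ q, 1 ≤ V q)
    {lam A gbar γ B ε : ℝ} {ℓ : ℕ} (hlam : lam ∈ Ioo (0 : ℝ) 1)
    (hA : 2 * Real.log (1 / lam) ≤ A) (hγ : γ ∈ Ioc 0 gbar) (hℓ : 1 ≤ ℓ)
    (hdrift : ∀ q, ∫⁻ z, ENNReal.ofReal (V z) ∂(K q) ≤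
      ENNReal.ofReal (lam ^ γ * V q + C.indicator (fun _ => A * γ) q))
    (hB1 : 1 ≤ B) (hB : ∀ q ∈ C, V q ≤ B) (hε : ε ∈ Ioo (0 : ℝ) 1)
    (hmin : ∀ q ∈ C, (K ^ (ℓ * ⌈1 / γ⌉₊)) q D ≤ ENNReal.ofReal (1 - ε)) (k : ℕ) {q : α}
    (hq : q ∈ D) :
    ∫⁻ z, ENNReal.ofReal (D.indicator V z) ∂((K ^ k) q) ≤ ENNReal.ofReal
      (lam ^ (k * γ / 4) * (D₁ lam A gbar * V q + D₂ lam A gbar ℓ) +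
        C₁ A gbar (rho lam A gbar ℓ B ε) * rho lam A gbar ℓ B ε ^ (k * γ / 4)) := by
  obtain ⟨hγ0, hγg⟩ := hγ
  have hg : 0 ≤ gbar := hγ0.le.trans hγg
  set w := Real.log (1 / lam) with hw
  have hw0 : 0 < w := Real.log_pos (one_lt_one_div hlam.1 hlam.2)
  have hA0 : 0 < A := by linarith
  set n := ℓ * ⌈1 / γ⌉₊ with hn
  have hn1 : 1 ≤ n := Nat.mul_pos hℓ (one_le_ceil_one_div hγ0)
  have hγn : γ * n ≤ (1 + gbar) * ℓ := by
    have := mul_ceil_one_div_le hγ0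
    rw [hn]; push_cast
    calc γ * (ℓ * ⌈1 / γ⌉₊) = (γ * ⌈1 / γ⌉₊) * ℓ := by ring
      _ ≤ (1 + gbar) * ℓ := by gcongr; linarith
  set c := B + burnIn lam A gbar ℓ with hc
  have hbi := burnIn_pos (ℓ := ℓ) hlam.1 hA0 hg hℓ
  have hc1 : 1 < c := by linarith
  set θ := interpExp c ε with hθd
  have hθ := interpExp_mem hc1 hε
  have hρm := rho_mem (ℓ := ℓ) hlam hA0 hg hℓ hB1 hε
  have hρe : rho lam A gbar ℓ B ε = lam ^ θ := rho_eq_rpow hlam.1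
  set ρ := rho lam A gbar ℓ B ε with hρd
  have hρ0 : 0 < ρ := hlam.1.trans_le hρm.1
  set Λ := lam ^ (-(1 + gbar) * ℓ) with hΛ
  have hΛ0 : 0 < Λ := Real.rpow_pos_of_pos hlam.1 _
  set l := lam ^ γ with hl
  have hl0 : 0 < l := Real.rpow_pos_of_pos hlam.1 _
  have hl1 : l ≤ 1 := Real.rpow_le_one hlam.1.le hlam.2.le hγ0.le
  set s := Real.exp (-w * γ / 4) with hs
  have hs0 : 0 < s := Real.exp_pos _
  have hs1 : s ≤ 1 := Real.exp_le_one_iff.2 (by nlinarith [mul_pos hw0 hγ0])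
  have hlog : Real.log lam = -w := by rw [hw, one_div, Real.log_inv, neg_neg]
  have hls : l = s ^ 4 := by
    rw [hl, Real.rpow_def_of_pos hlam.1, hs, ← Real.exp_nat_mul, hlog]; push_cast; congr 1; ring
  have hlk : ∀ j : ℕ, lam ^ (j * γ / 4) = s ^ j := fun j => by
    rw [Real.rpow_def_of_pos hlam.1, hs, ← Real.exp_nat_mul, hlog]; congr 1; ring
  -- the block length `n` is at most `(1 + gbar) ℓ / γ`, so `Λ` compensates the decay over a block
  have hlΛ : 1 ≤ l ^ n * Λ := by
    rw [hl, hΛ, ← Real.rpow_natCast, ← Real.rpow_mul hlam.1.le, ← Real.rpow_add hlam.1]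
    exact Real.one_le_rpow_of_pos_of_le_one_of_nonpos hlam.1 hlam.2.le (by linarith)
  -- over one block the Hölder bound loses nothing, by the choice of `θ`
  have hθE : (ENNReal.ofReal l ^ n * ENNReal.ofReal B + n * ENNReal.ofReal (A * γ)) ^ θ *
      ENNReal.ofReal (1 - ε) ^ (1 - θ) ≤ (ENNReal.ofReal l ^ θ) ^ n := by
    have hin : l ^ n * B + n * (A * γ) ≤ l ^ n * c := by
      have h1 : n * (A * γ) ≤ l ^ n * burnIn lam A gbar ℓ := by
        calc n * (A * γ) = A * (γ * n) := by ring
          _ ≤ A * ((1 + gbar) * ℓ) * 1 := by rw [mul_one]; gcongr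
          _ ≤ A * ((1 + gbar) * ℓ) * (l ^ n * Λ) := by gcongr
          _ = _ := by rw [burnIn]; ring
      rw [hc]; linarith
    have hεp : 0 < 1 - ε := by linarith [hε.2]
    have hreal : (l ^ n * B + n * (A * γ)) ^ θ * (1 - ε) ^ (1 - θ) ≤ (l ^ θ) ^ n := by
      calc (l ^ n * B + n * (A * γ)) ^ θ * (1 - ε) ^ (1 - θ)
          ≤ (l ^ n * c) ^ θ * (1 - ε) ^ (1 - θ) := by
            gcongr
            exact hθ.1.le
        _ = (l ^ θ) ^ n * (c ^ θ * (1 - ε) ^ (1 - θ)) := by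
            rw [Real.mul_rpow (by positivity) (by linarith), ← Real.rpow_natCast,
              ← Real.rpow_natCast, ← Real.rpow_mul hl0.le, ← Real.rpow_mul hl0.le, mul_comm θ]
            ring
        _ = (l ^ θ) ^ n := by rw [rpow_interpExp_mul hc1 hε, mul_one]
    rw [← ENNReal.ofReal_pow hl0.le, ← ENNReal.ofReal_mul (by positivity),
      ← ENNReal.ofReal_natCast n, ← ENNReal.ofReal_mul (by positivity),
      ← ENNReal.ofReal_add (by positivity) (by positivity),
      ENNReal.ofReal_rpow_of_nonneg (by positivity) hθ.1.le,
      ENNReal.ofReal_rpow_of_nonneg hεp.le (by linarith [hθ.2]),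
      ENNReal.ofReal_rpow_of_nonneg hl0.le hθ.1.le, ← ENNReal.ofReal_mul (by positivity),
      ← ENNReal.ofReal_pow (by positivity)]
    exact ENNReal.ofReal_le_ofReal hreal
  have hdriftE : ∀ q, ∫⁻ z, ENNReal.ofReal (V z) ∂(K q) ≤ ENNReal.ofReal l * ENNReal.ofReal (V q) +
      C.indicator (fun _ => ENNReal.ofReal (A * γ)) q := by
    intro q
    refine (hdrift q).trans (le_of_eq ?_)
    rw [ENNReal.ofReal_add (mul_nonneg hl0.le (by linarith [hV1 q]))
      (indicator_nonneg (fun _ _ => by positivity) q), ENNReal.ofReal_mul hl0.le]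
    by_cases h : q ∈ C <;> simp [h]
  -- non-absorption probability at time `j`, with the powers of `V q` and `Λ` made linear
  have hU : ∀ j : ℕ, (K ^ j) q D ≤ ENNReal.ofReal (s ^ j * (V q + Λ) + (s ^ θ) ^ j) := by
    intro j
    have hb := pow_apply_le_of_drift_of_minorization hD habs hV.ennreal_ofReal
      (fun q => ENNReal.one_le_ofReal.2 (hV1 q)) (ENNReal.ofReal_le_one.2 hl1) hdriftE
      (B := ENNReal.ofReal B) (fun q hq => ENNReal.ofReal_le_ofReal (hB q hq)) hn1 hmin hθ.1 hθ.2
      hθE j q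
    have hfin : (K ^ j) q D ≠ ∞ := measure_ne_top _ _
    rw [← ENNReal.ofReal_toReal hfin] at hb ⊢
    have hVq : 0 < V q := by linarith [hV1 q]
    rw [ENNReal.ofReal_rpow_of_nonneg hl0.le hθ.1.le, ENNReal.ofReal_rpow_of_nonneg hVq.le hθ.1.le,
      ← ENNReal.ofReal_pow (by positivity), ← ENNReal.ofReal_pow (by positivity),
      ← ENNReal.ofReal_mul (by positivity), ← ENNReal.ofReal_mul (by positivity),
      ENNReal.ofReal_le_ofReal_iff (by positivity)] at hb
    refine ENNReal.ofReal_le_ofReal ?_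
    set U := ((K ^ j) q D).toReal
    have hU1 : U ≤ 1 := by
      have : (K ^ j) q D ≤ 1 := prob_le_one
      exact ENNReal.toReal_le_of_le_ofReal zero_le_one (by simpa using this)
    have hU0 : 0 ≤ U := ENNReal.toReal_nonneg
    have hsθ : (s ^ θ) ^ j = (s ^ j) ^ θ := by
      rw [← Real.rpow_natCast, ← Real.rpow_natCast, ← Real.rpow_mul hs0.le,
        ← Real.rpow_mul hs0.le, mul_comm]
    rw [hsθ]
    refine le_of_le_rpow_of_le_one hU1 hVq.le hΛ0.le (by positivity) (pow_le_one₀ hs0.le hs1)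
      hθ.1 ?_
    have h1 : 1 ≤ (l ^ n * Λ) ^ θ := Real.one_le_rpow hlΛ hθ.1.le
    have hlθ : ∀ i : ℕ, (l ^ i) ^ θ = (l ^ θ) ^ i := fun i => by
      rw [← Real.rpow_natCast, ← Real.rpow_natCast, ← Real.rpow_mul hl0.le,
        ← Real.rpow_mul hl0.le, mul_comm]
    rw [Real.mul_rpow (by positivity) hΛ0.le, hlθ] at h1
    calc U ≤ U * ((l ^ θ) ^ n * Λ ^ θ) := le_mul_of_one_le_right hU0 h1
      _ = U * (l ^ θ) ^ n * Λ ^ θ := by ring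
      _ ≤ (l ^ θ) ^ j * V q ^ θ * Λ ^ θ := by gcongr
      _ = ((s ^ j) ^ 4 * V q * Λ) ^ θ := by
        rw [Real.mul_rpow (by positivity) hΛ0.le, Real.mul_rpow (by positivity) hVq.le, ← hlθ,
          hls, ← pow_mul, ← pow_mul, mul_comm 4 j]
  have hind : ∀ z, ENNReal.ofReal (D.indicator V z) =
      D.indicator (fun z => ENNReal.ofReal (V z)) z := by
    intro z; by_cases h : z ∈ D <;> simp [h]
  simp only [hind]
  have hdriftE' : ∀ q, ∫⁻ z, ENNReal.ofReal (V z) ∂(K q) ≤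
      ENNReal.ofReal l * ENNReal.ofReal (V q) + ENNReal.ofReal (A * γ) := fun q =>
    (hdriftE q).trans (by gcongr; exact indicator_le_self' (fun _ _ => zero_le) q)
  refine (lintegral_indicator_pow_le hD habs hV.ennreal_ofReal hdriftE' k hq).trans ?_
  have hVq : 0 < V q := by linarith [hV1 q]
  have hsθ0 : 0 < s ^ θ := Real.rpow_pos_of_pos hs0 θ
  calc ENNReal.ofReal l ^ k * ENNReal.ofReal (V q) + ENNReal.ofReal (A * γ) *
        ∑ j ∈ Finset.range k, ENNReal.ofReal l ^ (k - 1 - j) * (K ^ j) q D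
      ≤ ENNReal.ofReal l ^ k * ENNReal.ofReal (V q) + ENNReal.ofReal (A * γ) *
        ∑ j ∈ Finset.range k, ENNReal.ofReal l ^ (k - 1 - j) *
          ENNReal.ofReal (s ^ j * (V q + Λ) + (s ^ θ) ^ j) := by
        gcongr with j hj; exact hU j
    _ = ENNReal.ofReal (l ^ k * V q + A * γ * ∑ j ∈ Finset.range k,
        l ^ (k - 1 - j) * (s ^ j * (V q + Λ) + (s ^ θ) ^ j)) := by
        have hp : ∀ j, 0 ≤ l ^ (k - 1 - j) * (s ^ j * (V q + Λ) + (s ^ θ) ^ j) := fun j => by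
          positivity
        rw [ENNReal.ofReal_add (by positivity)
          (mul_nonneg (by positivity) (Finset.sum_nonneg fun j _ => hp j)),
          ENNReal.ofReal_mul (p := l ^ k) (by positivity), ENNReal.ofReal_pow hl0.le,
          ENNReal.ofReal_mul (p := A * γ) (by positivity),
          ENNReal.ofReal_sum_of_nonneg fun j _ => hp j]
        congr 2
        refine Finset.sum_congr rfl fun j _ => ?_
        rw [ENNReal.ofReal_mul (by positivity), ENNReal.ofReal_pow hl0.le]
    _ ≤ _ := by
        refine ENNReal.ofReal_le_ofReal ?_
        have hS1 := sum_exp_convolution_le hw0 hγ0 k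
        have hw'e : Real.log (1 / ρ) = θ * w := by
          rw [hρe, one_div, Real.log_inv, Real.log_rpow hlam.1, hlog]; ring
        have hw' : 0 < Real.log (1 / ρ) := Real.log_pos (one_lt_one_div hρ0 hρm.2)
        have hS2 := sum_exp_convolution_le hw' hγ0 k
        have hσ : Real.exp (-Real.log (1 / ρ) * γ / 4) = s ^ θ := by
          rw [Real.rpow_def_of_pos hs0, hs, Real.log_exp, hw'e]; congr 1; ring
        rw [hσ] at hS2
        have hρk : ρ ^ (k * γ / 4) = (s ^ θ) ^ k := by
          rw [← hσ, Real.rpow_def_of_pos hρ0, ← Real.exp_nat_mul, one_div, Real.log_inv]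
          congr 1; ring
        have hsσ : l ≤ (s ^ θ) ^ 4 := by
          rw [hls]
          gcongr
          conv_lhs => rw [← Real.rpow_one s]
          exact Real.rpow_le_rpow_of_exponent_ge hs0 hs1 hθ.2.le
        have he : ∀ {v : ℝ}, 0 ≤ v → Real.exp (v * γ) ≤ Real.exp (v * gbar) := fun hv =>
          Real.exp_le_exp.2 (by gcongr)
        have hcb := constants_bound (V := V q) (ℓ := ℓ) (sk := s ^ k) (ρk := (s ^ θ) ^ k) hlam hw
          hA hg (hV1 q) ⟨hρ0, hρm.2⟩ (by positivity) (by positivity)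
        rw [hlk, hρk]
        refine le_trans ?_ hcb
        have hlk1 : l ^ k ≤ s ^ k := by
          gcongr; rw [hls]; exact pow_le_of_le_one hs0.le hs1 (by norm_num)
        have hsplit : ∑ j ∈ Finset.range k, l ^ (k - 1 - j) * (s ^ j * (V q + Λ) + (s ^ θ) ^ j) ≤
            (∑ j ∈ Finset.range k, (s ^ 4) ^ (k - 1 - j) * s ^ j) * (V q + Λ) +
              ∑ j ∈ Finset.range k, ((s ^ θ) ^ 4) ^ (k - 1 - j) * (s ^ θ) ^ j := by
          rw [Finset.sum_mul, ← Finset.sum_add_distrib]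
          refine Finset.sum_le_sum fun j _ => ?_
          have : l ^ (k - 1 - j) * (s ^ θ) ^ j ≤ ((s ^ θ) ^ 4) ^ (k - 1 - j) * (s ^ θ) ^ j := by
            gcongr
          rw [← hls]
          linarith
        set S1 := ∑ j ∈ Finset.range k, (s ^ 4) ^ (k - 1 - j) * s ^ j
        set S2 := ∑ j ∈ Finset.range k, ((s ^ θ) ^ 4) ^ (k - 1 - j) * (s ^ θ) ^ j
        have hS1' : γ * S1 ≤ 4 / 3 * w⁻¹ / lam ^ gbar * s ^ k := by
          rw [div_eq_mul_inv _ (lam ^ gbar), inv_rpow_eq_exp hlam.1, ← hw]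
          exact hS1.trans (by gcongr)
        have hS2' : γ * S2 ≤ 4 / 3 * (Real.log (1 / ρ))⁻¹ / ρ ^ gbar * (s ^ θ) ^ k := by
          rw [div_eq_mul_inv _ (ρ ^ gbar), inv_rpow_eq_exp hρ0]
          exact hS2.trans (by gcongr)
        calc l ^ k * V q + A * γ * ∑ j ∈ Finset.range k,
              l ^ (k - 1 - j) * (s ^ j * (V q + Λ) + (s ^ θ) ^ j)
            ≤ s ^ k * V q + A * γ * (S1 * (V q + Λ) + S2) := by gcongr
          _ = s ^ k * V q + A * (γ * S1) * (V q + Λ) + A * (γ * S2) := by ring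
          _ ≤ s ^ k * V q + A * (4 / 3 * w⁻¹ / lam ^ gbar * s ^ k) * (V q + Λ) +
              A * (4 / 3 * (Real.log (1 / ρ))⁻¹ / ρ ^ gbar * (s ^ θ) ^ k) := by gcongr
          _ = _ := by ring

end Abstract

/-! ### Gaussian laws and the marginals of the reflection coupling -/

open Scheme

variable {d : ℕ}

theorem gaussDensity_eq (γ : ℝ) (c z : E d) :
    gaussDensity d γ c z = gaussDensity d γ 0 (z - c) := by
  simp [gaussDensity]

theorem gaussDensity_nonneg {γ : ℝ} (hγ : 0 < γ) (c z : E d) : 0 ≤ gaussDensity d γ c z := by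
  unfold gaussDensity
  have := Real.pi_pos
  positivity

theorem gaussDensity_zero_eq_of_norm {γ : ℝ} {z z' : E d} (h : ‖z‖ = ‖z'‖) :
    gaussDensity d γ 0 z = gaussDensity d γ 0 z' := by
  simp [gaussDensity, h]

theorem gaussDensity_normalization {γ : ℝ} (hγ : 0 < γ) :
    (2 * Real.pi * γ) ^ (-(d : ℝ) / 2) * (Real.pi / (1 / (2 * γ))) ^ ((d : ℝ) / 2) = 1 := by
  have h0 : 0 < 2 * Real.pi * γ := by have := Real.pi_pos; positivity
  rw [show Real.pi / (1 / (2 * γ)) = 2 * Real.pi * γ by field_simp, ← Real.rpow_add h0,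
    neg_div, neg_add_cancel, Real.rpow_zero]

theorem integral_gaussDensity {γ : ℝ} (hγ : 0 < γ) (c : E d) :
    ∫ z, gaussDensity d γ c z = 1 := by
  simp_rw [gaussDensity_eq γ c]
  rw [integral_sub_right_eq_self (fun z => gaussDensity d γ 0 z) c]
  unfold gaussDensity
  rw [integral_const_mul]
  have h : ∀ z : E d, -‖z - 0‖ ^ 2 / (2 * γ) = -(1 / (2 * γ)) * ‖z‖ ^ 2 := fun z => by
    rw [sub_zero]; ring
  simp_rw [h]
  rw [GaussianFourier.integral_rexp_neg_mul_sq_norm (by positivity), finrank_euclideanSpace,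
    Fintype.card_fin, gaussDensity_normalization hγ]

theorem lintegral_gaussDensity {γ : ℝ} (hγ : 0 < γ) (c : E d) :
    ∫⁻ z, ENNReal.ofReal (gaussDensity d γ c z) = 1 := by
  have h := integral_gaussDensity hγ c
  rw [← ofReal_integral_eq_lintegral_ofReal, h, ENNReal.ofReal_one]
  · exact not_imp_comm.1 integral_undef (by rw [h]; exact one_ne_zero)
  · exact ae_of_all _ fun z => gaussDensity_nonneg hγ c z

/-- The Gaussian law on `ℝ^d` with mean `c` and covariance `γ Id`. -/
noncomputable def gaussLaw (d : ℕ) (γ : ℝ) (c : E d) : Measure (E d) :=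
  (volume : Measure (E d)).withDensity fun z => ENNReal.ofReal (gaussDensity d γ c z)

theorem measurable_gaussDensity_right (γ : ℝ) (c : E d) : Measurable (gaussDensity d γ c) :=
  measurable_gaussDensity γ measurable_const measurable_id

theorem isProbabilityMeasure_gaussLaw {γ : ℝ} (hγ : 0 < γ) (c : E d) :
    IsProbabilityMeasure (gaussLaw d γ c) :=
  ⟨by rw [gaussLaw, withDensity_apply _ MeasurableSet.univ, Measure.restrict_univ,
    lintegral_gaussDensity hγ c]⟩

theorem lintegral_gaussLaw (γ : ℝ) (c : E d) (f : E d → ℝ≥0∞) (hf : Measurable f) :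
    ∫⁻ z, f z ∂(gaussLaw d γ c) = ∫⁻ z, ENNReal.ofReal (gaussDensity d γ c z) * f z := by
  rw [gaussLaw, lintegral_withDensity_eq_lintegral_mul _
    (measurable_gaussDensity_right γ c).ennreal_ofReal hf]
  rfl

/-- The marginal of the Gaussian law along a unit vector. -/
theorem map_inner_gaussLaw {γ : ℝ} (hγ : 0 < γ) (c : E d) {e : E d} (he : ‖e‖ = 1) :
    (gaussLaw d γ c).map (fun z => ⟪e, z - c⟫) = gaussianReal 0 γ.toNNReal := by
  have := isProbabilityMeasure_gaussLaw hγ c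
  have hm : Measurable fun z : E d => ⟪e, z - c⟫ := by fun_prop
  have := Measure.isProbabilityMeasure_map (μ := gaussLaw d γ c) hm.aemeasurable
  refine Measure.ext_of_charFun ?_
  ext t
  rw [charFun_gaussianReal, charFun_apply_real, integral_map hm.aemeasurable (by fun_prop),
    gaussLaw,
    integral_withDensity_eq_integral_toReal_smul
      (measurable_gaussDensity_right γ c).ennreal_ofReal
      (ae_of_all _ fun _ => ENNReal.ofReal_lt_top)]
  simp_rw [ENNReal.toReal_ofReal (gaussDensity_nonneg hγ c _), gaussDensity_eq γ c]
  rw [integral_sub_right_eq_self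
    (fun z => gaussDensity d γ 0 z • Complex.exp (t * ⟪e, z⟫ * Complex.I)) c]
  have hb : 0 < ((1 / (2 * γ) : ℝ) : ℂ).re := by rw [Complex.ofReal_re]; positivity
  have hint : ∀ z : E d, gaussDensity d γ 0 z • Complex.exp (t * ⟪e, z⟫ * Complex.I) =
      ((2 * Real.pi * γ) ^ (-(d : ℝ) / 2) : ℝ) *
        Complex.exp (-((1 / (2 * γ) : ℝ) : ℂ) * ‖z‖ ^ 2 + (t * Complex.I) * ⟪e, z⟫) := by
    intro z
    rw [gaussDensity, Complex.real_smul, Complex.ofReal_mul, mul_assoc, Complex.ofReal_exp,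
      ← Complex.exp_add, sub_zero]
    congr 2
    push_cast
    ring
  simp_rw [hint]
  rw [integral_const_mul, GaussianFourier.integral_cexp_neg_mul_sq_norm_add hb,
    finrank_euclideanSpace, Fintype.card_fin, he, ← mul_assoc]
  have h1 : (((2 * Real.pi * γ) ^ (-(d : ℝ) / 2) : ℝ) : ℂ) *
      ((Real.pi : ℂ) / ((1 / (2 * γ) : ℝ) : ℂ)) ^ ((d : ℂ) / 2) = 1 := by
    have h2 := gaussDensity_normalization (d := d) hγ
    have h3 : ((Real.pi : ℂ) / ((1 / (2 * γ) : ℝ) : ℂ)) ^ ((d : ℂ) / 2) =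
        (((Real.pi / (1 / (2 * γ))) ^ ((d : ℝ) / 2) : ℝ) : ℂ) := by
      rw [Complex.ofReal_cpow (by have := Real.pi_pos; positivity)]
      push_cast; rfl
    rw [h3, ← Complex.ofReal_mul, h2, Complex.ofReal_one]
  rw [h1, one_mul]
  congr 1
  rw [mul_pow, Complex.I_sq, Real.coe_toNNReal _ hγ.le]
  push_cast
  have : (γ : ℂ) ≠ 0 := by exact_mod_cast hγ.ne'
  field_simp
  ring

theorem lintegral_inner_gaussDensity {γ : ℝ} (hγ : 0 < γ) (c : E d) {e : E d} (he : ‖e‖ = 1)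
    {f : ℝ → ℝ≥0∞} (hf : Measurable f) :
    ∫⁻ z, ENNReal.ofReal (gaussDensity d γ c z) * f ⟪e, z - c⟫ =
      ∫⁻ g, f g ∂(gaussianReal 0 γ.toNNReal) := by
  have hm : Measurable fun z : E d => ⟪e, z - c⟫ := by fun_prop
  rw [← lintegral_gaussLaw γ c (fun z => f ⟪e, z - c⟫) (hf.comp hm), ← map_inner_gaussLaw hγ c he,
    lintegral_map hf hm]

namespace Scheme

variable (S : Scheme d)

theorem acceptProb_mem (γ : ℝ) (x y z : E d) : S.acceptProb γ x y z ∈ Icc (0 : ℝ) 1 := by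
  refine ⟨le_min zero_le_one (div_nonneg ?_ ?_), min_le_left _ _⟩ <;>
  exact gaussianPDFReal_nonneg _ _ _

theorem norm_dir {γ : ℝ} {x y : E d} (h : S.T γ x ≠ S.T γ y) : ‖S.dir γ x y‖ = 1 := by
  have : ‖S.gap γ x y‖ ≠ 0 := norm_ne_zero_iff.2 (sub_ne_zero.2 h.symm)
  rw [dir, norm_smul, norm_inv, norm_norm, inv_mul_cancel₀ this]

theorem norm_gap_smul_dir (γ : ℝ) (x y : E d) : ‖S.gap γ x y‖ • S.dir γ x y = S.gap γ x y := by
  rcases eq_or_ne (S.gap γ x y) 0 with h | h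
  · simp [dir, h]
  · rw [dir, smul_smul, mul_inv_cancel₀ (norm_ne_zero_iff.2 h), one_smul]

theorem reflected_sub {γ : ℝ} (x y z : E d) :
    reflected S γ x y z - (S.T γ x + z) =
      (‖S.gap γ x y‖ - 2 * ⟪S.dir γ x y, z⟫) • S.dir γ x y := by
  rw [sub_smul, norm_gap_smul_dir, reflected, gap]
  abel

/-- The part of the Gaussian density that is coupled is the minimum of the two densities. -/
theorem acceptProb_mul_gaussDensity {γ : ℝ} (hγ : 0 < γ) {x y : E d} (h : S.T γ x ≠ S.T γ y)
    (z : E d) : S.acceptProb γ x y z * gaussDensity d γ 0 z =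
      min (gaussDensity d γ 0 z) (gaussDensity d γ 0 (z - S.gap γ x y)) := by
  have hv : γ.toNNReal ≠ 0 := by simpa using hγ
  have he := S.norm_dir h
  have hp := gaussianPDFReal_pos 0 γ.toNNReal ⟪S.dir γ x y, z⟫ hv
  rw [acceptProb, min_mul_of_nonneg _ _ (gaussDensity_nonneg hγ _ _), one_mul]
  congr 1
  rw [div_mul_eq_mul_div, div_eq_iff hp.ne']
  simp only [gaussDensity, gaussianPDFReal, Real.coe_toNNReal _ hγ.le, sub_zero]
  have hn : ‖z - S.gap γ x y‖ ^ 2 =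
      ‖z‖ ^ 2 - 2 * ‖S.gap γ x y‖ * ⟪S.dir γ x y, z⟫ + ‖S.gap γ x y‖ ^ 2 := by
    conv_lhs => rw [norm_sub_sq_real, real_inner_comm, ← S.norm_gap_smul_dir γ x y]
    rw [real_inner_smul_left, norm_smul, he]; simp; ring
  rw [hn]
  set a := ‖S.gap γ x y‖
  set g := ⟪S.dir γ x y, z⟫
  rw [show ∀ p q r s : ℝ, p * q * (r * s) = p * r * (q * s) by intros; ring, ← Real.exp_add,
    show ∀ p q r s : ℝ, r * q * (p * s) = p * r * (q * s) by intros; ring, ← Real.exp_add]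
  congr 2
  field_simp
  ring

/-- The reflection used by the coupling, as a linear isometry. -/
noncomputable def refl (γ : ℝ) (x y : E d) : E d ≃ₗᵢ[ℝ] E d := (ℝ ∙ S.dir γ x y)ᗮ.reflection

theorem refl_apply {γ : ℝ} {x y : E d} (h : S.T γ x ≠ S.T γ y) (z : E d) :
    S.refl γ x y z = z - (2 * ⟪S.dir γ x y, z⟫) • S.dir γ x y := by
  rw [refl, Submodule.reflection_orthogonal_apply, Submodule.reflection_singleton_apply,
    S.norm_dir h]
  simp [two_smul, two_mul, add_smul]

theorem refl_refl (γ : ℝ) (x y z : E d) : S.refl γ x y (S.refl γ x y z) = z :=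
  Submodule.reflection_reflection _ z

theorem refl_gap {γ : ℝ} {x y : E d} (h : S.T γ x ≠ S.T γ y) :
    S.refl γ x y (S.gap γ x y) = -S.gap γ x y := by
  rw [S.refl_apply h]
  conv_lhs =>
    rw [← S.norm_gap_smul_dir γ x y, real_inner_smul_right, real_inner_self_eq_norm_sq,
      S.norm_dir h]
  conv_rhs => rw [← S.norm_gap_smul_dir γ x y]
  rw [← sub_smul, ← neg_smul]; congr 1; ring

theorem lintegral_couplingStep_of_eq {γ : ℝ} {x y : E d} (h : S.T γ x = S.T γ y)
    {f : S.X × S.X → ℝ≥0∞} (hf : Measurable f) :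
    ∫⁻ q, f q ∂(S.couplingStep γ x y) =
      ∫⁻ z, ENNReal.ofReal (gaussDensity d γ (S.T γ x) z) * f (S.proj z, S.proj z) := by
  have hP := S.continuous_proj.measurable
  rw [couplingStep, if_pos h, lintegral_map hf (hP.prodMk hP)]
  exact lintegral_gaussLaw _ _ _ (hf.comp (hP.prodMk hP))

theorem lintegral_couplingStep_of_ne {γ : ℝ} {x y : E d} (h : S.T γ x ≠ S.T γ y)
    {f : S.X × S.X → ℝ≥0∞} (hf : Measurable f) :
    ∫⁻ q, f q ∂(S.couplingStep γ x y) =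
      (∫⁻ z, ENNReal.ofReal (S.acceptProb γ x y (z - S.T γ x) * gaussDensity d γ (S.T γ x) z) *
        f (S.proj z, S.proj z)) +
      ∫⁻ z, ENNReal.ofReal ((1 - S.acceptProb γ x y (z - S.T γ x)) *
        gaussDensity d γ (S.T γ x) z) *
        f (S.proj z, S.proj (S.reflected γ x y (z - S.T γ x))) := by
  have hP := S.continuous_proj.measurable
  have hz : Measurable fun z : E d => z - S.T γ x := measurable_id.sub_const _
  have ha := S.measurable_acceptProb γ (measurable_const (a := x)) (measurable_const (a := y)) hz
  have hr := S.measurable_reflected γ (measurable_const (a := x)) (measurable_const (a := y)) hz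
  have hg := measurable_gaussDensity_right γ (S.T γ x)
  rw [couplingStep, if_neg h, lintegral_add_measure, lintegral_map hf (hP.prodMk hP),
    lintegral_map (g := fun z => (S.proj z, S.proj (S.reflected γ x y (z - S.T γ x)))) hf
      (hP.prodMk (hP.comp hr))]
  exact congrArg₂ (· + ·)
    (lintegral_withDensity_eq_lintegral_mul _ (ha.mul hg).ennreal_ofReal
      (hf.comp (hP.prodMk hP)))
    (lintegral_withDensity_eq_lintegral_mul _
      (((measurable_const (a := (1 : ℝ))).sub ha).mul hg).ennreal_ofReal
      (hf.comp (hP.prodMk (hP.comp hr))))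

theorem lintegral_couplingStep_fst {γ : ℝ} (hγ : 0 < γ) (x y : E d) {f : S.X → ℝ≥0∞}
    (hf : Measurable f) : ∫⁻ q, f q.1 ∂(S.couplingStep γ x y) =
      ∫⁻ z, ENNReal.ofReal (gaussDensity d γ (S.T γ x) z) * f (S.proj z) := by
  by_cases h : S.T γ x = S.T γ y
  · rw [S.lintegral_couplingStep_of_eq h (f := fun q => f q.1) (hf.comp measurable_fst)]
  · have hP := S.continuous_proj.measurable
    have hz : Measurable fun z : E d => z - S.T γ x := measurable_id.sub_const _
    have ha := S.measurable_acceptProb γ (measurable_const (a := x)) (measurable_const (a := y)) hz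
    have hg := measurable_gaussDensity_right γ (S.T γ x)
    rw [S.lintegral_couplingStep_of_ne h (f := fun q => f q.1) (hf.comp measurable_fst)]
    refine (lintegral_add_left ((ha.mul hg).ennreal_ofReal.mul (hf.comp hP)) _).symm.trans ?_
    refine lintegral_congr fun z => ?_
    have hm := S.acceptProb_mem γ x y (z - S.T γ x)
    have hg0 := gaussDensity_nonneg hγ (S.T γ x) z
    refine (add_mul _ _ (f (S.proj z))).symm.trans ?_
    refine congrArg (· * f (S.proj z)) ?_
    refine (ENNReal.ofReal_add (mul_nonneg hm.1 hg0)
      (mul_nonneg (by linarith [hm.2]) hg0)).symm.trans (congrArg _ ?_)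
    ring

/-- The second marginal: translation of the accepted part and reflection of the rejected part
restore the Gaussian law with mean `T_γ(y)`. -/
theorem lintegral_couplingStep_snd {γ : ℝ} (hγ : 0 < γ) (x y : E d) {f : S.X → ℝ≥0∞}
    (hf : Measurable f) : ∫⁻ q, f q.2 ∂(S.couplingStep γ x y) =
      ∫⁻ z, ENNReal.ofReal (gaussDensity d γ (S.T γ y) z) * f (S.proj z) := by
  by_cases h : S.T γ x = S.T γ y
  · rw [S.lintegral_couplingStep_of_eq h (f := fun q => f q.2) (hf.comp measurable_snd), h]
  · have hP := S.continuous_proj.measurable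
    have hg : ∀ c, Measurable (gaussDensity d γ c) := measurable_gaussDensity_right γ
    rw [S.lintegral_couplingStep_of_ne h (f := fun q => f q.2) (hf.comp measurable_snd)]
    set v := S.gap γ x y with hv
    have hTy : S.T γ y = S.T γ x + v := by rw [hv, gap]; abel
    have e1 : (∫⁻ z, ENNReal.ofReal (S.acceptProb γ x y (z - S.T γ x) *
          gaussDensity d γ (S.T γ x) z) * f (S.proj z)) =
        ∫⁻ u, ENNReal.ofReal (min (gaussDensity d γ 0 (u + v)) (gaussDensity d γ 0 u)) *
          f (S.proj (u + S.T γ y)) := by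
      rw [← lintegral_add_right_eq_self _ (S.T γ y)]
      refine lintegral_congr fun u => ?_
      rw [gaussDensity_eq γ (S.T γ x), S.acceptProb_mul_gaussDensity hγ h, ← hv,
        show u + S.T γ y - S.T γ x = u + v by rw [hTy]; abel, add_sub_cancel_right]
    have e2 : (∫⁻ z, ENNReal.ofReal ((1 - S.acceptProb γ x y (z - S.T γ x)) *
          gaussDensity d γ (S.T γ x) z) * f (S.proj (S.reflected γ x y (z - S.T γ x)))) =
        ∫⁻ u, ENNReal.ofReal (gaussDensity d γ 0 u -
          min (gaussDensity d γ 0 u) (gaussDensity d γ 0 (u + v))) *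
          f (S.proj (u + S.T γ y)) := by
      rw [← lintegral_add_right_eq_self _ (S.T γ x),
        ← (S.refl γ x y).measurePreserving.lintegral_comp_emb
          (S.refl γ x y).toHomeomorph.measurableEmbedding]
      refine lintegral_congr fun u => ?_
      have hr : S.reflected γ x y (S.refl γ x y u) = u + S.T γ y := by
        rw [reflected, ← S.refl_apply h, refl_refl, add_comm]
      have hn : ‖S.refl γ x y u - v‖ = ‖u + v‖ := by
        rw [← (S.refl γ x y).norm_map (u + v), map_add, hv, S.refl_gap h, sub_eq_add_neg]
      rw [gaussDensity_eq γ (S.T γ x), add_sub_cancel_right, hr, sub_mul, one_mul,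
        S.acceptProb_mul_gaussDensity hγ h, ← hv, gaussDensity_zero_eq_of_norm hn,
        gaussDensity_zero_eq_of_norm ((S.refl γ x y).norm_map u)]
    have hm1 : Measurable fun u : E d => gaussDensity d γ 0 (u + v) :=
      (hg 0).comp (measurable_add_const v)
    have hm2 : Measurable fun u : E d => f (S.proj (u + S.T γ y)) :=
      hf.comp (hP.comp (measurable_add_const _))
    rw [e1, e2]
    refine (lintegral_add_left ((hm1.min (hg 0)).ennreal_ofReal.mul hm2) _).symm.trans ?_
    rw [← lintegral_add_right_eq_self
        (fun z => ENNReal.ofReal (gaussDensity d γ (S.T γ y) z) * f (S.proj z)) (S.T γ y)]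
    refine lintegral_congr fun u => ?_
    have g1 := gaussDensity_nonneg hγ 0 u
    have g2 := gaussDensity_nonneg hγ 0 (u + v)
    refine (add_mul _ _ (f (S.proj (u + S.T γ y)))).symm.trans ?_
    rw [gaussDensity_eq γ (S.T γ y), add_sub_cancel_right,
      ← ENNReal.ofReal_add (le_min g2 g1) (sub_nonneg.2 (min_le_left _ _)), min_comm,
      add_sub_cancel]

theorem lintegral_R (γ : ℝ) (x : S.X) {f : S.X → ℝ≥0∞} (hf : Measurable f) :
    ∫⁻ y, f y ∂(S.R γ x) =
      ∫⁻ z, ENNReal.ofReal (gaussDensity d γ (S.T γ x) z) * f (S.proj z) := by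
  have hP := S.continuous_proj.measurable
  change ∫⁻ y, f y ∂((gaussLaw d γ (S.T γ x)).map S.proj) = _
  rw [lintegral_map hf hP]
  exact lintegral_gaussLaw _ _ _ (hf.comp hP)

theorem isMarkovCoupling {γ : ℝ} (hγ : 0 < γ) : IsMarkovCoupling (S.K γ) (S.R γ) := by
  have hfst : ∀ x y : S.X, (S.K γ (x, y)).map Prod.fst = S.R γ x := by
    intro x y
    refine Measure.ext_of_lintegral _ fun f hf => ?_
    rw [lintegral_map hf measurable_fst, S.lintegral_R γ x hf]
    exact S.lintegral_couplingStep_fst hγ x y hf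
  have hR : IsMarkovKernel (S.R γ) := ⟨fun x => by
    have : IsProbabilityMeasure ((volume : Measure (E d)).withDensity fun z =>
        ENNReal.ofReal (gaussDensity d γ (S.T γ x) z)) := isProbabilityMeasure_gaussLaw hγ _
    exact Measure.isProbabilityMeasure_map S.continuous_proj.measurable.aemeasurable⟩
  refine ⟨hR, ⟨fun q => ⟨?_⟩⟩, fun x y => ⟨hfst x y, ?_⟩⟩
  · have h := hfst q.1 q.2
    have h1 : (S.K γ q).map Prod.fst univ = 1 := by rw [h]; exact measure_univ
    rwa [Measure.map_apply measurable_fst MeasurableSet.univ, preimage_univ] at h1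
  · refine Measure.ext_of_lintegral _ fun f hf => ?_
    rw [lintegral_map hf measurable_snd, S.lintegral_R γ y hf]
    exact S.lintegral_couplingStep_snd hγ x y hf

end Scheme

/-! ### The probability that the reflection coupling has not met -/

theorem gaussianPDFReal_le_iff {v : NNReal} (hv : v ≠ 0) (g a : ℝ) :
    gaussianPDFReal 0 v (a - g) ≤ gaussianPDFReal 0 v g ↔ 0 ≤ a * (a - 2 * g) := by
  have hv' : (0 : ℝ) < v := by positivity
  have hs : 0 < (√(2 * Real.pi * v))⁻¹ := by have := Real.pi_pos; positivity
  rw [gaussianPDFReal, gaussianPDFReal, mul_le_mul_iff_right₀ hs, Real.exp_le_exp,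
    div_le_div_iff_of_pos_right (by positivity)]
  constructor <;> intro h <;> nlinarith

/-- One step of the one-dimensional reflection coupling: for an odd increasing function `F`, the
mass lost to coupling is exactly compensated by the negative values of `F`. The proof symmetrizes
under `g ↦ a - g`, which exchanges the two Gaussian densities. -/
theorem lintegral_reject_mul {v : NNReal} (hv : v ≠ 0) {a : ℝ} (ha : 0 < a) {F : ℝ → ℝ}
    (hodd : ∀ t, F (-t) = -F t) (hmono : Monotone F)
    (hint : Integrable (fun g => F (a - 2 * g)) (gaussianReal 0 v)) :
    ∫⁻ g, ENNReal.ofReal (1 - min 1 (gaussianPDFReal 0 v (a - g) / gaussianPDFReal 0 v g)) *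
        ENNReal.ofReal (F |a - 2 * g|) ∂(gaussianReal 0 v) =
      ENNReal.ofReal (∫ g, F (a - 2 * g) ∂(gaussianReal 0 v)) := by
  have hF0 : F 0 = 0 := by have := hodd 0; rw [neg_zero] at this; linarith
  have hFpos : ∀ t, 0 ≤ t → 0 ≤ F t := fun t ht => hF0 ▸ hmono ht
  have hFabs : ∀ t, F |t| = |F t| := by
    intro t
    rcases le_total 0 t with h | h
    · rw [abs_of_nonneg h, abs_of_nonneg (hFpos t h)]
    · have := hFpos (-t) (by linarith)
      rw [abs_of_nonpos h, abs_of_nonpos (by rw [hodd] at this; linarith), hodd]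
  set φ := gaussianPDFReal 0 v with hφ
  have hφpos : ∀ g, 0 < φ g := fun g => gaussianPDFReal_pos 0 v g hv
  have hφm : Measurable φ := measurable_gaussianPDFReal 0 v
  set P : ℝ → ℝ := fun g => 1 - min 1 (φ (a - g) / φ g) with hP
  have hP0 : ∀ g, 0 ≤ P g := fun g => sub_nonneg.2 (min_le_left _ _)
  have hP1 : ∀ g, P g ≤ 1 := fun g => sub_le_self _
    (le_min zero_le_one (div_nonneg (hφpos _).le (hφpos _).le))
  have hPm : Measurable P := by
    have : Measurable fun g => φ (a - g) := hφm.comp (measurable_const.sub measurable_id)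
    exact measurable_const.sub (measurable_const.min (this.div hφm))
  have hφP : ∀ g, φ g * P g = max (φ g - φ (a - g)) 0 := by
    intro g
    simp only [hP]
    rw [mul_sub, mul_one, mul_min_of_nonneg _ _ (hφpos g).le, mul_one,
      mul_div_cancel₀ _ (hφpos g).ne']
    rcases le_total (φ g) (φ (a - g)) with h | h
    · rw [min_eq_left h, max_eq_right (by linarith), sub_self]
    · rw [min_eq_right h, max_eq_left (by linarith)]
  have hintP : Integrable (fun g => P g * F |a - 2 * g|) (gaussianReal 0 v) := by
    simp_rw [hFabs]
    refine hint.abs.bdd_mul (c := 1) hPm.aestronglyMeasurable (ae_of_all _ fun g => ?_)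
    rw [Real.norm_of_nonneg (hP0 g)]; exact hP1 g
  have hmul : ∀ g, ENNReal.ofReal (1 - min 1 (φ (a - g) / φ g)) * ENNReal.ofReal (F |a - 2 * g|) =
      ENNReal.ofReal (P g * F |a - 2 * g|) := fun g => (ENNReal.ofReal_mul (hP0 g)).symm
  rw [lintegral_congr hmul, ← ofReal_integral_eq_lintegral_ofReal hintP
    (ae_of_all _ fun g => mul_nonneg (hP0 g) (hFpos _ (abs_nonneg _)))]
  congr 1
  have hvol : ∀ {f : ℝ → ℝ}, Integrable f (gaussianReal 0 v) → Integrable fun g => φ g * f g := by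
    intro f hf
    rw [gaussianReal_of_var_ne_zero _ hv, integrable_withDensity_iff_integrable_smul'
      (measurable_gaussianPDF _ _) (ae_of_all _ fun _ => gaussianPDF_lt_top)] at hf
    simpa [toReal_gaussianPDF] using hf
  rw [integral_gaussianReal_eq_integral_smul hv, integral_gaussianReal_eq_integral_smul hv]
  simp only [smul_eq_mul, ← hφ]
  have hh := hvol hintP
  have hk := hvol hint
  set h : ℝ → ℝ := fun g => φ g * (P g * F |a - 2 * g|) with hhd
  set k : ℝ → ℝ := fun g => φ g * F (a - 2 * g) with hkd
  have hpt : ∀ g, h g + h (a - g) = k g + k (a - g) := by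
    intro g
    simp only [hhd, hkd, ← mul_assoc, hφP, sub_sub_cancel]
    rw [show a - 2 * (a - g) = -(a - 2 * g) by ring, abs_neg, hodd, hFabs]
    rcases le_total 0 (a - 2 * g) with hs | hs
    · have h1 : φ (a - g) ≤ φ g := (gaussianPDFReal_le_iff hv g a).2 (by positivity)
      rw [abs_of_nonneg (hFpos _ hs), max_eq_left (by linarith), max_eq_right (by linarith)]
      ring
    · have h1 : φ g ≤ φ (a - g) := by
        have := (gaussianPDFReal_le_iff hv (a - g) a).2
          (mul_nonneg ha.le (by linarith))
        rwa [sub_sub_cancel] at this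
      have h2 : F (a - 2 * g) ≤ 0 := hF0 ▸ hmono hs
      rw [abs_of_nonpos h2, max_eq_right (by linarith), max_eq_left (by linarith)]
      ring
  have h1 : ∫ g, (h g + h (a - g)) = 2 * ∫ g, h g := by
    rw [integral_add hh (hh.comp_sub_left a), integral_sub_left_eq_self, two_mul]
  have h2 : ∫ g, (k g + k (a - g)) = 2 * ∫ g, k g := by
    rw [integral_add hk (hk.comp_sub_left a), integral_sub_left_eq_self, two_mul]
  simp_rw [hpt] at h1
  linarith

theorem measurable_real_sign : Measurable Real.sign := by
  unfold Real.sign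
  exact Measurable.ite measurableSet_Iio measurable_const
    (Measurable.ite measurableSet_Ioi measurable_const measurable_const)

theorem abs_real_sign_le (t : ℝ) : |Real.sign t| ≤ 1 := by
  rcases Real.sign_apply_eq t with h | h | h <;> simp [h]

theorem monotone_real_sign : Monotone Real.sign := by
  intro s t h
  rcases lt_trichotomy s 0 with hs | rfl | hs
  · rw [Real.sign_of_neg hs]; exact (abs_le.1 (abs_real_sign_le t)).1
  · rcases h.eq_or_lt with rfl | h
    · exact le_rfl
    · rw [Real.sign_of_pos h, Real.sign_zero]; exact zero_le_one
  · rw [Real.sign_of_pos hs, Real.sign_of_pos (hs.trans_le h)]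

/-- The mean of the sign of `t / 2 - U` where `U` is a centred Gaussian variable with variance `s`.
It is the probability that a reflection coupling of two Brownian motions at distance `t` has not met
at time `s`; for `s = 0` it is the indicator of `t ≠ 0` on `[0, ∞)`. -/
noncomputable def signMean (s : NNReal) (t : ℝ) : ℝ :=
  ∫ u, Real.sign (t / 2 - u) ∂(gaussianReal 0 s)

theorem integrable_sign_comp {μ : Measure ℝ} [IsFiniteMeasure μ] {f : ℝ → ℝ} (hf : Measurable f) :
    Integrable (fun u => Real.sign (f u)) μ :=
  Integrable.of_bound (measurable_real_sign.comp hf).aestronglyMeasurable 1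
    (ae_of_all _ fun _ => abs_real_sign_le _)

theorem signMean_mono (s : NNReal) : Monotone (signMean s) := by
  intro t t' h
  refine integral_mono (integrable_sign_comp (by fun_prop)) (integrable_sign_comp (by fun_prop)) ?_
  intro u
  exact monotone_real_sign (by linarith)

theorem abs_signMean_le (s : NNReal) (t : ℝ) : |signMean s t| ≤ 1 := by
  have := norm_integral_le_of_norm_le_const (μ := gaussianReal 0 s) (C := 1)
    (f := fun u => Real.sign (t / 2 - u)) (ae_of_all _ fun u => abs_real_sign_le _)
  simpa [signMean] using this

theorem integral_comp_neg_gaussianReal (s : NNReal) (f : ℝ → ℝ) :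
    ∫ u, f (-u) ∂(gaussianReal 0 s) = ∫ u, f u ∂(gaussianReal 0 s) := by
  conv_rhs => rw [← neg_zero, ← gaussianReal_map_neg]
  exact ((MeasurableEquiv.neg ℝ).measurableEmbedding.integral_map f).symm

theorem signMean_neg (s : NNReal) (t : ℝ) : signMean s (-t) = -signMean s t := by
  rw [signMean, signMean, ← integral_comp_neg_gaussianReal, ← integral_neg]
  refine integral_congr_ae (ae_of_all _ fun u => ?_)
  simp only []
  rw [← Real.sign_neg]; congr 1; ring

theorem signMean_zero_left {t : ℝ} (ht : 0 < t) : signMean 0 t = 1 := by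
  rw [signMean, gaussianReal_zero_var, integral_dirac, sub_zero, Real.sign_of_pos (by linarith)]

/-- Averaging over an independent Gaussian step adds the variances. -/
theorem integral_signMean (s v : NNReal) (a : ℝ) :
    ∫ g, signMean s (a - 2 * g) ∂(gaussianReal 0 v) = signMean (v + s) a := by
  have h := gaussianReal_conv_gaussianReal (m₁ := 0) (m₂ := 0) (v₁ := v) (v₂ := s)
  rw [add_zero] at h
  rw [signMean, ← h, integral_conv]
  · refine integral_congr_ae (ae_of_all _ fun g => ?_)
    simp only [signMean]
    congr 1; ext u; congr 1; ring
  · exact integrable_sign_comp (by fun_prop)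

/-- Brownian scaling. -/
theorem signMean_mul {c : ℝ} (hc : 0 < c) {s s' : NNReal} (hs : (s' : ℝ) = c ^ 2 * s) (t : ℝ) :
    signMean s' (c * t) = signMean s t := by
  have h := gaussianReal_map_const_mul (μ := 0) (v := s) c
  have hs' : NNReal.mk (c ^ 2) (sq_nonneg _) * s = s' := NNReal.eq hs.symm
  rw [mul_zero, hs'] at h
  rw [signMean, ← h, integral_map (f := fun u => Real.sign (c * t / 2 - u)) (by fun_prop)
    (Measurable.aestronglyMeasurable (measurable_real_sign.comp (by fun_prop))), signMean]
  congr 1; ext u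
  rw [show c * t / 2 - c * u = c * (t / 2 - u) by ring]
  rcases lt_trichotomy (t / 2 - u) 0 with h | h | h
  · rw [Real.sign_of_neg h, Real.sign_of_neg (mul_neg_of_pos_of_neg hc h)]
  · rw [h, mul_zero]
  · rw [Real.sign_of_pos h, Real.sign_of_pos (mul_pos hc h)]

/-- The closed form of `signMean`, for a nondegenerate variance; for `s = 0` the quotient
is junk. -/
theorem signMean_eq {s : NNReal} (hs : s ≠ 0) (t : ℝ) :
    signMean s t = 1 - 2 * Φ (-t / (2 * √(s : ℝ))) := by
  have hs' : 0 < √(s : ℝ) := Real.sqrt_pos.2 (by positivity)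
  have hone : ∀ t, signMean 1 t = 1 - 2 * Φ (-t / 2) := by
    intro t
    rw [signMean, ← integral_comp_neg_gaussianReal, Φ, cdf_eq_real]
    have : NullSingletonClass (gaussianReal 0 1) := nullSingletonClass_gaussianReal one_ne_zero
    have hae : ∀ᵐ u ∂(gaussianReal 0 1), Real.sign (t / 2 - -u) =
        1 - 2 * (Iic (-t / 2)).indicator 1 u := by
      have : ∀ᵐ u ∂(gaussianReal 0 1), u ≠ -t / 2 := by
        rw [ae_iff]; simp
      filter_upwards [this] with u hu
      rcases lt_or_gt_of_ne hu with h | h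
      · rw [Real.sign_of_neg (by linarith), indicator_of_mem (by exact h.le)]; norm_num
      · rw [Real.sign_of_pos (by linarith), indicator_of_notMem (by simpa using h)]; norm_num
    have hind : Integrable ((Iic (-t / 2)).indicator (1 : ℝ → ℝ)) (gaussianReal 0 1) :=
      (integrable_const (1 : ℝ)).indicator measurableSet_Iic
    rw [integral_congr_ae hae, integral_sub (integrable_const _) (hind.const_mul 2),
      integral_const_mul, integral_indicator_one measurableSet_Iic]
    simp
  have h := signMean_mul hs' (s := 1) (s' := s) (by simp) (t / √(s : ℝ))
  rw [mul_div_cancel₀ _ hs'.ne', hone] at h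
  rw [h]
  congr 3
  field_simp

namespace Scheme

variable {d : ℕ} (S : Scheme d)

/-- One step of the reflection coupling, tested against an odd increasing function of the distance.
The inequality is due to the projection only, which is a contraction. -/
theorem lintegral_K_le {γ : ℝ} (hγ : 0 < γ) {F : ℝ → ℝ} (hodd : ∀ t, F (-t) = -F t)
    (hmono : Monotone F)
    (hint : ∀ a, Integrable (fun g => F (a - 2 * g)) (gaussianReal 0 γ.toNNReal)) (x y : S.X) :
    ∫⁻ q, ENNReal.ofReal (F ‖(q.1 : E d) - q.2‖) ∂(S.K γ (x, y)) ≤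
      ENNReal.ofReal (∫ g, F (‖S.gap γ x y‖ - 2 * g) ∂(gaussianReal 0 γ.toNNReal)) := by
  have hF0 : F 0 = 0 := by have := hodd 0; rw [neg_zero] at this; linarith
  have hfm : Measurable fun q : S.X × S.X => ENNReal.ofReal (F ‖(q.1 : E d) - q.2‖) :=
    (hmono.measurable.comp (by fun_prop)).ennreal_ofReal
  change ∫⁻ q, _ ∂(S.couplingStep γ x y) ≤ _
  by_cases h : S.T γ x = S.T γ y
  · rw [S.lintegral_couplingStep_of_eq h hfm]
    simp [hF0]
  · have hv : γ.toNNReal ≠ 0 := by simpa using hγ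
    have he := S.norm_dir h
    have ha : 0 < ‖S.gap γ x y‖ := norm_pos_iff.2 (sub_ne_zero.2 (Ne.symm h))
    rw [S.lintegral_couplingStep_of_ne h hfm]
    simp only [sub_self, norm_zero, hF0, ENNReal.ofReal_zero, mul_zero, lintegral_zero, zero_add]
    rw [← lintegral_reject_mul hv ha hodd hmono (hint _)]
    set a := ‖S.gap γ x y‖
    have hm : Measurable fun g : ℝ => ENNReal.ofReal
        (1 - min 1 (gaussianPDFReal 0 γ.toNNReal (a - g) / gaussianPDFReal 0 γ.toNNReal g)) *
        ENNReal.ofReal (F |a - 2 * g|) := by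
      have hp := measurable_gaussianPDFReal 0 γ.toNNReal
      have h1 : Measurable fun g => gaussianPDFReal 0 γ.toNNReal (a - g) :=
        hp.comp (measurable_const.sub measurable_id)
      have h2 : Measurable fun g => F |a - 2 * g| := hmono.measurable.comp (by fun_prop)
      exact ((measurable_const.sub (measurable_const.min (h1.div hp))).ennreal_ofReal).mul
        h2.ennreal_ofReal
    rw [← lintegral_inner_gaussDensity hγ (S.T γ x) he hm]
    refine lintegral_mono fun z => ?_
    simp only []
    rw [ENNReal.ofReal_mul' (gaussDensity_nonneg hγ _ _), mul_comm (ENNReal.ofReal (1 - _)),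
      mul_assoc]
    gcongr ENNReal.ofReal (gaussDensity d γ (S.T γ x) z) * (?_ * ?_)
    · rfl
    · refine ENNReal.ofReal_le_ofReal (hmono ((S.norm_proj_sub_le _ _).trans (le_of_eq ?_)))
      have := S.reflected_sub (γ := γ) x y (z - S.T γ x)
      rw [add_sub_cancel] at this
      rw [norm_sub_rev, this, norm_smul, he, mul_one, Real.norm_eq_abs]

theorem measurableSet_offDiag : MeasurableSet (offDiag S.X) :=
  (measurableSet_eq_fun measurable_fst measurable_snd).compl

theorem K_self_offDiag (γ : ℝ) (x : S.X) : S.K γ (x, x) (offDiag S.X) = 0 := by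
  rw [← lintegral_indicator_one S.measurableSet_offDiag]
  change ∫⁻ q, _ ∂(S.couplingStep γ x x) = 0
  rw [S.lintegral_couplingStep_of_eq rfl (measurable_one.indicator S.measurableSet_offDiag)]
  simp [offDiag]

theorem K_offDiag_eq_zero (γ : ℝ) (q : S.X × S.X) (hq : q ∉ offDiag S.X) :
    S.K γ q (offDiag S.X) = 0 := by
  obtain ⟨x, y⟩ := q
  obtain rfl : x = y := by simpa [offDiag] using hq
  exact S.K_self_offDiag γ x

end Scheme

theorem Xi_nonneg {κ : ℝ → ℝ} {γ : ℝ} (hγ : 0 < γ) (hκ : 0 ≤ κ γ) (n : ℕ) : 0 ≤ Xi κ γ n := by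
  unfold Xi
  exact mul_nonneg hγ.le (Finset.sum_nonneg fun k _ => by positivity)

/-- The recursion for the variance: a step of the scheme adds `γ` to it, and the expansion of the
distance by `√(1 + γ κ(γ))` rescales it. -/
theorem Xi_succ {κ : ℝ → ℝ} {γ : ℝ} (hγ : 0 < γ) (hκ : 0 ≤ κ γ) (n : ℕ) :
    (1 + γ * κ γ) * Xi κ γ (n + 1) = γ + Xi κ γ n := by
  have h1 : 0 < 1 + γ * κ γ := by positivity
  induction n with
  | zero => simp [Xi]; field_simp
  | succ n ih =>
    have hs : ∀ n, Xi κ γ (n + 1) = Xi κ γ n + γ * ((1 + γ * κ γ) ^ (n + 1))⁻¹ := fun n => by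
      rw [Xi, Xi, Finset.sum_Icc_succ_top (by omega)]; ring
    rw [hs (n + 1), mul_add, ih, hs n, add_assoc]
    congr 2
    field_simp
    ring

/-- The probability that the reflection coupling has not met after `n` steps. By induction, the law
of the distance is compared with that of a one-dimensional reflected Gaussian walk. -/
theorem Scheme.K_pow_offDiag_le {d : ℕ} (S : Scheme d) {κ : ℝ → ℝ} {γ : ℝ} (hγ : 0 < γ)
    (hκ : 0 ≤ κ γ) (hT : ∀ x y : S.X, ‖S.gap γ x y‖ ^ 2 ≤ (1 + γ * κ γ) * ‖(x : E d) - y‖ ^ 2)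
    (n : ℕ) (x y : S.X) : (S.K γ ^ n) (x, y) (offDiag S.X) ≤
      ENNReal.ofReal (signMean (Xi κ γ n).toNNReal ‖(x : E d) - y‖) := by
  induction n generalizing x y with
  | zero =>
    rw [kernel_pow_zero_apply, Measure.dirac_apply' _ S.measurableSet_offDiag]
    by_cases h : x = y
    · simp [offDiag, h]
    · have hx : 0 < ‖(x : E d) - y‖ := norm_pos_iff.2 (sub_ne_zero.2 (Subtype.coe_ne_coe.2 h))
      have h0 : (Xi κ γ 0).toNNReal = 0 := by simp [Xi]
      rw [h0, signMean_zero_left hx, ENNReal.ofReal_one]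
      exact indicator_le_self' (fun _ _ => zero_le) _
  | succ n ih =>
    set s := (Xi κ γ n).toNNReal with hs
    have hc : 0 < √(1 + γ * κ γ) := Real.sqrt_pos.2 (by positivity)
    rw [kernel_pow_succ_apply_eq_lintegral _ _ _ S.measurableSet_offDiag]
    calc ∫⁻ q, (S.K γ ^ n) q (offDiag S.X) ∂(S.K γ (x, y))
        ≤ ∫⁻ q, ENNReal.ofReal (signMean s ‖(q.1 : E d) - q.2‖) ∂(S.K γ (x, y)) :=
          lintegral_mono fun q => ih q.1 q.2
      _ ≤ ENNReal.ofReal (∫ g, signMean s (‖S.gap γ x y‖ - 2 * g)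
            ∂(gaussianReal 0 γ.toNNReal)) := by
          refine S.lintegral_K_le hγ (signMean_neg s) (signMean_mono s) (fun a => ?_) x y
          exact Integrable.of_bound ((signMean_mono s).measurable.comp
            (by fun_prop)).aestronglyMeasurable 1 (ae_of_all _ fun _ => abs_signMean_le _ _)
      _ = ENNReal.ofReal (signMean (γ.toNNReal + s) ‖S.gap γ x y‖) := by rw [integral_signMean]
      _ ≤ ENNReal.ofReal (signMean (γ.toNNReal + s)
            (√(1 + γ * κ γ) * ‖(x : E d) - y‖)) := by
          refine ENNReal.ofReal_le_ofReal (signMean_mono _ ?_)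
          have := Real.sqrt_le_sqrt (hT x y)
          rwa [Real.sqrt_sq (norm_nonneg _), Real.sqrt_mul (by positivity),
            Real.sqrt_sq (norm_nonneg _)] at this
      _ = _ := by
          rw [signMean_mul hc]
          rw [NNReal.coe_add, hs, Real.coe_toNNReal _ hγ.le,
            Real.coe_toNNReal _ (Xi_nonneg hγ hκ _), Real.coe_toNNReal _ (Xi_nonneg hγ hκ _),
            Real.sq_sqrt (by positivity), Xi_succ hγ hκ]

/-! ### Wasserstein bounds and the convergence theorem -/

theorem IsMarkovCoupling.map_pow {d : ℕ} {X : Set (E d)} {K : Kernel (X × X) (X × X)}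
    {R : Kernel X X} (h : IsMarkovCoupling K R) (k : ℕ) (x y : X) :
    ((K ^ k) (x, y)).map Prod.fst = (R ^ k) x ∧ ((K ^ k) (x, y)).map Prod.snd = (R ^ k) y := by
  obtain ⟨hR, -, h⟩ := h
  induction k with
  | zero =>
    simp only [kernel_pow_zero_apply]
    exact ⟨Measure.map_dirac' measurable_fst _, Measure.map_dirac' measurable_snd _⟩
  | succ k ih =>
    constructor
    · refine Measure.ext_of_lintegral _ fun f hf => ?_
      rw [lintegral_map hf measurable_fst,
        lintegral_kernel_pow_succ _ _ _ (f := fun q : X × X => f q.1)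
          (hf.comp measurable_fst), lintegral_kernel_pow_succ _ _ _ hf, ← ih.1,
        lintegral_map hf.lintegral_kernel measurable_fst]
      refine lintegral_congr fun q => ?_
      rw [← (h q.1 q.2).1, lintegral_map hf measurable_fst]
    · refine Measure.ext_of_lintegral _ fun f hf => ?_
      rw [lintegral_map hf measurable_snd,
        lintegral_kernel_pow_succ _ _ _ (f := fun q : X × X => f q.2)
          (hf.comp measurable_snd), lintegral_kernel_pow_succ _ _ _ hf, ← ih.2,
        lintegral_map hf.lintegral_kernel measurable_snd]
      refine lintegral_congr fun q => ?_
      rw [← (h q.1 q.2).2, lintegral_map hf measurable_snd]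

theorem IsMarkovCoupling.wasserstein_pow_le {d : ℕ} {X : Set (E d)} {K : Kernel (X × X) (X × X)}
    {R : Kernel X X} (h : IsMarkovCoupling K R) (c : X × X → ℝ) (k : ℕ) (x y : X) :
    wasserstein c ((R ^ k) x) ((R ^ k) y) ≤ ∫⁻ q, ENNReal.ofReal (c q) ∂((K ^ k) (x, y)) :=
  iInf₂_le (f := fun ζ _ => ∫⁻ q, ENNReal.ofReal (c q) ∂ζ) _ (h.map_pow k x y)

/-- For `gbar ≤ 1` the logarithm of `c = B + A λ^{-(1 + gbar) ℓ} (1 + gbar) ℓ` splits into the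
terms of the explicit rate. -/
theorem log_burnIn_le {lam A gbar B : ℝ} {ℓ : ℕ} (hlam : lam ∈ Ioo (0 : ℝ) 1) (hA : 0 < A)
    (hg : gbar ∈ Icc (0 : ℝ) 1) (hB : 1 ≤ B) :
    Real.log (B + burnIn lam A gbar ℓ) ≤
      Real.log B + Real.log (1 + 2 * A * ℓ) + 2 * ℓ * Real.log lam⁻¹ := by
  have hw : 0 < Real.log lam⁻¹ := Real.log_pos (one_lt_inv_iff₀.2 hlam)
  have hx : lam ^ (-(1 + gbar) * ℓ) ≤ Real.exp (2 * ℓ * Real.log lam⁻¹) := by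
    rw [Real.rpow_def_of_pos hlam.1]
    apply Real.exp_le_exp.2
    have h1 : Real.log lam * (-(1 + gbar) * ℓ) = (1 + gbar) * (ℓ * Real.log lam⁻¹) := by
      rw [Real.log_inv]; ring
    rw [h1, mul_assoc]
    gcongr
    linarith [hg.2]
  have hx1 : 1 ≤ Real.exp (2 * ℓ * Real.log lam⁻¹) := Real.one_le_exp (by positivity)
  have hp := Real.rpow_pos_of_pos hlam.1 (-(1 + gbar) * ℓ)
  set x := Real.exp (2 * ℓ * Real.log lam⁻¹) with hxd
  have hb : burnIn lam A gbar ℓ ≤ A * x * 2 * ℓ := by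
    unfold burnIn
    have := hg.1
    gcongr
    linarith [hg.2]
  have hb0 : 0 ≤ burnIn lam A gbar ℓ := by
    unfold burnIn; have := hg.1; positivity
  have hle : B + burnIn lam A gbar ℓ ≤ B * (1 + 2 * A * ℓ) * x := by
    have h2 : 0 ≤ 2 * A * ℓ * x := by positivity
    nlinarith [mul_le_mul_of_nonneg_left hx1 (by linarith : 0 ≤ B),
      mul_le_mul_of_nonneg_right hB h2]
  calc _ ≤ Real.log (B * (1 + 2 * A * ℓ) * x) := Real.log_le_log (by linarith) hle
    _ = _ := by
      rw [Real.log_mul (by positivity) (by positivity), Real.log_mul (by positivity)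
        (by positivity), hxd, Real.log_exp]

/-- Explicit bound for the inverse rate. For `ε = 1` one has `ρ = 1` and the left side is `0`. -/
theorem inv_log_rho_inv_le {lam A gbar B ε : ℝ} {ℓ : ℕ} (hlam : lam ∈ Ioo (0 : ℝ) 1) (hA : 0 < A)
    (hg : gbar ∈ Icc (0 : ℝ) 1) (hℓ : 1 ≤ ℓ) (hB : 1 ≤ B) (hε : ε ∈ Ioc (0 : ℝ) 1) :
    (Real.log (rho lam A gbar ℓ B ε)⁻¹)⁻¹ ≤
      (1 + Real.log B + Real.log (1 + 2 * A * ℓ) + 2 * ℓ * Real.log lam⁻¹) /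
        (Real.log lam⁻¹ * ε) := by
  have hw : 0 < Real.log lam⁻¹ := Real.log_pos (one_lt_inv_iff₀.2 hlam)
  have hlogB := Real.log_nonneg hB
  have hlogA : 0 ≤ Real.log (1 + 2 * A * ℓ) :=
    Real.log_nonneg (le_add_of_nonneg_right (by positivity))
  have hε0 := hε.1
  rcases hε.2.eq_or_lt with rfl | hε1
  · rw [rho]
    simp only [sub_self, Real.log_zero, mul_zero, zero_div, Real.exp_zero, inv_one, Real.log_one,
      inv_zero]
    positivity
  · have hc : 1 < B + burnIn lam A gbar ℓ := by linarith [burnIn_pos (ℓ := ℓ) hlam.1 hA hg.1 hℓ]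
    have hlc := log_burnIn_le (ℓ := ℓ) hlam hA hg hB
    have hlc0 := Real.log_pos hc
    rw [rho_eq_rpow hlam.1, Real.log_inv, Real.log_rpow hlam.1, interpExp]
    set c := B + burnIn lam A gbar ℓ
    have hL : ε ≤ -Real.log (1 - ε) := by
      linarith [Real.log_le_sub_one_of_pos (by linarith : 0 < 1 - ε)]
    set M := -Real.log (1 - ε) with hM
    have hlogM : Real.log (1 - ε) = -M := by rw [hM, neg_neg]
    have hlogw : Real.log lam = -Real.log lam⁻¹ := by rw [Real.log_inv, neg_neg]
    have hM0 : 0 < M := by linarith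
    rw [hlogM, hlogw]
    set w := Real.log lam⁻¹
    have h1 : (-(-M / (-M - Real.log c) * -w))⁻¹ = (1 + Real.log c / M) / w := by
      have : -M - Real.log c ≠ 0 := by linarith
      have : M + Real.log c ≠ 0 := by linarith
      rw [show -M - Real.log c = -(M + Real.log c) by ring, neg_div_neg_eq]
      field_simp
    rw [h1, div_le_div_iff₀ hw (by positivity)]
    have h2 : Real.log c / M * ε ≤ Real.log c := by
      rw [div_mul_eq_mul_div, div_le_iff₀ hM0]
      gcongr
    have h3 : (1 + Real.log c / M) * ε ≤
        1 + Real.log B + Real.log (1 + 2 * A * ℓ) + 2 * ℓ * w := by linarith [hε.2]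
    calc (1 + Real.log c / M) * (w * ε) = ((1 + Real.log c / M) * ε) * w := by ring
      _ ≤ _ := by gcongr

namespace Scheme

variable {d : ℕ} (S : Scheme d) {L R₁ m₁ m mb A : ℝ}

theorem norm_gap_sq (γ : ℝ) (x y : E d) : ‖S.gap γ x y‖ ^ 2 =
    ‖x - y‖ ^ 2 + 2 * γ * ⟪S.b x - S.b y, x - y⟫ + γ ^ 2 * ‖S.b x - S.b y‖ ^ 2 := by
  have : S.gap γ x y = -((x - y) + γ • (S.b x - S.b y)) := by
    rw [gap, T, T, smul_sub]; abel
  rw [this, norm_neg, norm_add_sq_real, real_inner_smul_right, real_inner_comm, norm_smul,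
    mul_pow, Real.norm_eq_abs, sq_abs]
  ring

theorem norm_gap_sq_le (hLip : S.LipschitzDrift L) {γ : ℝ} (hγ : 0 < γ) {c : ℝ} {x y : E d}
    (hx : x ∈ S.X) (hy : y ∈ S.X) (h : ⟪S.b x - S.b y, x - y⟫ ≤ -c * ‖x - y‖ ^ 2) :
    ‖S.gap γ x y‖ ^ 2 ≤ (1 + γ * (-2 * c + L ^ 2 * γ)) * ‖x - y‖ ^ 2 := by
  have h1 : ‖S.b x - S.b y‖ ^ 2 ≤ L ^ 2 * ‖x - y‖ ^ 2 := by
    rw [← mul_pow]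
    exact pow_le_pow_left₀ (norm_nonneg _) (hLip.2.1 x hx y hy) 2
  rw [norm_gap_sq]
  nlinarith [mul_le_mul_of_nonneg_left h1 (sq_nonneg γ), mul_le_mul_of_nonneg_left h hγ.le]

/-- The unsquared bound, from `√(1 + 2 u) ≤ 1 + u`. -/
theorem norm_gap_le (hLip : S.LipschitzDrift L) {γ : ℝ} (hγ : 0 < γ) {c : ℝ} {x y : E d}
    (hx : x ∈ S.X) (hy : y ∈ S.X) (h : ⟪S.b x - S.b y, x - y⟫ ≤ -c * ‖x - y‖ ^ 2) :
    ‖S.gap γ x y‖ ≤ (1 + γ * (-c + γ * L ^ 2 / 2)) * ‖x - y‖ := by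
  have h1 := S.norm_gap_sq_le hLip hγ hx hy h
  rcases (norm_nonneg (x - y)).eq_or_lt with h0 | h0
  · rw [← h0] at h1 ⊢
    have : ‖S.gap γ x y‖ = 0 := by
      have := sq_nonneg ‖S.gap γ x y‖
      exact pow_eq_zero_iff two_ne_zero |>.1 (by nlinarith)
    simp [this]
  · have h2 : 0 ≤ 1 + γ * (-2 * c + L ^ 2 * γ) := by
      by_contra! hneg
      nlinarith [sq_nonneg ‖S.gap γ x y‖, mul_neg_of_neg_of_pos hneg (pow_pos h0 2)]
    refine abs_le_of_sq_le_sq (h1.trans ?_) (mul_nonneg (by nlinarith) h0.le) |> (abs_le.1 · |>.2)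
    rw [mul_pow]
    gcongr
    nlinarith [sq_nonneg (γ * (-c + γ * L ^ 2 / 2))]

/-- Under co-coercivity and for small step sizes `T_γ` does not expand distances. -/
theorem norm_gap_le_of_coCoercive (hco : S.CoCoercive mb) {γ : ℝ} (hγ : 0 < γ) (hγm : γ ≤ 2 * mb)
    {x y : E d} (hx : x ∈ S.X) (hy : y ∈ S.X) : ‖S.gap γ x y‖ ≤ ‖x - y‖ := by
  refine abs_le_of_sq_le_sq (b := ‖x - y‖) ?_ (norm_nonneg _) |> (abs_le.1 · |>.2)
  rw [norm_gap_sq]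
  have h1 := mul_le_mul_of_nonneg_left (hco.2 x hx y hy) hγ.le
  have h2 : γ * γ * ‖S.b x - S.b y‖ ^ 2 ≤ γ * (2 * mb) * ‖S.b x - S.b y‖ ^ 2 := by gcongr
  nlinarith

theorem measurable_lyapunov (R₁ : ℝ) : Measurable (S.lyapunov R₁) := by
  unfold lyapunov; fun_prop

theorem one_le_lyapunov (hR : 0 < R₁) (q : S.X × S.X) : 1 ≤ S.lyapunov R₁ q := by
  unfold lyapunov
  have : 0 ≤ ‖(q.1 : E d) - q.2‖ / R₁ := by positivity
  linarith

theorem lyapunov_le_two (hR : 0 < R₁) {q : S.X × S.X} (hq : q ∈ closePairs S.X R₁) :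
    S.lyapunov R₁ q ≤ 2 := by
  have : ‖(q.1 : E d) - q.2‖ / R₁ ≤ 1 := (div_le_one hR).2 hq
  unfold lyapunov; linarith

theorem bddAbove_lyapunov (hR : 0 < R₁) : BddAbove (S.lyapunov R₁ '' closePairs S.X R₁) :=
  ⟨2, by rintro _ ⟨q, hq, rfl⟩; exact S.lyapunov_le_two hR hq⟩

theorem lyapunov_le_B (hR : 0 < R₁) {q : S.X × S.X} (hq : q ∈ closePairs S.X R₁) :
    S.lyapunov R₁ q ≤ S.B R₁ :=
  le_csSup (S.bddAbove_lyapunov hR) ⟨q, hq, rfl⟩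

theorem exists_diag_mem_closePairs (hR : 0 ≤ R₁) :
    ∃ x : S.X, (x, x) ∈ closePairs S.X R₁ := by
  obtain ⟨x, hx⟩ := S.nonempty
  exact ⟨⟨x, hx⟩, by simpa [closePairs] using hR⟩

theorem B_mem (hR : 0 < R₁) : S.B R₁ ∈ Icc (1 : ℝ) 2 := by
  obtain ⟨x, hx⟩ := S.exists_diag_mem_closePairs hR.le
  refine ⟨(S.one_le_lyapunov hR _).trans (S.lyapunov_le_B hR hx), ?_⟩
  refine csSup_le ⟨_, (x, x), hx, rfl⟩ ?_
  rintro _ ⟨q, hq, rfl⟩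
  exact S.lyapunov_le_two hR hq

/-- The mean of the distance after one step is at most `‖T_γ(y) - T_γ(x)‖`: the case of a linear `F`
in `lintegral_K_le`. -/
theorem lintegral_lyapunov_le (hR : 0 < R₁) {γ : ℝ} (hγ : 0 < γ) (x y : S.X) :
    ∫⁻ q, ENNReal.ofReal (S.lyapunov R₁ q) ∂(S.K γ (x, y)) ≤
      ENNReal.ofReal (1 + ‖S.gap γ x y‖ / R₁) := by
  have hMk := (S.isMarkovCoupling hγ).2.1
  have hid : Integrable (fun g : ℝ => g) (gaussianReal 0 γ.toNNReal) :=
    (memLp_id_gaussianReal 1).integrable (by simp)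
  have h := S.lintegral_K_le hγ (F := fun t => t / R₁) (fun t => neg_div _ _)
    (fun s t h => by simp only; gcongr) (fun a => ((integrable_const a).sub
      (hid.const_mul 2)).div_const R₁) x y
  have hmean : ∫ g, (‖S.gap γ x y‖ - 2 * g) / R₁ ∂(gaussianReal 0 γ.toNNReal) =
      ‖S.gap γ x y‖ / R₁ := by
    rw [integral_div, integral_sub (integrable_const _) (hid.const_mul 2), integral_const_mul,
      integral_id_gaussianReal]
    simp
  rw [hmean] at h
  have hsplit : ∀ q : S.X × S.X, ENNReal.ofReal (S.lyapunov R₁ q) =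
      1 + ENNReal.ofReal (‖(q.1 : E d) - q.2‖ / R₁) := fun q => by
    rw [lyapunov, ENNReal.ofReal_add zero_le_one (by positivity), ENNReal.ofReal_one]
  simp_rw [hsplit]
  rw [lintegral_add_left measurable_const, ENNReal.ofReal_add zero_le_one (by positivity),
    ENNReal.ofReal_one]
  simpa using add_le_add_right h 1

theorem lamBar_mem {gbar : ℝ} (h : gbar * L ^ 2 < 2 * m₁) : lamBar m₁ L gbar ∈ Ioo (0 : ℝ) 1 :=
  ⟨Real.exp_pos _, Real.exp_lt_one_iff.2 (by linarith)⟩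

theorem log_lamBar_inv (gbar : ℝ) :
    Real.log (lamBar m₁ L gbar)⁻¹ = (m₁ - gbar * L ^ 2 / 2) / 2 := by
  rw [lamBar, Real.log_inv, Real.log_exp]; ring

/-- The drift condition. At distance at least `R₁` the loss `γ (m₁ - γ L² / 2)` of the distance is
worth half as much for `1 + ‖x - y‖ / R₁`, whence the factor `1 / 2` in the definition of `λ`. -/
theorem drift_lyapunov (hLip : S.LipschitzDrift L) (hDis : S.DissipativeAtInfinity R₁ m₁)
    (hA : m₁ ≤ A) {γ gbar : ℝ} (hγ : γ ∈ Ioc 0 gbar) (hg : gbar * L ^ 2 < 2 * m₁)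
    (hgap : ∀ x y : S.X,
      ‖S.gap γ x y‖ ≤ (1 + γ * (A - m₁ + γ * L ^ 2 / 2)) * ‖(x : E d) - y‖) :
    Drift (S.K γ) (S.lyapunov R₁) (lamBar m₁ L gbar ^ γ) (A * γ) (closePairs S.X R₁) := by
  obtain ⟨hR, hm₁, hdis⟩ := hDis
  obtain ⟨hγ0, hγg⟩ := hγ
  rintro ⟨x, y⟩
  refine (S.lintegral_lyapunov_le hR hγ0 x y).trans (ENNReal.ofReal_le_ofReal ?_)
  set M := m₁ - gbar * L ^ 2 / 2 with hM
  have hM0 : 0 < M := by linarith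
  have hLg : γ * L ^ 2 ≤ gbar * L ^ 2 := by gcongr
  have hlam : 1 - γ * M / 2 ≤ lamBar m₁ L gbar ^ γ := by
    rw [lamBar, ← Real.exp_mul]
    calc 1 - γ * M / 2 = -(M / 2) * γ + 1 := by ring
      _ ≤ _ := by rw [neg_div]; exact Real.add_one_le_exp _
  have hV1 := S.one_le_lyapunov hR (x, y)
  set r := ‖(x : E d) - y‖ with hr
  have hr0 : 0 ≤ r := norm_nonneg _
  have hVr : S.lyapunov R₁ (x, y) = 1 + r / R₁ := rfl
  have hlamV := mul_le_mul_of_nonneg_right hlam (by linarith : 0 ≤ S.lyapunov R₁ (x, y))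
  rw [hVr] at hlamV hV1 ⊢
  by_cases hC : (x, y) ∈ closePairs S.X R₁
  · rw [indicator_of_mem hC]
    have hu1 : r / R₁ ≤ 1 := (div_le_one hR).2 hC
    have hu0 : 0 ≤ r / R₁ := by positivity
    have h1 : ‖S.gap γ x y‖ / R₁ ≤ (1 + γ * (A - m₁ + γ * L ^ 2 / 2)) * (r / R₁) := by
      rw [mul_div_assoc']; gcongr; exact hgap x y
    set u := r / R₁
    have h2 : (A - m₁ + γ * L ^ 2 / 2) * u ≤ A - m₁ + gbar * L ^ 2 / 2 := by
      have hnn : 0 ≤ A - m₁ + γ * L ^ 2 / 2 := by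
        have : 0 ≤ γ * L ^ 2 / 2 := by positivity
        linarith
      calc _ ≤ (A - m₁ + γ * L ^ 2 / 2) * 1 := by gcongr
        _ ≤ _ := by linarith
    have h3 : M / 2 * (1 + u) ≤ M := by nlinarith
    have h4 : γ * ((A - m₁ + γ * L ^ 2 / 2) * u + M / 2 * (1 + u)) ≤ γ * A := by
      gcongr; linarith
    nlinarith
  · rw [indicator_of_notMem hC, add_zero]
    have hrR : R₁ ≤ r := le_of_lt (by simpa [closePairs] using hC)
    have hu1 : 1 ≤ r / R₁ := (one_le_div hR).2 hrR
    have hgap' := S.norm_gap_le hLip hγ0 x.2 y.2 (hdis x x.2 y y.2 hrR)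
    have h1 : ‖S.gap γ x y‖ / R₁ ≤ (1 + γ * (-m₁ + γ * L ^ 2 / 2)) * (r / R₁) := by
      rw [mul_div_assoc']; gcongr
    set u := r / R₁
    have h2 : γ * ((-m₁ + γ * L ^ 2 / 2) * u) ≤ γ * (-M * u) := by
      gcongr; linarith
    have h3 : γ * M / 2 * (1 + u) ≤ γ * M * u := by
      have : 0 < γ * M := by positivity
      nlinarith
    nlinarith

theorem epsBar_le {Ψ : ℝ → ℕ → ℝ → ℝ} {gbar : ℝ} {ℓ : ℕ}
    (hΨ : ∀ γ ∈ Ioc 0 gbar, ∀ t : ℝ, 0 ≤ t → 0 ≤ Ψ γ ℓ t) {γ : ℝ} (hγ : γ ∈ Ioc 0 gbar)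
    {q : S.X × S.X} (hq : q ∈ closePairs S.X R₁) :
    epsBar S.X Ψ gbar R₁ ℓ ≤ Ψ γ ℓ ‖(q.1 : E d) - q.2‖ := by
  refine csInf_le ⟨0, ?_⟩ ⟨γ, hγ, q, hq, rfl⟩
  rintro _ ⟨γ', hγ', q', -, rfl⟩
  exact hΨ γ' hγ' _ (norm_nonneg _)

/-- The convergence theorem for the scheme, given a minorization function `Ψ`. -/
theorem converges_of_minorization (hLip : S.LipschitzDrift L)
    (hDis : S.DissipativeAtInfinity R₁ m₁) (hA : m₁ ≤ A) {gbar : ℝ} (hg0 : 0 < gbar)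
    (hg : gbar * L ^ 2 < 2 * m₁) {Ψ : ℝ → ℕ → ℝ → ℝ}
    (hgap : ∀ γ ∈ Ioc 0 gbar, ∀ x y : S.X,
      ‖S.gap γ x y‖ ≤ (1 + γ * (A - m₁ + γ * L ^ 2 / 2)) * ‖(x : E d) - y‖)
    (hΨ : ∀ γ ∈ Ioc 0 gbar, ∀ ℓ : ℕ, 1 ≤ ℓ → ∀ t : ℝ, 0 ≤ t → Ψ γ ℓ t ∈ Icc (0 : ℝ) 1)
    (hmin : ∀ γ ∈ Ioc 0 gbar, ∀ ℓ : ℕ, 1 ≤ ℓ → ∀ x y : S.X,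
      (S.K γ ^ (ℓ * ⌈1 / γ⌉₊)) (x, y) (offDiag S.X) ≤
        ENNReal.ofReal (1 - Ψ γ ℓ ‖(x : E d) - (y : E d)‖))
    (hpos : ∀ γ ∈ Ioc 0 gbar, ∀ ℓ : ℕ, 1 ≤ ℓ → ∀ M' : ℝ, 0 ≤ M' →
      ∃ δ > 0, ∀ q ∈ closePairs S.X M', δ ≤ Ψ γ ℓ ‖(q.1 : E d) - (q.2 : E d)‖)
    (heps : ∀ ℓ : ℕ, 1 ≤ ℓ → 0 < epsBar S.X Ψ gbar R₁ ℓ)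
    (heps1 : ∀ ℓ : ℕ, 1 ≤ ℓ → S.X.Nontrivial → epsBar S.X Ψ gbar R₁ ℓ < 1) :
    S.Converges L R₁ m₁ A Ψ gbar := by
  have hR := hDis.1
  have hm₁ := hDis.2.1
  have hA0 : 0 < A := by linarith
  have hlam := lamBar_mem hg
  have hwA : 2 * Real.log (1 / lamBar m₁ L gbar) ≤ A := by
    rw [one_div, log_lamBar_inv]
    have : 0 ≤ gbar * L ^ 2 := by positivity
    linarith
  have hB := S.B_mem hR
  have hdrift := fun γ hγ => S.drift_lyapunov hLip hDis hA (γ := γ) hγ hg (hgap γ hγ)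
  refine ⟨⟨hlam, hA0.le, hR, S.measurable_lyapunov R₁, S.one_le_lyapunov hR, ?_, subset_rfl,
    fun γ hγ => S.isMarkovCoupling hγ.1, hdrift, fun γ hγ x => ?_, hΨ, hmin, hpos⟩,
    fun ℓ hℓ => ⟨⟨fun γ hγ x y k => ?_, fun hg1 _ => ?_⟩, heps ℓ hℓ, fun hX => ?_⟩⟩
  · exact measurableSet_le (by fun_prop) measurable_const
  · have := (S.isMarkovCoupling hγ.1).2.1
    rw [prob_compl_eq_one_iff S.measurableSet_offDiag, S.K_self_offDiag]
  · have hMk := (S.isMarkovCoupling hγ.1).2.1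
    have hW := (S.isMarkovCoupling hγ.1).wasserstein_pow_le (cost (S.lyapunov R₁)) k x y
    by_cases hxy : (x, y) ∈ offDiag S.X
    · have hX : S.X.Nontrivial := ⟨x, x.2, y, y.2, Subtype.coe_ne_coe.2 hxy⟩
      have hε : epsBar S.X Ψ gbar R₁ ℓ ∈ Ioo (0 : ℝ) 1 := ⟨heps ℓ hℓ, heps1 ℓ hℓ hX⟩
      have hρ := rho_mem (ℓ := ℓ) hlam hA0 hg0.le hℓ hB.1 hε
      have hmain := lintegral_pow_cost_le S.measurableSet_offDiag (S.K_offDiag_eq_zero γ)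
        (S.measurable_lyapunov R₁) (S.one_le_lyapunov hR) hlam hwA hγ hℓ (hdrift γ hγ) hB.1
        (fun q hq => S.lyapunov_le_B hR hq) hε (fun q hq => (hmin γ hγ ℓ hℓ q.1 q.2).trans
          (ENNReal.ofReal_le_ofReal (sub_le_sub_left
            (S.epsBar_le (fun γ hγ t ht => (hΨ γ hγ ℓ hℓ t ht).1) hγ hq) 1))) k hxy
      set ρ := rho (lamBar m₁ L gbar) A gbar ℓ (S.B R₁) (epsBar S.X Ψ gbar R₁ ℓ)
      have hcost : cost (S.lyapunov R₁) (x, y) = S.lyapunov R₁ (x, y) := indicator_of_mem hxy _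
      rw [hcost, indicator_of_mem hxy, Pi.one_apply, mul_one, mul_one]
      refine ⟨hW, hmain, hW.trans (hmain.trans (ENNReal.ofReal_le_ofReal ?_))⟩
      have hρ0 : 0 < ρ := hlam.1.trans_le hρ.1
      have hD1 : 0 ≤ D₁ (lamBar m₁ L gbar) A gbar := by
        have := Real.log_pos (one_lt_one_div hlam.1 hlam.2)
        have := Real.rpow_pos_of_pos hlam.1 gbar
        unfold D₁; positivity
      have hD2 : 0 ≤ D₂ (lamBar m₁ L gbar) A gbar ℓ :=
        mul_nonneg hD1 (burnIn_pos hlam.1 hA0 hg0.le hℓ).le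
      have hC1 : 0 ≤ C₁ A gbar ρ := by
        have := Real.log_pos (one_lt_one_div hρ0 hρ.2)
        have := Real.rpow_pos_of_pos hρ0 gbar
        unfold C₁; positivity
      have hV := S.one_le_lyapunov hR (x, y)
      have hk : (0 : ℝ) ≤ k * γ / 4 := by have := hγ.1; positivity
      have hle : lamBar m₁ L gbar ^ (k * γ / 4) ≤ ρ ^ (k * γ / 4) :=
        Real.rpow_le_rpow hlam.1.le hρ.1 hk
      have hρk : 0 ≤ ρ ^ (k * γ / 4) := Real.rpow_nonneg hρ0.le _
      set V := S.lyapunov R₁ (x, y)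
      calc _ ≤ ρ ^ (k * γ / 4) * (D₁ (lamBar m₁ L gbar) A gbar * V +
            D₂ (lamBar m₁ L gbar) A gbar ℓ * V) + C₁ A gbar ρ * ρ ^ (k * γ / 4) * V := by
            refine add_le_add ?_ (le_mul_of_one_le_right (by positivity) hV)
            gcongr
            exact le_mul_of_one_le_right hD2 hV
        _ = _ := by ring
    · have h0 : ∫⁻ q, ENNReal.ofReal (cost (S.lyapunov R₁) q) ∂((S.K γ ^ k) (x, y)) = 0 := by
        have hind : ∀ q, ENNReal.ofReal (cost (S.lyapunov R₁) q) =
            (offDiag S.X).indicator (fun q => ENNReal.ofReal (S.lyapunov R₁ q)) q := by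
          intro q; unfold cost; by_cases h : q ∈ offDiag S.X <;> simp [h]
        simp_rw [hind]
        rw [lintegral_indicator S.measurableSet_offDiag, setLIntegral_measure_zero]
        exact pow_apply_eq_zero_of_absorbing S.measurableSet_offDiag (S.K_offDiag_eq_zero γ) k hxy
      exact ⟨hW, h0 ▸ zero_le, (hW.trans h0.le).trans zero_le⟩
  · rcases lt_or_ge (epsBar S.X Ψ gbar R₁ ℓ) 1 with h | h
    · exact inv_log_rho_inv_le hlam hA0 ⟨hg0.le, hg1⟩ hℓ hB.1 ⟨heps ℓ hℓ, h.le⟩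
    · refine absurd ‹epsBar S.X Ψ gbar R₁ ℓ ≤ _› (not_le.2 ?_)
      linarith [Real.exp_pos (-1)]
  · exact rho_mem hlam hA0 hg0.le hℓ hB.1 ⟨heps ℓ hℓ, heps1 ℓ hℓ hX⟩

end Scheme

/-! ### The minorization functions and the limit of small step sizes -/

theorem Φ_sub {a b : ℝ} (h : a ≤ b) : Φ b - Φ a = (gaussianReal 0 1).real (Ioc a b) := by
  rw [Φ, Φ, cdf_eq_real, cdf_eq_real, ← Iic_union_Ioc_eq_Iic h,
    measureReal_union ((Iic_disjoint_Ioi le_rfl).mono_right Ioc_subset_Ioi_self)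
      measurableSet_Ioc]
  ring

theorem Φ_mono : Monotone Φ := monotone_cdf _

theorem Φ_nonneg (t : ℝ) : 0 ≤ Φ t := cdf_nonneg _ t

theorem Φ_strictMono : StrictMono Φ := by
  intro a b h
  rw [← sub_pos, Φ_sub h.le]
  refine ENNReal.toReal_pos (fun h0 => ?_) (measure_ne_top _ _)
  have := gaussianReal_absolutelyContinuous' 0 one_ne_zero h0
  rw [Real.volume_Ioc] at this
  linarith [ENNReal.ofReal_eq_zero.1 this]

theorem Φ_pos (t : ℝ) : 0 < Φ t :=
  (Φ_nonneg (t - 1)).trans_lt (Φ_strictMono (by linarith))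

theorem two_mul_Φ_zero : 2 * Φ 0 = 1 := by
  have h1 := signMean_eq one_ne_zero 0
  have h2 := signMean_neg 1 0
  rw [neg_zero] at h2
  have h3 : -(0 : ℝ) / (2 * √((1 : NNReal) : ℝ)) = 0 := by simp
  rw [h3] at h1
  linarith

theorem two_mul_Φ_le_one {t : ℝ} (ht : t ≤ 0) : 2 * Φ t ≤ 1 := by
  linarith [Φ_mono ht, two_mul_Φ_zero]

theorem two_mul_Φ_lt_one {t : ℝ} (ht : t < 0) : 2 * Φ t < 1 := by
  linarith [Φ_strictMono ht, two_mul_Φ_zero]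

theorem Φ_sub_le {a b : ℝ} (h : a ≤ b) : Φ b - Φ a ≤ b - a := by
  rw [Φ_sub h, measureReal_def]
  refine ENNReal.toReal_le_of_le_ofReal (by linarith) ?_
  rw [gaussianReal_apply _ one_ne_zero]
  calc ∫⁻ x in Ioc a b, gaussianPDF 0 1 x ≤ ∫⁻ _ in Ioc a b, 1 := by
        refine lintegral_mono fun x => ENNReal.ofReal_le_one.2 ?_
        rw [gaussianPDFReal]
        have h1 : 1 ≤ √(2 * Real.pi * ((1 : NNReal) : ℝ)) := by
          rw [NNReal.coe_one, mul_one]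
          exact Real.one_le_sqrt.2 (by linarith [Real.pi_gt_three])
        have h2 : -(x - 0) ^ 2 / (2 * ((1 : NNReal) : ℝ)) ≤ 0 := by
          rw [NNReal.coe_one, neg_div]
          have : 0 ≤ (x - 0) ^ 2 / (2 * 1) := by positivity
          linarith
        exact mul_le_one₀ (inv_le_one_of_one_le₀ h1) (Real.exp_pos _).le (Real.exp_le_one_iff.2 h2)
    _ = ENNReal.ofReal (b - a) := by simp

theorem abs_Φ_sub_le (a b : ℝ) : |Φ a - Φ b| ≤ |a - b| := by
  rcases le_total a b with h | h
  · rw [abs_sub_comm, abs_sub_comm a, abs_of_nonneg (sub_nonneg.2 (Φ_mono h)),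
      abs_of_nonneg (sub_nonneg.2 h)]
    exact Φ_sub_le h
  · rw [abs_of_nonneg (sub_nonneg.2 (Φ_mono h)), abs_of_nonneg (sub_nonneg.2 h)]
    exact Φ_sub_le h

/-- `Φ(-t / (2 √s))` increases with the variance `s` and decreases with the distance `t`. -/
theorem Φ_neg_div_le {s s' t t' : ℝ} (hs : 0 < s) (hss : s ≤ s') (ht : 0 ≤ t) (htt : t ≤ t') :
    Φ (-t' / (2 * √s)) ≤ Φ (-t / (2 * √s')) := by
  have h0 : 0 < √s := Real.sqrt_pos.2 hs
  have h1 := Real.sqrt_le_sqrt hss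
  apply Φ_mono
  rw [neg_div, neg_div, neg_le_neg_iff]
  have h2 : 0 ≤ t' := ht.trans htt
  gcongr

theorem Xi_le {κ : ℝ → ℝ} {γ : ℝ} (hγ : 0 < γ) (hκ : 0 ≤ κ γ) (n : ℕ) : Xi κ γ n ≤ γ * n := by
  unfold Xi
  gcongr
  have h1 : 1 ≤ 1 + γ * κ γ := le_add_of_nonneg_right (by positivity)
  calc ∑ k ∈ Finset.Icc 1 n, ((1 + γ * κ γ) ^ k)⁻¹ ≤ ∑ k ∈ Finset.Icc 1 n, (1 : ℝ) :=
        Finset.sum_le_sum fun k _ => inv_le_one_of_one_le₀ (one_le_pow₀ h1)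
    _ = n := by simp

theorem le_Xi {κ : ℝ → ℝ} {γ : ℝ} (hγ : 0 < γ) (hκ : 0 ≤ κ γ) (n : ℕ) :
    γ * n * Real.exp (-(γ * n * κ γ)) ≤ Xi κ γ n := by
  unfold Xi
  have h1 : 1 ≤ 1 + γ * κ γ := le_add_of_nonneg_right (by positivity)
  have h2 : ∀ k ∈ Finset.Icc 1 n, Real.exp (-(γ * n * κ γ)) ≤ ((1 + γ * κ γ) ^ k)⁻¹ := by
    intro k hk
    rw [Real.exp_neg]
    refine inv_anti₀ (by positivity) ?_
    calc (1 + γ * κ γ) ^ k ≤ (1 + γ * κ γ) ^ n := pow_le_pow_right₀ h1 (Finset.mem_Icc.1 hk).2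
      _ ≤ Real.exp (γ * κ γ) ^ n := by
        gcongr
        linarith [Real.add_one_le_exp (γ * κ γ)]
      _ = Real.exp (γ * n * κ γ) := by rw [← Real.exp_nat_mul]; congr 1; ring
  rw [mul_assoc]
  gcongr
  calc n * Real.exp (-(γ * n * κ γ)) = ∑ k ∈ Finset.Icc 1 n, Real.exp (-(γ * n * κ γ)) := by simp
    _ ≤ _ := Finset.sum_le_sum h2

/-- The geometric sum defining `Ξ_n` in closed form. -/
theorem mul_Xi {κ : ℝ → ℝ} {γ : ℝ} (hγ : 0 < γ) (hκ : 0 ≤ κ γ) (n : ℕ) :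
    κ γ * Xi κ γ n = 1 - ((1 + γ * κ γ) ^ n)⁻¹ := by
  have h1 : 0 < 1 + γ * κ γ := by positivity
  induction n with
  | zero => simp [Xi]
  | succ n ih =>
    have h := Xi_succ hγ hκ n
    have h2 : κ γ * Xi κ γ (n + 1) * (1 + γ * κ γ) = κ γ * γ + (1 - ((1 + γ * κ γ) ^ n)⁻¹) := by
      rw [← ih]; linear_combination κ γ * h
    rw [← mul_left_inj' h1.ne', h2, pow_succ]
    field_simp
    ring

theorem kappa_nonneg {m L γ : ℝ} (hm : m ≤ 0) (hγ : 0 ≤ γ) : 0 ≤ kappa m L γ := by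
  unfold kappa
  have : 0 ≤ L ^ 2 * γ := by positivity
  linarith

theorem kappa_mono {m L γ γ' : ℝ} (h : γ ≤ γ') : kappa m L γ ≤ kappa m L γ' := by
  unfold kappa; gcongr

theorem le_mul_natMul_ceil {γ : ℝ} (hγ : 0 < γ) (ℓ : ℕ) : (ℓ : ℝ) ≤ γ * (ℓ * ⌈1 / γ⌉₊ : ℕ) := by
  push_cast
  calc (ℓ : ℝ) = ℓ * 1 := (mul_one _).symm
    _ ≤ ℓ * (γ * ⌈1 / γ⌉₊) := by gcongr; exact one_le_mul_ceil_one_div hγ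
    _ = _ := by ring

theorem mul_natMul_ceil_le {γ : ℝ} (hγ : 0 < γ) (ℓ : ℕ) :
    γ * (ℓ * ⌈1 / γ⌉₊ : ℕ) ≤ ℓ * (1 + γ) := by
  push_cast
  calc γ * (ℓ * ⌈1 / γ⌉₊) = ℓ * (γ * ⌈1 / γ⌉₊) := by ring
    _ ≤ _ := by gcongr; exact mul_ceil_one_div_le hγ

/-- A lower bound for `Ξ_{ℓ ⌈1/γ⌉}`, uniform in the step size. -/
theorem exists_le_Xi {m L gbar : ℝ} (hm : m ≤ 0) {ℓ : ℕ} (hℓ : 1 ≤ ℓ) :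
    ∃ ξ > 0, ∀ γ ∈ Ioc 0 gbar, ξ ≤ Xi (kappa m L) γ (ℓ * ⌈1 / γ⌉₊) := by
  have hℓ0 : (0 : ℝ) < ℓ := by exact_mod_cast hℓ
  refine ⟨ℓ * Real.exp (-(ℓ * (1 + gbar) * kappa m L gbar)), by positivity, fun γ hγ => ?_⟩
  refine le_trans ?_ (le_Xi hγ.1 (kappa_nonneg hm hγ.1.le) _)
  have h1 := le_mul_natMul_ceil hγ.1 ℓ
  have h2 := mul_natMul_ceil_le hγ.1 ℓ
  have hκ := kappa_nonneg (L := L) hm hγ.1.le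
  have h3 : γ * (ℓ * ⌈1 / γ⌉₊ : ℕ) ≤ ℓ * (1 + gbar) := h2.trans (by gcongr; exact hγ.2)
  have h4 := mul_le_mul h3 (kappa_mono (m := m) (L := L) hγ.2) hκ
    (hℓ0.le.trans (h1.trans h3))
  have h5 := hℓ0.le.trans h1
  gcongr

/-- For `ℓ ≥ 2` the variance `Ξ_{ℓ ⌈1/γ⌉}` at any step size `γ ≤ gbar ≤ 1` is at least
`Ξ_{⌈1/gbar⌉}` at the step size `gbar`: the time horizons compare as `ℓ γ ⌈1/γ⌉ ≥ 2` and
`gbar ⌈1/gbar⌉ ≤ 2`, and Bernoulli's inequality compares the discounts. -/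
theorem Xi_ceil_le {m L γ gbar : ℝ} (hm : m ≤ 0) (hγ : γ ∈ Ioc 0 gbar) (hg : gbar ≤ 1) {ℓ : ℕ}
    (hℓ : 2 ≤ ℓ) :
    Xi (kappa m L) gbar ⌈1 / gbar⌉₊ ≤ Xi (kappa m L) γ (ℓ * ⌈1 / γ⌉₊) := by
  obtain ⟨hγ0, hγg⟩ := hγ
  have hg0 : 0 < gbar := hγ0.trans_le hγg
  have hκγ := kappa_nonneg (L := L) hm hγ0.le
  have hκ := kappa_nonneg (L := L) hm hg0.le
  have hκle := kappa_mono (m := m) (L := L) hγg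
  set κ := kappa m L gbar with hκd
  set n := ℓ * ⌈1 / γ⌉₊ with hn
  have htime : gbar * ⌈1 / gbar⌉₊ ≤ γ * n := by
    have h1 : (2 : ℝ) ≤ ℓ := by exact_mod_cast hℓ
    linarith [mul_ceil_one_div_le hg0, le_mul_natMul_ceil hγ0 ℓ]
  have hmono : Xi (fun _ => κ) γ n ≤ Xi (kappa m L) γ n := by
    unfold Xi
    gcongr
  refine le_trans ?_ hmono
  change Xi (fun _ => κ) gbar ⌈1 / gbar⌉₊ ≤ _
  rcases hκ.eq_or_lt with h0 | h0
  · rw [← h0]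
    simpa [Xi] using htime
  · refine le_of_mul_le_mul_left ?_ h0
    have e1 := mul_Xi (κ := fun _ => κ) hg0 hκ ⌈1 / gbar⌉₊
    have e2 := mul_Xi (κ := fun _ => κ) hγ0 hκ n
    rw [e1, e2]
    have h1 : 1 + gbar * κ ≤ (1 + γ * κ) ^ (gbar / γ) := by
      have := one_add_mul_self_le_rpow_one_add (s := γ * κ) (p := gbar / γ)
        (by have : 0 ≤ γ * κ := by positivity
            linarith) ((one_le_div hγ0).2 hγg)
      rwa [← mul_assoc, div_mul_cancel₀ _ hγ0.ne'] at this
    have h2 : (1 + gbar * κ) ^ ⌈1 / gbar⌉₊ ≤ (1 + γ * κ) ^ n := by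
      calc (1 + gbar * κ) ^ ⌈1 / gbar⌉₊ ≤ ((1 + γ * κ) ^ (gbar / γ)) ^ ⌈1 / gbar⌉₊ := by gcongr
        _ = (1 + γ * κ) ^ (gbar / γ * ⌈1 / gbar⌉₊) := by
          rw [← Real.rpow_natCast, ← Real.rpow_mul (by positivity)]
        _ ≤ (1 + γ * κ) ^ (n : ℝ) := by
          refine Real.rpow_le_rpow_of_exponent_le ?_ ?_
          · have : 0 ≤ γ * κ := by positivity
            linarith
          · rw [div_mul_eq_mul_div, div_le_iff₀ hγ0, mul_comm (n : ℝ)]; exact htime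
        _ = _ := Real.rpow_natCast _ _
    have h3 : ((1 + γ * κ) ^ n)⁻¹ ≤ ((1 + gbar * κ) ^ ⌈1 / gbar⌉₊)⁻¹ :=
      inv_anti₀ (by positivity) h2
    linarith

theorem XiZero_pos {m : ℝ} (hm : m ≤ 0) {ℓ : ℕ} (hℓ : 1 ≤ ℓ) : 0 < XiZero m ℓ := by
  have hℓ0 : (0 : ℝ) < ℓ := by exact_mod_cast hℓ
  unfold XiZero
  split_ifs with h
  · exact hℓ0
  · have hm' : m < 0 := lt_of_le_of_ne hm h
    refine div_pos (sub_pos.2 (Real.exp_lt_one_iff.2 ?_)) (by linarith)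
    nlinarith

theorem tendsto_mul_natMul_ceil (ℓ : ℕ) :
    Tendsto (fun γ : ℝ => γ * (ℓ * ⌈1 / γ⌉₊ : ℕ)) (𝓝[>] 0) (𝓝 ℓ) := by
  have h1 : Tendsto (fun γ : ℝ => (ℓ : ℝ) * (1 + γ)) (𝓝[>] 0) (𝓝 ℓ) := by
    have : Tendsto (fun γ : ℝ => (ℓ : ℝ) * (1 + γ)) (𝓝 0) (𝓝 (ℓ * (1 + 0))) :=
      Continuous.tendsto (by fun_prop) 0
    rw [add_zero, mul_one] at this
    exact this.mono_left nhdsWithin_le_nhds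
  refine tendsto_of_tendsto_of_tendsto_of_le_of_le' tendsto_const_nhds h1 ?_ ?_
  · filter_upwards [self_mem_nhdsWithin] with γ hγ using le_mul_natMul_ceil hγ ℓ
  · filter_upwards [self_mem_nhdsWithin] with γ hγ using mul_natMul_ceil_le hγ ℓ

theorem tendsto_kappa (m L : ℝ) : Tendsto (kappa m L) (𝓝[>] 0) (𝓝 (-2 * m)) := by
  have : Tendsto (kappa m L) (𝓝 0) (𝓝 (-2 * m + L ^ 2 * 0)) :=
    Continuous.tendsto (by unfold kappa; fun_prop) 0
  rw [mul_zero, add_zero] at this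
  exact this.mono_left nhdsWithin_le_nhds

/-- For `m = 0` the closed form of `Ξ` degenerates as `γ → 0`, and `Ξ` is squeezed between
`γ n e^{-γ n κ(γ)}` and `γ n` instead. -/
theorem tendsto_Xi {m : ℝ} (hm : m ≤ 0) (L : ℝ) (ℓ : ℕ) :
    Tendsto (fun γ => Xi (kappa m L) γ (ℓ * ⌈1 / γ⌉₊)) (𝓝[>] 0) (𝓝 (XiZero m ℓ)) := by
  have hn := tendsto_mul_natMul_ceil ℓ
  have hκ := tendsto_kappa m L
  have hid : Tendsto (fun γ : ℝ => γ) (𝓝[>] 0) (𝓝 0) := nhdsWithin_le_nhds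
  unfold XiZero
  split_ifs with h0
  · have hlow := hn.mul ((hn.mul hκ).neg.rexp)
    rw [h0, mul_zero, mul_zero, neg_zero, Real.exp_zero, mul_one] at hlow
    refine tendsto_of_tendsto_of_tendsto_of_le_of_le' hlow hn ?_ ?_
    · filter_upwards [self_mem_nhdsWithin] with γ hγ
      rw [h0]
      exact le_Xi hγ (kappa_nonneg le_rfl (le_of_lt hγ)) _
    · filter_upwards [self_mem_nhdsWithin] with γ hγ using
        Xi_le hγ (kappa_nonneg hm (le_of_lt hγ)) _
  · have hm' : m < 0 := lt_of_le_of_ne hm h0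
    have hlog : Tendsto (fun γ => ((ℓ * ⌈1 / γ⌉₊ : ℕ) : ℝ) * Real.log (1 + γ * kappa m L γ))
        (𝓝[>] 0) (𝓝 (ℓ * (-2 * m))) := by
      have hup := hn.mul hκ
      have hden : Tendsto (fun γ => (1 + γ * kappa m L γ)⁻¹) (𝓝[>] 0) (𝓝 1) := by
        have := ((hid.mul hκ).const_add 1).inv₀ (by simp)
        simpa using this
      have hlow := hup.mul hden
      rw [mul_one] at hlow
      refine tendsto_of_tendsto_of_tendsto_of_le_of_le' hlow hup ?_ ?_
      · filter_upwards [self_mem_nhdsWithin] with γ hγ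
        have hγ0 : 0 < γ := hγ
        have hk := kappa_nonneg (L := L) hm hγ0.le
        have hp : 0 < 1 + γ * kappa m L γ := by positivity
        have h1 := Real.one_sub_inv_le_log_of_pos hp
        have h2 : 1 - (1 + γ * kappa m L γ)⁻¹ =
            γ * kappa m L γ * (1 + γ * kappa m L γ)⁻¹ := by field_simp; ring
        rw [h2] at h1
        calc _ = ((ℓ * ⌈1 / γ⌉₊ : ℕ) : ℝ) *
              (γ * kappa m L γ * (1 + γ * kappa m L γ)⁻¹) := by ring
          _ ≤ _ := by gcongr
      · filter_upwards [self_mem_nhdsWithin] with γ hγ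
        have hγ0 : 0 < γ := hγ
        have hk := kappa_nonneg (L := L) hm hγ0.le
        have hp : 0 < 1 + γ * kappa m L γ := by positivity
        have h1 := Real.log_le_sub_one_of_pos hp
        calc ((ℓ * ⌈1 / γ⌉₊ : ℕ) : ℝ) * Real.log (1 + γ * kappa m L γ)
            ≤ ((ℓ * ⌈1 / γ⌉₊ : ℕ) : ℝ) * (γ * kappa m L γ) := by gcongr; linarith
          _ = _ := by ring
    have hlim := (hlog.neg.rexp.const_sub 1).div hκ (by linarith)
    rw [show -(ℓ * (-2 * m)) = 2 * m * ℓ by ring] at hlim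
    refine hlim.congr' ?_
    filter_upwards [self_mem_nhdsWithin] with γ hγ
    have hγ0 : 0 < γ := hγ
    have hk : 0 < kappa m L γ := by
      unfold kappa
      have : 0 ≤ L ^ 2 * γ := by positivity
      linarith
    have hp : 0 < 1 + γ * kappa m L γ := by positivity
    simp only [Pi.div_apply]
    rw [div_eq_iff hk.ne', mul_comm (Xi _ _ _), mul_Xi hγ0 hk.le, Real.exp_neg, Real.exp_nat_mul,
      Real.exp_log hp]

/-- `PsiOneSided` converges uniformly on bounded sets of distances. -/
theorem eventually_abs_PsiOneSided_sub_le {m : ℝ} (hm : m ≤ 0) (L : ℝ) {ℓ : ℕ} (hℓ : 1 ≤ ℓ)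
    {R₁ η : ℝ} (hη : 0 < η) : ∀ᶠ γ in 𝓝[>] (0 : ℝ), ∀ t ∈ Icc 0 R₁,
      |PsiOneSided m L γ ℓ t - PsiOneSidedZero m ℓ t| ≤ η := by
  have h1 := ((tendsto_Xi hm L ℓ).sqrt.inv₀ (Real.sqrt_pos.2 (XiZero_pos hm hℓ)).ne').sub_const
    (√(XiZero m ℓ))⁻¹
  rw [sub_self] at h1
  have h2 := (h1.abs).const_mul R₁
  rw [abs_zero, mul_zero] at h2
  filter_upwards [h2.eventually (gt_mem_nhds hη)] with γ hγ t ht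
  unfold PsiOneSided PsiOneSidedZero
  set a := √(Xi (kappa m L) γ (ℓ * ⌈1 / γ⌉₊))
  set b := √(XiZero m ℓ)
  rw [← mul_sub, abs_mul, abs_two]
  calc 2 * |Φ (-t / (2 * a)) - Φ (-t / (2 * b))| ≤ 2 * |-t / (2 * a) - -t / (2 * b)| := by
        exact mul_le_mul_of_nonneg_left (abs_Φ_sub_le _ _) zero_le_two
    _ = t * |a⁻¹ - b⁻¹| := by
        rw [show -t / (2 * a) - -t / (2 * b) = -(t / 2 * (a⁻¹ - b⁻¹)) by
          simp only [div_eq_mul_inv, mul_inv]; ring, abs_neg, abs_mul,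
          abs_of_nonneg (by linarith [ht.1] : 0 ≤ t / 2)]
        ring
    _ ≤ R₁ * |a⁻¹ - b⁻¹| := by gcongr; exact ht.2
    _ ≤ η := hγ.le

theorem PsiOneSided_mem (m L γ : ℝ) (ℓ : ℕ) {t : ℝ} (ht : 0 ≤ t) :
    PsiOneSided m L γ ℓ t ∈ Icc (0 : ℝ) 1 :=
  ⟨mul_nonneg zero_le_two (Φ_nonneg _), two_mul_Φ_le_one (by
    rw [neg_div]; exact neg_nonpos.2 (by positivity))⟩

theorem PsiOneSidedZero_mem (m : ℝ) (ℓ : ℕ) {t : ℝ} (ht : 0 ≤ t) :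
    PsiOneSidedZero m ℓ t ∈ Icc (0 : ℝ) 1 :=
  ⟨mul_nonneg zero_le_two (Φ_nonneg _), two_mul_Φ_le_one (by
    rw [neg_div]; exact neg_nonpos.2 (by positivity))⟩

/-- A lower bound for `PsiOneSided`, uniform in the step size and on bounded sets of distances. -/
theorem exists_le_PsiOneSided {m L gbar : ℝ} (hm : m ≤ 0) {ℓ : ℕ} (hℓ : 1 ≤ ℓ) (M : ℝ) :
    ∃ δ > 0, ∀ γ ∈ Ioc 0 gbar, ∀ t ∈ Icc 0 M, δ ≤ PsiOneSided m L γ ℓ t := by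
  obtain ⟨ξ, hξ, h⟩ := exists_le_Xi (L := L) (gbar := gbar) hm hℓ
  refine ⟨2 * Φ (-M / (2 * √ξ)), mul_pos two_pos (Φ_pos _), fun γ hγ t ht => ?_⟩
  unfold PsiOneSided
  gcongr
  exact Φ_neg_div_le hξ (h γ hγ) ht.1 ht.2

theorem PsiOneSided_lt_one {m L γ : ℝ} (hm : m ≤ 0) (hγ : 0 < γ) {ℓ : ℕ} (hℓ : 1 ≤ ℓ) {t : ℝ}
    (ht : 0 < t) : PsiOneSided m L γ ℓ t < 1 := by
  obtain ⟨ξ, hξ, h⟩ := exists_le_Xi (L := L) (gbar := γ) hm hℓ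
  have := Real.sqrt_pos.2 (hξ.trans_le (h γ ⟨hγ, le_rfl⟩))
  refine two_mul_Φ_lt_one ?_
  rw [neg_div]; exact neg_neg_of_pos (by positivity)

theorem PsiOneSidedZero_lt_one {m : ℝ} (hm : m ≤ 0) {ℓ : ℕ} (hℓ : 1 ≤ ℓ) {t : ℝ}
    (ht : 0 < t) : PsiOneSidedZero m ℓ t < 1 := by
  have := Real.sqrt_pos.2 (XiZero_pos hm hℓ)
  refine two_mul_Φ_lt_one ?_
  rw [neg_div]; exact neg_neg_of_pos (by positivity)

theorem PsiOneSidedZero_anti {m : ℝ} (hm : m ≤ 0) {ℓ : ℕ} (hℓ : 1 ≤ ℓ) {t M : ℝ}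
    (ht : t ∈ Icc 0 M) : PsiOneSidedZero m ℓ M ≤ PsiOneSidedZero m ℓ t := by
  unfold PsiOneSidedZero
  gcongr
  exact Φ_neg_div_le (XiZero_pos hm hℓ) le_rfl ht.1 ht.2

namespace Scheme

variable {d : ℕ} (S : Scheme d) {L R₁ m₁ m mb A : ℝ}

/-- By convexity, a set with two points has distinct points at distance at most `R₁`; this makes
`ε < 1`. -/
theorem exists_closePairs_pos (hR : 0 < R₁) (hX : S.X.Nontrivial) :
    ∃ q ∈ closePairs S.X R₁, 0 < ‖(q.1 : E d) - q.2‖ := by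
  obtain ⟨x, hx, y, hy, hxy⟩ := hX
  have hr : 0 < ‖y - x‖ := norm_pos_iff.2 (sub_ne_zero.2 hxy.symm)
  set s := min 1 (R₁ / ‖y - x‖) with hs
  have hs0 : 0 < s := lt_min one_pos (by positivity)
  have hz : x + s • (y - x) ∈ S.X :=
    S.convex.add_smul_sub_mem hx hy ⟨hs0.le, min_le_left _ _⟩
  refine ⟨(⟨x + s • (y - x), hz⟩, ⟨x, hx⟩), ?_, ?_⟩
  · simp only [closePairs, mem_ofPred_eq, add_sub_cancel_left, norm_smul,
      Real.norm_of_nonneg hs0.le]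
    calc s * ‖y - x‖ ≤ R₁ / ‖y - x‖ * ‖y - x‖ := by gcongr; exact min_le_right _ _
      _ = R₁ := by field_simp
  · simp only [add_sub_cancel_left, norm_smul, Real.norm_of_nonneg hs0.le]
    positivity

theorem le_epsBar {Ψ : ℝ → ℕ → ℝ → ℝ} {gbar c : ℝ} {ℓ : ℕ} (hR : 0 < R₁) (hg : 0 < gbar)
    (h : ∀ γ ∈ Ioc 0 gbar, ∀ t ∈ Icc 0 R₁, c ≤ Ψ γ ℓ t) : c ≤ epsBar S.X Ψ gbar R₁ ℓ := by
  obtain ⟨x, hx⟩ := S.exists_diag_mem_closePairs hR.le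
  refine le_csInf ⟨_, gbar, ⟨hg, le_rfl⟩, _, hx, rfl⟩ ?_
  rintro _ ⟨γ, hγ, q, hq, rfl⟩
  exact h γ hγ _ ⟨norm_nonneg _, hq⟩

theorem le_epsInf {ψ : ℝ → ℝ} {c : ℝ} (hR : 0 < R₁) (h : ∀ t ∈ Icc 0 R₁, c ≤ ψ t) :
    c ≤ epsInf S.X ψ R₁ := by
  obtain ⟨x, hx⟩ := S.exists_diag_mem_closePairs hR.le
  refine le_csInf ⟨_, _, hx, rfl⟩ ?_
  rintro _ ⟨q, hq, rfl⟩
  exact h _ ⟨norm_nonneg _, hq⟩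

theorem epsInf_le {ψ : ℝ → ℝ} (h : ∀ t ∈ Icc 0 R₁, 0 ≤ ψ t) {q : S.X × S.X}
    (hq : q ∈ closePairs S.X R₁) : epsInf S.X ψ R₁ ≤ ψ ‖(q.1 : E d) - q.2‖ := by
  refine csInf_le ⟨0, ?_⟩ ⟨q, hq, rfl⟩
  rintro _ ⟨q', hq', rfl⟩
  exact h _ ⟨norm_nonneg _, hq'⟩

theorem epsInf_mem {ψ : ℝ → ℝ} (hR : 0 < R₁) {c : ℝ} (hc : 0 < c)
    (h : ∀ t ∈ Icc 0 R₁, ψ t ∈ Icc c 1) : epsInf S.X ψ R₁ ∈ Ioc (0 : ℝ) 1 := by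
  obtain ⟨x, hx⟩ := S.exists_diag_mem_closePairs hR.le
  exact ⟨hc.trans_le (S.le_epsInf hR fun t ht => (h t ht).1),
    (S.epsInf_le (fun t ht => hc.le.trans (h t ht).1) hx).trans (h _ ⟨norm_nonneg _, hx⟩).2⟩

theorem epsInf_lt_one {ψ : ℝ → ℝ} (hR : 0 < R₁) (h0 : ∀ t ∈ Icc 0 R₁, 0 ≤ ψ t)
    (h : ∀ t ∈ Ioc 0 R₁, ψ t < 1) (hX : S.X.Nontrivial) : epsInf S.X ψ R₁ < 1 := by
  obtain ⟨q, hq, hq0⟩ := S.exists_closePairs_pos hR hX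
  exact (S.epsInf_le h0 hq).trans_lt (h _ ⟨hq0, hq⟩)

/-- Infima are continuous for uniform convergence. -/
theorem abs_epsBar_sub_epsInf_le {Ψ : ℝ → ℕ → ℝ → ℝ} {ψ : ℝ → ℝ} {ℓ : ℕ} {gbar η : ℝ}
    (hR : 0 < R₁) (hg : 0 < gbar) (hΨ : ∀ γ ∈ Ioc 0 gbar, ∀ t : ℝ, 0 ≤ t → 0 ≤ Ψ γ ℓ t)
    (hψ : ∀ t ∈ Icc 0 R₁, 0 ≤ ψ t)
    (h : ∀ γ ∈ Ioc 0 gbar, ∀ t ∈ Icc 0 R₁, |Ψ γ ℓ t - ψ t| ≤ η) :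
    |epsBar S.X Ψ gbar R₁ ℓ - epsInf S.X ψ R₁| ≤ η := by
  obtain ⟨x, hx⟩ := S.exists_diag_mem_closePairs hR.le
  rw [abs_le]
  constructor
  · rw [neg_le_sub_iff_le_add, ← sub_le_iff_le_add]
    refine le_csInf ⟨_, gbar, ⟨hg, le_rfl⟩, _, hx, rfl⟩ ?_
    rintro _ ⟨γ, hγ, q, hq, rfl⟩
    have h1 := (abs_le.1 (h γ hγ _ ⟨norm_nonneg _, hq⟩)).1
    have h2 := S.epsInf_le hψ hq
    linarith
  · rw [sub_le_iff_le_add, ← sub_le_iff_le_add']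
    refine le_csInf ⟨_, _, hx, rfl⟩ ?_
    rintro _ ⟨q, hq, rfl⟩
    have h1 := (abs_le.1 (h gbar ⟨hg, le_rfl⟩ _ ⟨norm_nonneg _, hq⟩)).2
    have h2 := S.epsBar_le hΨ ⟨hg, le_rfl⟩ hq
    linarith

theorem epsBar_eq_of_subsingleton {Ψ : ℝ → ℕ → ℝ → ℝ} {gbar c : ℝ} {ℓ : ℕ} (hR : 0 < R₁)
    (hg : 0 < gbar) (hX : ¬ S.X.Nontrivial) (h : ∀ γ > 0, Ψ γ ℓ 0 = c) :
    epsBar S.X Ψ gbar R₁ ℓ = c := by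
  obtain ⟨x, hx⟩ := S.exists_diag_mem_closePairs hR.le
  have h0 : ∀ q : S.X × S.X, ‖(q.1 : E d) - q.2‖ = 0 := fun q => by
    rw [not_nontrivial_iff.1 hX q.1.2 q.2.2, sub_self, norm_zero]
  have : {r | ∃ γ ∈ Ioc 0 gbar, ∃ q ∈ closePairs S.X R₁, r = Ψ γ ℓ ‖(q.1 : E d) - (q.2 : E d)‖} =
      {c} := by
    ext r
    simp only [mem_ofPred_eq, h0, mem_singleton_iff]
    constructor
    · rintro ⟨γ, hγ, -, -, rfl⟩; exact h γ hγ.1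
    · rintro rfl; exact ⟨gbar, ⟨hg, le_rfl⟩, _, hx, (h gbar hg).symm⟩
  rw [epsBar, this, csInf_singleton]

theorem epsInf_eq_of_subsingleton {ψ : ℝ → ℝ} (hR : 0 < R₁) (hX : ¬ S.X.Nontrivial) :
    epsInf S.X ψ R₁ = ψ 0 := by
  obtain ⟨x, hx⟩ := S.exists_diag_mem_closePairs hR.le
  have h0 : ∀ q : S.X × S.X, ‖(q.1 : E d) - q.2‖ = 0 := fun q => by
    rw [not_nontrivial_iff.1 hX q.1.2 q.2.2, sub_self, norm_zero]
  have : {r | ∃ q ∈ closePairs S.X R₁, r = ψ ‖(q.1 : E d) - (q.2 : E d)‖} = {ψ 0} := by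
    ext r
    simp only [mem_ofPred_eq, h0, mem_singleton_iff]
    exact ⟨fun ⟨_, _, h⟩ => h, fun h => ⟨_, hx, h⟩⟩
  rw [epsInf, this, csInf_singleton]

theorem tendsto_lamBar (m₁ L : ℝ) :
    Tendsto (fun g => lamBar m₁ L g) (𝓝[>] 0) (𝓝 (Real.exp (-m₁ / 2))) := by
  have : Tendsto (fun g => lamBar m₁ L g) (𝓝 0) (𝓝 (lamBar m₁ L 0)) :=
    Continuous.tendsto (by unfold lamBar; fun_prop) 0
  rw [show lamBar m₁ L 0 = Real.exp (-m₁ / 2) by simp [lamBar]] at this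
  exact this.mono_left nhdsWithin_le_nhds

/-- Convergence of the constants as the step sizes tend to `0`, given a minorization function `Ψ`
converging uniformly on bounded sets of distances. A one-point set needs a separate argument, since
`ε = 1` and hence `ρ = 1` may occur there. -/
theorem hasLimits_of_tendsto (hR : 0 < R₁) (hm₁ : 0 < m₁) (hA : 0 < A) {Ψ : ℝ → ℕ → ℝ → ℝ}
    {ψ : ℕ → ℝ → ℝ} {ℓ : ℕ} (hℓ : 1 ≤ ℓ) (hΨ : ∀ γ > 0, ∀ t : ℝ, 0 ≤ t → 0 ≤ Ψ γ ℓ t)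
    {c : ℝ} (hc : 0 < c) (hψ : ∀ t ∈ Icc 0 R₁, ψ ℓ t ∈ Icc c 1)
    (hψ1 : ∀ t ∈ Ioc 0 R₁, ψ ℓ t < 1) (h0 : ∀ γ > 0, Ψ γ ℓ 0 = ψ ℓ 0)
    (hlim : ∀ η > 0, ∀ᶠ γ in 𝓝[>] (0 : ℝ), ∀ t ∈ Icc 0 R₁, |Ψ γ ℓ t - ψ ℓ t| ≤ η) :
    S.HasLimits L R₁ m₁ A Ψ ψ ℓ := by
  have hψ0 : ∀ t ∈ Icc 0 R₁, 0 ≤ ψ ℓ t := fun t ht => hc.le.trans (hψ t ht).1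
  have hid : Tendsto (fun g : ℝ => g) (𝓝[>] 0) (𝓝 0) := nhdsWithin_le_nhds
  have hl := tendsto_lamBar m₁ L
  set lam₀ := Real.exp (-m₁ / 2) with hlam₀
  have hlam : lam₀ ∈ Ioo (0 : ℝ) 1 := ⟨Real.exp_pos _, Real.exp_lt_one_iff.2 (by linarith)⟩
  have hB := (S.B_mem hR).1
  have he0 := S.epsInf_mem hR hc hψ
  have he1 := S.epsInf_lt_one hR hψ0 hψ1
  have heps : Tendsto (fun g => epsBar S.X Ψ g R₁ ℓ) (𝓝[>] 0) (𝓝 (epsInf S.X (ψ ℓ) R₁)) := by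
    rw [Metric.tendsto_nhds]
    intro η hη
    obtain ⟨g₀, hg₀, hsub⟩ := mem_nhdsGT_iff_exists_Ioo_subset.1 (hlim (η / 2) (by positivity))
    filter_upwards [Ioo_mem_nhdsGT hg₀] with g hg
    rw [Real.dist_eq]
    refine (S.abs_epsBar_sub_epsInf_le hR hg.1 (fun γ hγ => hΨ γ hγ.1) hψ0 fun γ hγ =>
      hsub ⟨hγ.1, hγ.2.trans_lt hg.2⟩).trans_lt (by linarith)
  have hD1 : Tendsto (fun g => D₁ (lamBar m₁ L g) A g) (𝓝[>] 0) (𝓝 (D₁ lam₀ A 0)) := by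
    unfold D₁
    have h1 : Tendsto (fun g => Real.log (1 / lamBar m₁ L g)) (𝓝[>] 0) (𝓝 (Real.log (1 / lam₀))) :=
      (tendsto_const_nhds.div hl hlam.1.ne').log (one_div_pos.2 hlam.1).ne'
    exact (((h1.inv₀ (Real.log_pos (one_lt_one_div hlam.1 hlam.2)).ne').const_mul _).div
      (hl.rpow hid (Or.inl hlam.1.ne')) (Real.rpow_pos_of_pos hlam.1 _).ne').const_add 1
  have hbi : Tendsto (fun g => burnIn (lamBar m₁ L g) A g ℓ) (𝓝[>] 0) (𝓝 (burnIn lam₀ A 0 ℓ)) := by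
    unfold burnIn
    have h1 : Tendsto (fun g : ℝ => 1 + g) (𝓝[>] 0) (𝓝 (1 + 0)) := hid.const_add 1
    exact (((hl.rpow (h1.neg.mul_const _) (Or.inl hlam.1.ne')).const_mul A).mul h1).mul_const _
  have hrho : Tendsto (fun g => S.rhoBar L R₁ m₁ A Ψ ℓ g) (𝓝[>] 0)
      (𝓝 (S.rhoZero R₁ m₁ A ψ ℓ)) ∧ Tendsto (fun g => C₁ A g (S.rhoBar L R₁ m₁ A Ψ ℓ g)) (𝓝[>] 0)
      (𝓝 (C₁ A 0 (S.rhoZero R₁ m₁ A ψ ℓ))) := by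
    rcases he0.2.eq_or_lt with h | h
    · have hX : ¬ S.X.Nontrivial := fun hX => (he1 hX).ne h
      -- `log 0 = 0` yields `ρ = 1` for `ε = 1`, and then `C₁ = 0` as `(log 1)⁻¹ = 0`
      have hone : ∀ {lam g : ℝ}, rho lam A g ℓ (S.B R₁) 1 = 1 := by
        intro lam g; simp [rho]
      have hzero : S.rhoZero R₁ m₁ A ψ ℓ = 1 := by rw [rhoZero, h, hone]
      have hbar : ∀ g > 0, S.rhoBar L R₁ m₁ A Ψ ℓ g = 1 := by
        intro g hg
        rw [rhoBar, S.epsBar_eq_of_subsingleton hR hg hX h0,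
          ← S.epsInf_eq_of_subsingleton (ψ := ψ ℓ) hR hX, h, hone]
      constructor
      · rw [hzero]
        refine tendsto_const_nhds.congr' ?_
        filter_upwards [self_mem_nhdsWithin] with g hg using (hbar g hg).symm
      · rw [hzero, show C₁ A 0 1 = 0 by simp [C₁]]
        refine tendsto_const_nhds.congr' ?_
        filter_upwards [self_mem_nhdsWithin] with g hg
        rw [hbar g hg]; simp [C₁]
    · have hbi0 := burnIn_pos (ℓ := ℓ) hlam.1 hA le_rfl hℓ
      have hρ := rho_mem (ℓ := ℓ) hlam hA le_rfl hℓ hB ⟨he0.1, h⟩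
      have h1 : Tendsto (fun g => Real.log (1 - epsBar S.X Ψ g R₁ ℓ)) (𝓝[>] 0)
          (𝓝 (Real.log (1 - epsInf S.X (ψ ℓ) R₁))) := (heps.const_sub 1).log (by linarith)
      have h2 : Tendsto (fun g => Real.log (S.B R₁ + burnIn (lamBar m₁ L g) A g ℓ)) (𝓝[>] 0)
          (𝓝 (Real.log (S.B R₁ + burnIn lam₀ A 0 ℓ))) := (hbi.const_add _).log (by linarith)
      have h3 : Real.log (1 - epsInf S.X (ψ ℓ) R₁) < 0 :=
        Real.log_neg (by linarith) (by linarith [he0.1])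
      have h4 : 0 < Real.log (S.B R₁ + burnIn lam₀ A 0 ℓ) := Real.log_pos (by linarith)
      have hlimρ : Tendsto (fun g => S.rhoBar L R₁ m₁ A Ψ ℓ g) (𝓝[>] 0)
          (𝓝 (S.rhoZero R₁ m₁ A ψ ℓ)) := by
        unfold rhoBar rhoZero rho
        exact (((hl.log hlam.1.ne').mul h1).div (h2.neg.add h1) (by linarith)).rexp
      refine ⟨hlimρ, ?_⟩
      have hρ0 : 0 < S.rhoZero R₁ m₁ A ψ ℓ := hlam.1.trans_le hρ.1
      unfold C₁
      exact ((((tendsto_const_nhds.div hlimρ hρ0.ne').log (one_div_pos.2 hρ0).ne').inv₀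
        (Real.log_pos (one_lt_one_div hρ0 hρ.2)).ne').const_mul _).div
        (hlimρ.rpow hid (Or.inl hρ0.ne')) (Real.rpow_pos_of_pos hρ0 _).ne'
  exact ⟨hl, hD1, hD1.mul hbi, hrho.1, hrho.2, fun hX =>
    rho_mem hlam hA le_rfl hℓ hB ⟨he0.1, he1 hX⟩⟩

end Scheme

/-! ### The two cases and the explicit rates -/

/-- The limit variance is monotone in `ℓ`, so that `⌈R₁²⌉` may be replaced by `R₁²`. -/
theorem Φ_le_of_neg {m R₁ : ℝ} (hm : m < 0) (hR : 0 < R₁) :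
    Φ (-(√(-m) * R₁ / √(2 - 2 * Real.exp (2 * m * R₁ ^ 2)))) ≤
      Φ (-R₁ / (2 * √(XiZero m ⌈R₁ ^ 2⌉₊))) := by
  have hq1 : Real.exp (2 * m * R₁ ^ 2) < 1 :=
    Real.exp_lt_one_iff.2 (by nlinarith [pow_pos hR 2])
  have hqℓ : Real.exp (2 * m * ⌈R₁ ^ 2⌉₊) ≤ Real.exp (2 * m * R₁ ^ 2) := by
    refine Real.exp_le_exp.2 (mul_le_mul_of_nonpos_left (Nat.le_ceil _) (by linarith))
  set q := Real.exp (2 * m * R₁ ^ 2)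
  have hX : (1 - q) / (-2 * m) ≤ XiZero m ⌈R₁ ^ 2⌉₊ := by
    rw [XiZero, if_neg hm.ne]
    exact div_le_div_of_nonneg_right (by linarith) (by linarith)
  have h0 : 0 < (1 - q) / (-2 * m) := div_pos (by linarith) (by linarith)
  have hm' : 0 < √(-m) := Real.sqrt_pos.2 (by linarith)
  have hq' : 0 < √(2 - 2 * q) := Real.sqrt_pos.2 (by linarith)
  have h1 : √(2 - 2 * q) / √(-m) ≤ 2 * √(XiZero m ⌈R₁ ^ 2⌉₊) := by
    rw [← Real.sqrt_div (by linarith)]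
    calc √((2 - 2 * q) / -m) = √(2 ^ 2 * ((1 - q) / (-2 * m))) := by
          congr 1
          have : -m ≠ 0 := by linarith
          field_simp
      _ = 2 * √((1 - q) / (-2 * m)) := by
          rw [Real.sqrt_mul (by norm_num), Real.sqrt_sq (by norm_num)]
      _ ≤ _ := by gcongr
  apply Φ_mono
  rw [neg_div, neg_le_neg_iff]
  calc R₁ / (2 * √(XiZero m ⌈R₁ ^ 2⌉₊)) ≤ R₁ / (√(2 - 2 * q) / √(-m)) := by gcongr
    _ = _ := by field_simp

theorem Φ_neg_half_le {R₁ s : ℝ} (hR : 0 < R₁) (hs : R₁ ^ 2 ≤ s) {t : ℝ}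
    (ht : t ≤ R₁) : Φ (-1 / 2) ≤ Φ (-t / (2 * √s)) := by
  have h1 : R₁ ≤ √s := Real.le_sqrt_of_sq_le hs
  apply Φ_mono
  rw [neg_div, neg_div, neg_le_neg_iff, div_le_div_iff₀ (by linarith) two_pos]
  linarith

theorem PsiCoCoercive_mem (N : ℕ) (R₁ L γ : ℝ) (ℓ : ℕ) {t : ℝ} (ht : 0 ≤ t) :
    PsiCoCoercive N R₁ L γ ℓ t ∈ Icc (0 : ℝ) 1 := by
  unfold PsiCoCoercive
  split_ifs
  · exact ⟨mul_nonneg zero_le_two (Φ_nonneg _), two_mul_Φ_le_one (by norm_num)⟩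
  · exact PsiOneSided_mem 0 L γ ℓ ht

theorem exists_le_PsiCoCoercive (N : ℕ) (R₁ L gbar : ℝ) {ℓ : ℕ} (hℓ : 1 ≤ ℓ)
    (M : ℝ) : ∃ δ > 0, ∀ γ ∈ Ioc 0 gbar, ∀ t ∈ Icc 0 M, δ ≤ PsiCoCoercive N R₁ L γ ℓ t := by
  obtain ⟨δ, hδ, h⟩ := exists_le_PsiOneSided (m := 0) (L := L) (gbar := gbar) le_rfl hℓ M
  refine ⟨min (2 * Φ (-1 / 2)) δ, lt_min (mul_pos two_pos (Φ_pos _)) hδ, fun γ hγ t ht => ?_⟩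
  unfold PsiCoCoercive
  split_ifs
  · exact min_le_left _ _
  · exact (min_le_right _ _).trans (h γ hγ t ht)

/-- The bound for the inverse rate with `ℓ = ⌈R₁²⌉` and `λ = exp(-M / 2)`. -/
theorem inv_log_rho_inv_le_explicit {M A g B ε φ R₁ : ℝ} (hM : 0 < M) (hA : 0 < A)
    (hg : g ∈ Icc (0 : ℝ) 1) (hB : B ∈ Icc (1 : ℝ) 2) (hR : 0 < R₁) (hφ : 0 < φ)
    (hφε : 2 * φ ≤ ε) (hε : ε ≤ 1) :
    (Real.log (rho (Real.exp (-M / 2)) A g ⌈R₁ ^ 2⌉₊ B ε)⁻¹)⁻¹ ≤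
      (1 + Real.log 2 + Real.log (1 + 2 * (1 + R₁ ^ 2) * A) + 2 * (1 + R₁ ^ 2) * M) / (M * φ) := by
  have hlam : Real.exp (-M / 2) ∈ Ioo (0 : ℝ) 1 :=
    ⟨Real.exp_pos _, Real.exp_lt_one_iff.2 (by linarith)⟩
  have hw : Real.log (Real.exp (-M / 2))⁻¹ = M / 2 := by rw [Real.log_inv, Real.log_exp]; ring
  have hℓ : 1 ≤ ⌈R₁ ^ 2⌉₊ := Nat.one_le_ceil_iff.2 (by positivity)
  have hℓR : (⌈R₁ ^ 2⌉₊ : ℝ) ≤ 1 + R₁ ^ 2 := by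
    linarith [(Nat.ceil_lt_add_one (sq_nonneg R₁)).le]
  have hB1 := hB.1
  have hlogB : 0 ≤ Real.log B := Real.log_nonneg hB1
  have hlogA : 0 ≤ Real.log (1 + 2 * A * ⌈R₁ ^ 2⌉₊) :=
    Real.log_nonneg (le_add_of_nonneg_right (by positivity))
  refine (inv_log_rho_inv_le (ℓ := ⌈R₁ ^ 2⌉₊) hlam hA hg hℓ hB1 ⟨by linarith, hε⟩).trans ?_
  rw [hw]
  have h1 : Real.log B ≤ Real.log 2 := Real.log_le_log (by linarith) hB.2
  have h2 : Real.log (1 + 2 * A * ⌈R₁ ^ 2⌉₊) ≤ Real.log (1 + 2 * (1 + R₁ ^ 2) * A) := by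
    refine Real.log_le_log (by positivity) ?_
    have := mul_le_mul_of_nonneg_left hℓR (by positivity : 0 ≤ 2 * A)
    linarith
  have h3 : 2 * (⌈R₁ ^ 2⌉₊ : ℝ) * (M / 2) ≤ 2 * (1 + R₁ ^ 2) * M := by
    have := mul_le_mul_of_nonneg_right hℓR hM.le
    have : 0 ≤ (1 + R₁ ^ 2) * M := by positivity
    linarith
  have h4 : M * φ ≤ M / 2 * ε := by
    have := mul_le_mul_of_nonneg_left hφε hM.le
    linarith
  have h5 : 0 ≤ 2 * (⌈R₁ ^ 2⌉₊ : ℝ) * (M / 2) := by positivity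
  exact div_le_div₀ (by linarith) (by linarith) (by positivity) h4

namespace Scheme

variable {d : ℕ} (S : Scheme d) {L R₁ m₁ m mb : ℝ}

theorem K_pow_offDiag_le_Φ {κ : ℝ → ℝ} {γ : ℝ} (hγ : 0 < γ) (hκ : 0 ≤ κ γ)
    (hT : ∀ x y : S.X, ‖S.gap γ x y‖ ^ 2 ≤ (1 + γ * κ γ) * ‖(x : E d) - y‖ ^ 2)
    {n : ℕ} (hn : 1 ≤ n) (x y : S.X) : (S.K γ ^ n) (x, y) (offDiag S.X) ≤
      ENNReal.ofReal (1 - 2 * Φ (-‖(x : E d) - y‖ / (2 * √(Xi κ γ n)))) := by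
  have hn0 : (0 : ℝ) < n := by exact_mod_cast hn
  have hX : 0 < Xi κ γ n := lt_of_lt_of_le (by positivity) (le_Xi hγ hκ n)
  have h := S.K_pow_offDiag_le hγ hκ hT n x y
  rwa [signMean_eq (by simpa using hX), Real.coe_toNNReal _ hX.le] at h

theorem converges_of_oneSided (hLip : S.LipschitzDrift L) (hDis : S.DissipativeAtInfinity R₁ m₁)
    (hm : m ≤ 0) (hone : S.OneSided m) {gbar : ℝ} (hg0 : 0 < gbar) (hg : gbar * L ^ 2 < 2 * m₁) :
    S.Converges L R₁ m₁ (m₁ - m) (PsiOneSided m L) gbar := by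
  have hR := hDis.1
  refine S.converges_of_minorization hLip hDis (by linarith) hg0 hg ?_
    (fun γ _ ℓ _ t ht => PsiOneSided_mem m L γ ℓ ht) ?_ ?_ ?_ ?_
  · intro γ hγ x y
    rw [sub_sub_cancel_left]
    exact S.norm_gap_le hLip hγ.1 x.2 y.2 (hone x x.2 y y.2)
  · intro γ hγ ℓ hℓ x y
    exact S.K_pow_offDiag_le_Φ hγ.1 (kappa_nonneg hm hγ.1.le)
      (fun x y => S.norm_gap_sq_le hLip hγ.1 x.2 y.2 (hone x x.2 y y.2))
      (Nat.mul_pos hℓ (one_le_ceil_one_div hγ.1)) x y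
  · intro γ hγ ℓ hℓ M _
    obtain ⟨δ, hδ, h⟩ := exists_le_PsiOneSided (L := L) (gbar := gbar) hm hℓ M
    exact ⟨δ, hδ, fun q hq => h γ hγ _ ⟨norm_nonneg _, hq⟩⟩
  · intro ℓ hℓ
    obtain ⟨δ, hδ, h⟩ := exists_le_PsiOneSided (L := L) (gbar := gbar) hm hℓ R₁
    exact hδ.trans_le (S.le_epsBar hR hg0 h)
  · intro ℓ hℓ hX
    obtain ⟨q, hq, hq0⟩ := S.exists_closePairs_pos hR hX
    exact (S.epsBar_le (fun γ _ t ht => (PsiOneSided_mem m L γ ℓ ht).1) ⟨hg0, le_rfl⟩ hq).trans_lt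
      (PsiOneSided_lt_one hm hg0 hℓ hq0)

theorem hasLimits_of_oneSided (hR : 0 < R₁) (hm₁ : 0 < m₁) (hm : m ≤ 0) {ℓ : ℕ} (hℓ : 1 ≤ ℓ) :
    S.HasLimits L R₁ m₁ (m₁ - m) (PsiOneSided m L) (PsiOneSidedZero m) ℓ :=
  S.hasLimits_of_tendsto hR hm₁ (by linarith) hℓ
    (fun γ _ t ht => (PsiOneSided_mem m L γ ℓ ht).1)
    (c := PsiOneSidedZero m ℓ R₁) (mul_pos two_pos (Φ_pos _))
    (fun t ht => ⟨PsiOneSidedZero_anti hm hℓ ht, (PsiOneSidedZero_mem m ℓ ht.1).2⟩)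
    (fun t ht => PsiOneSidedZero_lt_one hm hℓ ht.1)
    (fun γ _ => by simp [PsiOneSided, PsiOneSidedZero])
    (fun η hη => eventually_abs_PsiOneSided_sub_le hm L hℓ hη)

theorem inv_log_rhoBar_oneSided_le (hm₁ : 0 < m₁) (hm : m ≤ 0) (hR : 1 < R₁) {gbar : ℝ}
    (hg0 : 0 < gbar) (hg1 : gbar ≤ 1) (hg : gbar * L ^ 2 < 2 * m₁) :
    (Real.log (S.rhoBar L R₁ m₁ (m₁ - m) (PsiOneSided m L) ⌈R₁ ^ 2⌉₊ gbar)⁻¹)⁻¹ ≤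
      (1 + Real.log 2 + Real.log (1 + 2 * (1 + R₁ ^ 2) * (m₁ - m)) +
          2 * (1 + R₁ ^ 2) * (m₁ - gbar * L ^ 2 / 2)) /
        ((m₁ - gbar * L ^ 2 / 2) * Φ (-(R₁ / (2 * √(Xi (kappa m L) gbar ⌈1 / gbar⌉₊))))) := by
  have hR0 : 0 < R₁ := by linarith
  have hℓ : 2 ≤ ⌈R₁ ^ 2⌉₊ := by
    have : 1 < ⌈R₁ ^ 2⌉₊ := Nat.lt_ceil.2 (by push_cast; nlinarith)
    omega
  have hΨ := fun γ (_ : γ ∈ Ioc 0 gbar) t ht => (PsiOneSided_mem m L γ ⌈R₁ ^ 2⌉₊ (t := t) ht).1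
  obtain ⟨x, hx⟩ := S.exists_diag_mem_closePairs hR0.le
  refine inv_log_rho_inv_le_explicit (by linarith) (by linarith) ⟨hg0.le, hg1⟩ (S.B_mem hR0) hR0
    (Φ_pos _) (S.le_epsBar hR0 hg0 fun γ hγ t ht => ?_)
    ((S.epsBar_le hΨ ⟨hg0, le_rfl⟩ hx).trans (PsiOneSided_mem m L gbar _ (norm_nonneg _)).2)
  have hN : (0 : ℝ) < ⌈1 / gbar⌉₊ := by exact_mod_cast one_le_ceil_one_div hg0
  have hpos : 0 < Xi (kappa m L) gbar ⌈1 / gbar⌉₊ :=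
    lt_of_lt_of_le (by positivity) (le_Xi hg0 (kappa_nonneg hm hg0.le) _)
  unfold PsiOneSided
  gcongr
  rw [← neg_div]
  exact Φ_neg_div_le hpos (Xi_ceil_le hm hγ hg1 hℓ) ht.1 ht.2

/-- The bound for the limit rate, given a lower bound `2 φ` for the limit minorization at distance
`R₁`. -/
theorem inv_log_rhoZero_oneSided_le (hm₁ : 0 < m₁) (hm : m ≤ 0) (hR : 0 < R₁) {φ : ℝ} (hφ : 0 < φ)
    (h : φ ≤ Φ (-R₁ / (2 * √(XiZero m ⌈R₁ ^ 2⌉₊)))) :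
    (Real.log (S.rhoZero R₁ m₁ (m₁ - m) (PsiOneSidedZero m) ⌈R₁ ^ 2⌉₊)⁻¹)⁻¹ ≤
      (1 + Real.log 2 + Real.log (1 + 2 * (1 + R₁ ^ 2) * (m₁ - m)) + 2 * (1 + R₁ ^ 2) * m₁) /
        (m₁ * φ) := by
  have hℓ : 1 ≤ ⌈R₁ ^ 2⌉₊ := Nat.one_le_ceil_iff.2 (by positivity)
  have hψ := fun t (ht : t ∈ Icc 0 R₁) => PsiOneSidedZero_anti hm hℓ ht
  refine inv_log_rho_inv_le_explicit hm₁ (by linarith) ⟨le_rfl, zero_le_one⟩ (S.B_mem hR) hR hφ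
    (S.le_epsInf hR fun t ht => le_trans ?_ (hψ t ht))
    (S.epsInf_mem hR (c := PsiOneSidedZero m ⌈R₁ ^ 2⌉₊ R₁) (mul_pos two_pos (Φ_pos _))
      fun t ht => ⟨hψ t ht, (PsiOneSidedZero_mem m _ ht.1).2⟩).2
  exact mul_le_mul_of_nonneg_left h zero_le_two

theorem converges_of_coCoercive (hLip : S.LipschitzDrift L)
    (hDis : S.DissipativeAtInfinity R₁ m₁) (hco : S.CoCoercive mb) {N : ℕ} (hN : R₁ ^ 2 ≤ N)
    {gbar : ℝ} (hg0 : 0 < gbar) (hg : gbar * L ^ 2 < 2 * m₁) (hgm : gbar ≤ 2 * mb) :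
    S.Converges L R₁ m₁ m₁ (PsiCoCoercive N R₁ L) gbar := by
  have hR := hDis.1
  have hgap : ∀ γ ∈ Ioc 0 gbar, ∀ x y : S.X, ‖S.gap γ x y‖ ≤ ‖(x : E d) - y‖ :=
    fun γ hγ x y => S.norm_gap_le_of_coCoercive hco hγ.1 (hγ.2.trans hgm) x.2 y.2
  have hgapsq : ∀ γ ∈ Ioc 0 gbar, ∀ κ : ℝ → ℝ, 0 ≤ κ γ → ∀ x y : S.X,
      ‖S.gap γ x y‖ ^ 2 ≤ (1 + γ * κ γ) * ‖(x : E d) - y‖ ^ 2 := by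
    intro γ hγ κ hκ x y
    have h1 := pow_le_pow_left₀ (norm_nonneg _) (hgap γ hγ x y) 2
    have h2 : 0 ≤ γ * κ γ * ‖(x : E d) - y‖ ^ 2 := by have := hγ.1; positivity
    linarith
  refine S.converges_of_minorization hLip hDis le_rfl hg0 hg ?_
    (fun γ _ ℓ _ t ht => PsiCoCoercive_mem N R₁ L γ ℓ ht) ?_ ?_ ?_ ?_
  · intro γ hγ x y
    have h : 0 ≤ γ * (m₁ - m₁ + γ * L ^ 2 / 2) * ‖(x : E d) - y‖ := by
      rw [sub_self, zero_add]; have := hγ.1; positivity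
    linarith [hgap γ hγ x y]
  · intro γ hγ ℓ hℓ x y
    have hn : 1 ≤ ℓ * ⌈1 / γ⌉₊ := Nat.mul_pos hℓ (one_le_ceil_one_div hγ.1)
    unfold PsiCoCoercive
    split_ifs with hc
    · refine (S.K_pow_offDiag_le_Φ (κ := fun _ => 0) hγ.1 le_rfl
        (hgapsq γ hγ (fun _ => 0) le_rfl) hn x y).trans (ENNReal.ofReal_le_ofReal ?_)
      -- for a vanishing `κ` the variance is the elapsed time, which is at least `ℓ ≥ N ≥ R₁²`
      have hXi : R₁ ^ 2 ≤ Xi (fun _ => 0) γ (ℓ * ⌈1 / γ⌉₊) := by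
        have h1 : (N : ℝ) ≤ ℓ := by exact_mod_cast hc.1
        have h2 := le_Xi (κ := fun _ => 0) hγ.1 le_rfl (ℓ * ⌈1 / γ⌉₊)
        simp only [mul_zero, neg_zero, Real.exp_zero, mul_one] at h2
        linarith [le_mul_natMul_ceil hγ.1 ℓ]
      linarith [Φ_neg_half_le hR hXi hc.2]
    · exact S.K_pow_offDiag_le_Φ hγ.1 (kappa_nonneg le_rfl hγ.1.le)
        (hgapsq γ hγ _ (kappa_nonneg le_rfl hγ.1.le)) hn x y
  · intro γ hγ ℓ hℓ M _
    obtain ⟨δ, hδ, h⟩ := exists_le_PsiCoCoercive N R₁ L gbar hℓ M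
    exact ⟨δ, hδ, fun q hq => h γ hγ _ ⟨norm_nonneg _, hq⟩⟩
  · intro ℓ hℓ
    obtain ⟨δ, hδ, h⟩ := exists_le_PsiCoCoercive N R₁ L gbar hℓ R₁
    exact hδ.trans_le (S.le_epsBar hR hg0 h)
  · intro ℓ hℓ hX
    obtain ⟨q, hq, hq0⟩ := S.exists_closePairs_pos hR hX
    refine (S.epsBar_le (fun γ _ t ht => (PsiCoCoercive_mem N R₁ L γ ℓ ht).1)
      ⟨hg0, le_rfl⟩ hq).trans_lt ?_
    unfold PsiCoCoercive
    split_ifs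
    · exact two_mul_Φ_lt_one (by norm_num)
    · exact PsiOneSided_lt_one le_rfl hg0 hℓ hq0

theorem hasLimits_of_coCoercive (hR : 0 < R₁) (hm₁ : 0 < m₁) (N : ℕ) {ℓ : ℕ} (hℓ : 1 ≤ ℓ) :
    S.HasLimits L R₁ m₁ m₁ (PsiCoCoercive N R₁ L) (PsiCoCoerciveZero N R₁) ℓ := by
  have hhalf : 2 * Φ (-1 / 2) < 1 := two_mul_Φ_lt_one (by norm_num)
  refine S.hasLimits_of_tendsto hR hm₁ hm₁ hℓ
    (fun γ _ t ht => (PsiCoCoercive_mem N R₁ L γ ℓ ht).1)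
    (c := min (2 * Φ (-1 / 2)) (PsiOneSidedZero 0 ℓ R₁))
    (lt_min (mul_pos two_pos (Φ_pos _)) (mul_pos two_pos (Φ_pos _))) ?_ ?_ ?_ ?_
  · intro t ht
    unfold PsiCoCoerciveZero
    split_ifs
    · exact ⟨min_le_left _ _, hhalf.le⟩
    · exact ⟨(min_le_right _ _).trans (PsiOneSidedZero_anti le_rfl hℓ ht),
        (PsiOneSidedZero_mem 0 ℓ ht.1).2⟩
  · intro t ht
    unfold PsiCoCoerciveZero
    split_ifs
    · exact hhalf
    · exact PsiOneSidedZero_lt_one le_rfl hℓ ht.1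
  · intro γ _
    simp [PsiCoCoercive, PsiCoCoerciveZero, PsiOneSided, PsiOneSidedZero]
  · intro η hη
    filter_upwards [eventually_abs_PsiOneSided_sub_le (R₁ := R₁) le_rfl L hℓ hη] with γ hγ t ht
    unfold PsiCoCoercive PsiCoCoerciveZero
    split_ifs
    · rw [sub_self, abs_zero]; exact hη.le
    · exact hγ t ht

theorem inv_log_rhoBar_coCoercive_le (hm₁ : 0 < m₁) (hR : 0 < R₁) {gbar : ℝ}
    (hg0 : 0 < gbar) (hg1 : gbar ≤ 1) (hg : gbar * L ^ 2 < 2 * m₁) :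
    (Real.log (S.rhoBar L R₁ m₁ m₁ (PsiCoCoercive ⌈R₁ ^ 2⌉₊ R₁ L) ⌈R₁ ^ 2⌉₊ gbar)⁻¹)⁻¹ ≤
      (1 + Real.log 2 + Real.log (1 + 2 * (1 + R₁ ^ 2) * m₁) +
          2 * (1 + R₁ ^ 2) * (m₁ - gbar * L ^ 2 / 2)) /
        ((m₁ - gbar * L ^ 2 / 2) * Φ (-1 / 2)) := by
  obtain ⟨x, hx⟩ := S.exists_diag_mem_closePairs hR.le
  refine inv_log_rho_inv_le_explicit (by linarith) hm₁ ⟨hg0.le, hg1⟩ (S.B_mem hR) hR (Φ_pos _)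
    (S.le_epsBar hR hg0 fun γ _ t ht => ?_)
    ((S.epsBar_le (fun γ _ t ht => (PsiCoCoercive_mem _ R₁ L γ _ ht).1) ⟨hg0, le_rfl⟩ hx).trans
      (PsiCoCoercive_mem _ R₁ L gbar _ (norm_nonneg _)).2)
  rw [PsiCoCoercive, if_pos ⟨le_rfl, ht.2⟩]

theorem inv_log_rhoZero_coCoercive_le (hm₁ : 0 < m₁) (hR : 0 < R₁) :
    (Real.log (S.rhoZero R₁ m₁ m₁ (PsiCoCoerciveZero ⌈R₁ ^ 2⌉₊ R₁) ⌈R₁ ^ 2⌉₊)⁻¹)⁻¹ ≤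
      (1 + Real.log 2) / (m₁ * Φ (-1 / 2)) + 4 * (1 + R₁ ^ 2) / Φ (-1 / 2) := by
  have hΦ := Φ_pos (-1 / 2)
  have hψ : ∀ t ∈ Icc 0 R₁,
      PsiCoCoerciveZero ⌈R₁ ^ 2⌉₊ R₁ ⌈R₁ ^ 2⌉₊ t = 2 * Φ (-1 / 2) := fun t ht => by
    rw [PsiCoCoerciveZero, if_pos ⟨le_rfl, ht.2⟩]
  have h := inv_log_rho_inv_le_explicit hm₁ hm₁ ⟨le_rfl, zero_le_one⟩ (S.B_mem hR) hR hΦ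
    (S.le_epsInf hR fun t ht => (hψ t ht).ge)
    (S.epsInf_mem hR (mul_pos two_pos hΦ) fun t ht =>
      ⟨(hψ t ht).ge, (hψ t ht).le.trans (two_mul_Φ_le_one (by norm_num))⟩).2
  refine h.trans ?_
  have hlog : Real.log (1 + 2 * (1 + R₁ ^ 2) * m₁) ≤ 2 * (1 + R₁ ^ 2) * m₁ := by
    have := Real.log_le_sub_one_of_pos (by positivity : 0 < 1 + 2 * (1 + R₁ ^ 2) * m₁)
    linarith
  calc _ ≤ (1 + Real.log 2 + 4 * (1 + R₁ ^ 2) * m₁) / (m₁ * Φ (-1 / 2)) := by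
        refine div_le_div_of_nonneg_right ?_ (by positivity)
        linarith
    _ = _ := by field_simp

theorem inv_log_rhoZero_coCoercive_le_max (hm₁ : 0 < m₁) (hR : 1 ≤ R₁) :
    (Real.log (S.rhoZero R₁ m₁ m₁ (PsiCoCoerciveZero ⌈R₁ ^ 2⌉₊ R₁) ⌈R₁ ^ 2⌉₊)⁻¹)⁻¹ ≤
      (9 + Real.log 2) / Φ (-1 / 2) * max (R₁ ^ 2) (1 / m₁) := by
  have hΦ := Φ_pos (-1 / 2)
  refine (S.inv_log_rhoZero_coCoercive_le hm₁ (by linarith)).trans ?_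
  have h1 := le_max_left (R₁ ^ 2) (1 / m₁)
  have h2 := le_max_right (R₁ ^ 2) (1 / m₁)
  set M := max (R₁ ^ 2) (1 / m₁)
  have hl := Real.log_pos one_lt_two
  have h3 : (1 + Real.log 2) * (1 / m₁) + 4 * (1 + R₁ ^ 2) ≤ (9 + Real.log 2) * M := by
    have := mul_le_mul_of_nonneg_left h2 (by linarith : 0 ≤ 1 + Real.log 2)
    nlinarith
  calc _ = ((1 + Real.log 2) * (1 / m₁) + 4 * (1 + R₁ ^ 2)) / Φ (-1 / 2) := by field_simp
    _ ≤ (9 + Real.log 2) * M / Φ (-1 / 2) := by gcongr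
    _ = _ := by ring

end Scheme

end ProjEM

theorem theorem13 {d : ℕ} (S : Scheme d) (L R₁ m₁ : ℝ)
    (hLip : S.LipschitzDrift L) (hDis : S.DissipativeAtInfinity R₁ m₁) :
    -- under a one-sided Lipschitz condition with `m ≤ 0`
    (∀ m : ℝ, m ≤ 0 → S.OneSided m →
      (∀ gbar : ℝ, 0 < gbar → gbar * L ^ 2 < 2 * m₁ →
        S.Converges L R₁ m₁ (m₁ - m) (PsiOneSided m L) gbar) ∧
      (∀ ℓ : ℕ, 1 ≤ ℓ →
        S.HasLimits L R₁ m₁ (m₁ - m) (PsiOneSided m L) (PsiOneSidedZero m) ℓ) ∧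
      (1 < R₁ → ∀ gbar : ℝ, 0 < gbar → gbar ≤ 1 → gbar * L ^ 2 < 2 * m₁ →
        (Real.log (S.rhoBar L R₁ m₁ (m₁ - m) (PsiOneSided m L) ⌈R₁ ^ 2⌉₊ gbar)⁻¹)⁻¹ ≤
          (1 + Real.log 2 + Real.log (1 + 2 * (1 + R₁ ^ 2) * (m₁ - m)) +
              2 * (1 + R₁ ^ 2) * (m₁ - gbar * L ^ 2 / 2)) /
            ((m₁ - gbar * L ^ 2 / 2) *
              Φ (-(R₁ / (2 * √(Xi (kappa m L) gbar ⌈1 / gbar⌉₊)))))) ∧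
      (m < 0 →
        (Real.log (S.rhoZero R₁ m₁ (m₁ - m) (PsiOneSidedZero m) ⌈R₁ ^ 2⌉₊)⁻¹)⁻¹ ≤
          (1 + Real.log 2 + Real.log (1 + 2 * (1 + R₁ ^ 2) * (m₁ - m)) +
              2 * (1 + R₁ ^ 2) * m₁) /
            (m₁ * Φ (-(√(-m) * R₁ / √(2 - 2 * Real.exp (2 * m * R₁ ^ 2)))))) ∧
      (m = 0 →
        (Real.log (S.rhoZero R₁ m₁ (m₁ - m) (PsiOneSidedZero m) ⌈R₁ ^ 2⌉₊)⁻¹)⁻¹ ≤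
          (1 + Real.log 2 + Real.log (1 + 2 * (1 + R₁ ^ 2) * (m₁ - m)) +
              2 * (1 + R₁ ^ 2) * m₁) / (m₁ * Φ (-1 / 2)))) ∧
    -- under co-coercivity
    (∀ mb : ℝ, S.CoCoercive mb → ∀ N : ℕ, R₁ ^ 2 ≤ N →
      (∀ gbar : ℝ, 0 < gbar → gbar * L ^ 2 < 2 * m₁ → gbar ≤ 2 * mb →
        S.Converges L R₁ m₁ m₁ (PsiCoCoercive N R₁ L) gbar) ∧
      (∀ ℓ : ℕ, 1 ≤ ℓ →
        S.HasLimits L R₁ m₁ m₁ (PsiCoCoercive N R₁ L) (PsiCoCoerciveZero N R₁) ℓ) ∧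
      (N = ⌈R₁ ^ 2⌉₊ →
        (∀ gbar : ℝ, 0 < gbar → gbar ≤ 1 → gbar * L ^ 2 < 2 * m₁ → gbar ≤ 2 * mb →
          (Real.log (S.rhoBar L R₁ m₁ m₁ (PsiCoCoercive N R₁ L) ⌈R₁ ^ 2⌉₊ gbar)⁻¹)⁻¹ ≤
            (1 + Real.log 2 + Real.log (1 + 2 * (1 + R₁ ^ 2) * m₁) +
                2 * (1 + R₁ ^ 2) * (m₁ - gbar * L ^ 2 / 2)) /
              ((m₁ - gbar * L ^ 2 / 2) * Φ (-1 / 2))) ∧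
        (Real.log (S.rhoZero R₁ m₁ m₁ (PsiCoCoerciveZero N R₁) ⌈R₁ ^ 2⌉₊)⁻¹)⁻¹ ≤
          (1 + Real.log 2) / (m₁ * Φ (-1 / 2)) + 4 * (1 + R₁ ^ 2) / Φ (-1 / 2) ∧
        (1 ≤ R₁ →
          (Real.log (S.rhoZero R₁ m₁ m₁ (PsiCoCoerciveZero N R₁) ⌈R₁ ^ 2⌉₊)⁻¹)⁻¹ ≤
            (9 + Real.log 2) / Φ (-1 / 2) * max (R₁ ^ 2) (1 / m₁)))) := by
  have hR := hDis.1
  have hm₁ := hDis.2.1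
  refine ⟨fun m hm hone => ⟨fun gbar hg0 hg => S.converges_of_oneSided hLip hDis hm hone hg0 hg,
    fun ℓ hℓ => S.hasLimits_of_oneSided hR hm₁ hm hℓ,
    fun hR1 gbar hg0 hg1 hg => S.inv_log_rhoBar_oneSided_le hm₁ hm hR1 hg0 hg1 hg,
    fun hm0 => S.inv_log_rhoZero_oneSided_le hm₁ hm hR (Φ_pos _) (Φ_le_of_neg hm0 hR),
    fun hm0 => S.inv_log_rhoZero_oneSided_le hm₁ hm hR (Φ_pos _) ?_⟩,
    fun mb hco N hN => ⟨fun gbar hg0 hg hgm =>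
      S.converges_of_coCoercive hLip hDis hco hN hg0 hg hgm,
    fun ℓ hℓ => S.hasLimits_of_coCoercive hR hm₁ N hℓ, ?_⟩⟩
  · rw [XiZero, if_pos hm0]
    exact Φ_neg_half_le hR (Nat.le_ceil _) le_rfl
  · rintro rfl
    exact ⟨fun gbar hg0 hg1 hg _ => S.inv_log_rhoBar_coCoercive_le hm₁ hR hg0 hg1 hg,
      S.inv_log_rhoZero_coCoercive_le hm₁ hR,
      fun hR1 => S.inv_log_rhoZero_coCoercive_le_max hm₁ hR1⟩
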